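/- **Setting.** A scene consists of a vertical wall $x=n$ ($n$ a real number) and a (possibly infinite) set of axis-parallel rectangular obstacles with pairwise disjoint interiors, whose corners have integral $x$-coordinates and whose width and height are at least $1$. A point robot may not enter the interiors of obstacles, but may walk along their boundaries (and so squeeze between touching obstacles). Let $k\ge 1$ and $M\ge 1$ be integers and $n,L,\tau$ reals with $k\le n\le L$, $\tau=L/\sqrt{nk}$ and $(M-k)\tau\le 2L$ (for instance $M=k+2L/\tau$, if this is an integer). A *$\tau$-post* at $P$ is a vertical segment of height $2\tau$ centred at $P$ that is part of the left edge of an obstacle. The *$\tau$-path* from a point at height $y_0$ is the path of the robot that moves right along $y=y_0$; when it hits an obstacle whose nearest corner is less than $\tau$ away, it goes around that corner to the point at height $y_0$ on the opposite side and continues to the right; it stops when it hits a $\tau$-post or the wall. *Greedy down-left* means: go down until an obstacle is hit, then left to its corner, and repeat; *greedy right-down* means: go right until an obstacle is hit, then down to its corner, and repeat. **State.** The robot searches for posts $P_i^m=(X_i^m,Y_i^m)$ of fences $F_i$ ($1\le i\le k$, $1\le m\le M$). It keeps the number $i$ of the current fence (initially $1$), and for each fence $F_j$ the number $M_j$ of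 posts found so far and the $x$-coordinate $X_j=X_j^{M_j}$ of its last post. It starts at a $\tau$-post $P_1^1=(x_0,-L)$ with $0<x_0<n$; initially $M_1=1$, $X_1=x_0$, and $M_j=X_j=0$ for $j>1$. An up-edge (down-edge) from a post goes vertically up (down) a distance $\tau$ and then along a $\tau$-path. The *tree path* to a post is the path from $P_1^1$ to it along the edges by which the posts were found. **Procedure FindFenceTree** repeats the first of the following cases that applies. 1. If $i<k$, $X_i>X_{i+1}$ and $M_i>M_{i+1}+1$: perform GoBackDown$(i,M_i,M_{i+1})$; $i\leftarrow i+1$. 2. If $i<k$ and $X_i>X_{i+1}$: traverse the down-edge from the current post; if the wall is reached, halt; otherwise the post reached becomes the next post of $F_{i+1}$, and $i\leftarrow i+1$. 3. If $i=1$ and $M_1<M$, or $i>1$ and ($M_{i-1}>M_i+1$, or $M_{i-1}=M_i+1$ and $X_{i-1}\le X_i$): traverse the up-edge from the current post; if the wall is reached, halt; otherwise the post reached becomes the next post of $F_i$. 4. If $i<k$, $M_i>M_{i+1}$, and either $M_i=M$ or there is $u<i$ with $M_u=M_i+1$ and $X_u>X_{i+1}$: perform GoDown$(i,M_i,M_{i+1})$;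 $i\leftarrow i+1$. 5. If $i=k$ and $M_i=M$: halt. 6. Otherwise return to the last post of $F_{i-1}$ by the reverse of the last path that was used to get from it to the current post; $i\leftarrow i-1$. **GoDown$(i,m,q)$** (it ends at $P_{i+1}^q$): (1) go greedy down-left until $y\le Y_{i+1}^q+\tau$; (2) go greedy right-down until the post $P_{i+1}^q$ is touched (then move along it to its centre and return) or the tree path to $P_{i+1}^q$ is hit; (3) in the latter case follow the tree path to $P_{i+1}^q$. **GoBackDown$(i,m,q)$** (it starts at $P_i^m$ and ends at $P_{i+1}^q$): (1) follow the tree path backward until $x=X_{i+1}^q$; (2) go greedy down-left until either (a) the current point lies in the rectangle with opposite corners $P_j^{m-1},P_{j+1}^{m-1}$ for some $j<i$, in which case perform GoDown$(j,m-1,m-1)$, $j\leftarrow j+1$ until $j=i$, or (b) $y=Y_i^{m-1}$; (3) perform GoDown$(i,m-1,q)$. **Theorem 9.** Procedure FindFenceTree terminates, and the total distance the robot walks in it is at most $$k\,(60L+62\,\tau\,\Delta x),$$ where $\Delta x$ is the difference of the $x$-coordinates of the final and the initial position of the robot (that is, $X_k^M-X_1^1$ if the robot does not end at the wall, and $n-x_0$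 if it does). -/

import Mathlib

/-! ## Scenes -/

/-- Points of the plane.  The coordinates are `p.1` (rightwards) and `p.2` (upwards). -/
abbrev Pt : Type := ℝ × ℝ

/-- An axis-parallel rectangular obstacle: its corners have integral `x`-coordinates, and its
width and its height are at least `1`. -/
structure Obstacle where
  left : ℤ
  right : ℤ
  bot : ℝ
  top : ℝ
  width_pos : left + 1 ≤ right
  height_ge : bot + 1 ≤ top

/-- The points that the obstacle blocks.  The robot may walk along the boundary of an obstacle,
and hence squeeze between touching obstacles. -/
def Obstacle.interior (R : Obstacle) : Set Pt :=
  Set.Ioo (R.left : ℝ) (R.right : ℝ) ×ˢ Set.Ioo R.bot R.top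

/-- A scene: a vertical wall `x = n` and non-overlapping obstacles. -/
structure Scene where
  n : ℝ
  obstacles : Set Obstacle
  disjoint : obstacles.Pairwise fun R R' => Disjoint R.interior R'.interior

/-- The straight segment from `p` to `q` avoids the interiors of all obstacles. -/
def FreeSeg (S : Scene) (p q : Pt) : Prop :=
  ∀ R ∈ S.obstacles, Disjoint (segment ℝ p q) R.interior

/-- At `p`, the obstacle `R` blocks the motion to the right. -/
def BlocksRight (R : Obstacle) (p : Pt) : Prop :=
  (R.left : ℝ) = p.1 ∧ R.bot < p.2 ∧ p.2 < R.top

/-- At `p`, the obstacle `R` blocks the motion downwards. -/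
def BlocksDown (R : Obstacle) (p : Pt) : Prop :=
  R.top = p.2 ∧ (R.left : ℝ) < p.1 ∧ p.1 < (R.right : ℝ)

/-! ## Paths

A path is the list of the successive vertices of an axis-parallel polygonal line. -/

/-- Length of a path.  All the paths below are made of horizontal and vertical segments, for
which `|Δx| + |Δy|` is the Euclidean length. -/
def pathLen : List Pt → ℝ
  | [] => 0
  | [_] => 0
  | a :: b :: l => |b.1 - a.1| + |b.2 - a.2| + pathLen (b :: l)

/-- The points of a path. -/
def pathPts : List Pt → Set Pt
  | [] => ∅
  | [a] => {a}
  | a :: b :: l => segment ℝ a b ∪ pathPts (b :: l)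

/-- `π` is a final portion of the path `γ`, starting at the point `B` of `γ`. -/
def IsFinalPortion (γ : List Pt) (B : Pt) (π : List Pt) : Prop :=
  ∃ (γ₁ : List Pt) (a b : Pt) (γ₂ : List Pt),
    γ = γ₁ ++ a :: b :: γ₂ ∧ B ∈ segment ℝ a b ∧ π = B :: b :: γ₂

/-- `π` is what remains of the path `γ` from the point `B` on (from the last visit to `B`, if `γ`
visits `B` more than once). -/
def FollowFrom (γ : List Pt) (B : Pt) (π : List Pt) : Prop :=
  IsFinalPortion γ B π ∧ ∀ π', IsFinalPortion γ B π' → pathLen π ≤ pathLen π'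

/-- `π` is the final portion of `γ` that one traverses when one follows `γ` backward from its end
until the `x`-coordinate is `c` for the first time, which happens at the point `A`. -/
def BackUntil (γ : List Pt) (c : ℝ) (A : Pt) (π : List Pt) : Prop :=
  IsFinalPortion γ A π ∧ A.1 = c ∧ ∀ z ∈ pathPts π, z.1 = c → z = A

/-! ## Posts and `τ`-paths -/

/-- There is a `τ`-post at `p`: the vertical segment of height `2τ` centred at `p` is a portion of
the left edge of an obstacle. -/
def IsPost (S : Scene) (τ : ℝ) (p : Pt) : Prop :=
  ∃ R ∈ S.obstacles, (R.left : ℝ) = p.1 ∧ R.bot ≤ p.2 - τ ∧ p.2 + τ ≤ R.top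

/-- The segment occupied by the `τ`-post at `p`. -/
def postSeg (τ : ℝ) (p : Pt) : Set Pt :=
  {z | z.1 = p.1 ∧ |z.2 - p.2| ≤ τ}

/-- `c` is the `y`-coordinate of a corner of (the left edge of) `R` that is nearest to the point
`p` of that edge, and that corner is less than `τ` away from `p`. -/
def NearCorner (R : Obstacle) (τ : ℝ) (p : Pt) (c : ℝ) : Prop :=
  ((c = R.top ∧ R.top - p.2 ≤ p.2 - R.bot) ∨ (c = R.bot ∧ p.2 - R.bot ≤ R.top - p.2)) ∧
    |c - p.2| < τ

/-- `TauPath S τ p q π`: the `τ`-path that starts at `p` is `π`, and it ends at `q`, which is a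
`τ`-post or a point of the wall. -/
inductive TauPath (S : Scene) (τ : ℝ) : Pt → Pt → List Pt → Prop
  /-- A `τ`-post has been hit. -/
  | post (p : Pt) (hp : p.1 < S.n) (h : IsPost S τ p) : TauPath S τ p p [p]
  /-- The wall has been hit. -/
  | wall (p : Pt) (hp : p.1 = S.n) : TauPath S τ p p [p]
  /-- Move to the right until an obstacle or the wall is hit. -/
  | move (p q r : Pt) (π : List Pt) (hx : p.1 < q.1) (hy : q.2 = p.2) (hn : q.1 ≤ S.n)
      (hfree : FreeSeg S p q)
      (hend : (∃ R ∈ S.obstacles, BlocksRight R q) ∨ q.1 = S.n)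
      (hrest : TauPath S τ q r π) : TauPath S τ p r (p :: π)
  /-- Go around the nearest corner of the obstacle `R`, to the point on the opposite side that is
  level with `p`. -/
  | around (p r : Pt) (R : Obstacle) (c : ℝ) (π : List Pt) (hR : R ∈ S.obstacles)
      (hblock : BlocksRight R p) (hc : NearCorner R τ p c) (hn : (R.right : ℝ) < S.n)
      (hrest : TauPath S τ ((R.right : ℝ), p.2) r π) :
      TauPath S τ p r (p :: (p.1, c) :: ((R.right : ℝ), c) :: π)
  /-- The same, when the wall is reached on the way around `R`. -/
  | aroundToWall (p : Pt) (R : Obstacle) (c : ℝ) (hR : R ∈ S.obstacles)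
      (hblock : BlocksRight R p) (hc : NearCorner R τ p c) (hp : p.1 < S.n)
      (hn : S.n ≤ (R.right : ℝ)) :
      TauPath S τ p (S.n, c) [p, (p.1, c), (S.n, c)]

/-! ## Greedy paths -/

/-- `GreedyDownLeft S C p r π`: going greedy down-left from `p` (down until an obstacle is hit,
then left to the corner of the obstacle, and so on) until a point of `C` is reached, the robot
walks along `π` and stops at `r`. -/
inductive GreedyDownLeft (S : Scene) (C : Set Pt) : Pt → Pt → List Pt → Prop
  | reached (p : Pt) (h : p ∈ C) : GreedyDownLeft S C p p [p]
  | down (p q r : Pt) (π : List Pt) (hx : q.1 = p.1) (hy : q.2 < p.2)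
      (hfree : FreeSeg S p q)
      (hfirst : ∀ z ∈ segment ℝ p q, z ∈ C → z = q)
      (hend : q ∈ C ∨ ∃ R ∈ S.obstacles, BlocksDown R q)
      (hrest : GreedyDownLeft S C q r π) : GreedyDownLeft S C p r (p :: π)
  | left (p q r : Pt) (R : Obstacle) (π : List Pt) (hR : R ∈ S.obstacles)
      (hblock : BlocksDown R p) (hx : q.1 < p.1) (hx' : (R.left : ℝ) ≤ q.1) (hy : q.2 = p.2)
      (hfirst : ∀ z ∈ segment ℝ p q, z ∈ C → z = q)
      (hend : q ∈ C ∨ q.1 = (R.left : ℝ))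
      (hrest : GreedyDownLeft S C q r π) : GreedyDownLeft S C p r (p :: π)

/-- `GreedyRightDown S C p r π`: going greedy right-down from `p` (right until an obstacle is hit,
then down to the corner of the obstacle, and so on) until a point of `C` is reached, the robot
walks along `π` and stops at `r`. -/
inductive GreedyRightDown (S : Scene) (C : Set Pt) : Pt → Pt → List Pt → Prop
  | reached (p : Pt) (h : p ∈ C) : GreedyRightDown S C p p [p]
  | right (p q r : Pt) (π : List Pt) (hx : p.1 < q.1) (hy : q.2 = p.2)
      (hfree : FreeSeg S p q)
      (hfirst : ∀ z ∈ segment ℝ p q, z ∈ C → z = q)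
      (hend : q ∈ C ∨ ∃ R ∈ S.obstacles, BlocksRight R q)
      (hrest : GreedyRightDown S C q r π) : GreedyRightDown S C p r (p :: π)
  | down (p q r : Pt) (R : Obstacle) (π : List Pt) (hR : R ∈ S.obstacles)
      (hblock : BlocksRight R p) (hx : q.1 = p.1) (hy : q.2 < p.2) (hy' : R.bot ≤ q.2)
      (hfirst : ∀ z ∈ segment ℝ p q, z ∈ C → z = q)
      (hend : q ∈ C ∨ q.2 = R.bot)
      (hrest : GreedyRightDown S C q r π) : GreedyRightDown S C p r (p :: π)

/-! ## The state of the procedure -/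

/-- The state of the procedure.  Fences and posts are numbered from `1`. -/
structure RobotState where
  /-- current position of the robot -/
  pos : Pt
  /-- number `i` of the current fence -/
  cur : ℕ
  /-- `cnt j` is the number of posts found so far on fence `j` -/
  cnt : ℕ → ℕ
  /-- `post j m` is the `m`-th post of fence `j`, once found -/
  post : ℕ → ℕ → Pt
  /-- `treePath j m` is the path in the tree from the root to the `m`-th post of fence `j` -/
  treePath : ℕ → ℕ → List Pt
  /-- `lastPath j` is the last path used to get from the last post of fence `j - 1` to the last
  post of fence `j` -/
  lastPath : ℕ → List Pt
  /-- total distance walked so far -/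
  dist : ℝ
  /-- whether the procedure has halted -/
  halted : Bool

/-- The variable `X_j`: the `x`-coordinate of the last post found on fence `j`, and `0` as long as
there is none (see `initState`). -/
def RobotState.X (s : RobotState) (j : ℕ) : ℝ := (s.post j (s.cnt j)).1

/-- Initially the robot is at the root, which is the first post of fence `1`; nothing else has
been found, and the variables `M_j` and `X_j` of the other fences are `0`. -/
noncomputable def initState (root : Pt) : RobotState where
  pos := root
  cur := 1
  cnt := fun j => if j = 1 then 1 else 0
  post := fun j m => if j = 1 ∧ m = 1 then root else (0, 0)
  treePath := fun j m => if j = 1 ∧ m = 1 then [root] else []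
  lastPath := fun j => if j = 1 then [root] else []
  dist := 0
  halted := false

/-- Record a new post `p` on fence `j`, with the tree path `γ` from the root to it. -/
def RobotState.addPost (s : RobotState) (j : ℕ) (p : Pt) (γ : List Pt) : RobotState :=
  { s with
    cnt := Function.update s.cnt j (s.cnt j + 1)
    post := Function.update s.post j (Function.update (s.post j) (s.cnt j + 1) p)
    treePath := Function.update s.treePath j (Function.update (s.treePath j) (s.cnt j + 1) γ) }

/-- The robot walks along the path `π`, which ends at `p`. -/
def RobotState.walk (s : RobotState) (π : List Pt) (p : Pt) : RobotState :=
  { s with pos := p, dist := s.dist + pathLen π }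

/-- Make `i` the current fence. -/
def RobotState.setCur (s : RobotState) (i : ℕ) : RobotState :=
  { s with cur := i }

/-- Record `π` as the last path used to get to (the last post of) fence `j`. -/
def RobotState.setLastPath (s : RobotState) (j : ℕ) (π : List Pt) : RobotState :=
  { s with lastPath := Function.update s.lastPath j π }

/-- Halt. -/
def RobotState.halt (s : RobotState) : RobotState :=
  { s with halted := true }

/-! ## The subroutines -/

/-- `GoDown S τ s i q p π`: the robot, starting at `p` (near some post of fence `i`), performs
`GoDown (i, _, q)`, and thereby walks along `π` to the `q`-th post of fence `i + 1`.

1. Go greedy down-left until `y ≤ Y_{i+1}^q + τ`.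
2. Go greedy right-down until the post `P_{i+1}^q` is reached (then move along the post to its
   centre, and return) or an edge is hit that leads to `P_{i+1}^q`.
3. Follow the edges to the right until `P_{i+1}^q` is reached. -/
def GoDown (S : Scene) (τ : ℝ) (s : RobotState) (i q : ℕ) (p : Pt) (π : List Pt) : Prop :=
  ∃ (A B : Pt) (π₁ π₂ π₃ : List Pt),
    GreedyDownLeft S {z | z.2 ≤ (s.post (i + 1) q).2 + τ} p A π₁ ∧
    GreedyRightDown S (postSeg τ (s.post (i + 1) q) ∪ pathPts (s.treePath (i + 1) q)) A B π₂ ∧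
    ((B ∈ postSeg τ (s.post (i + 1) q) ∧ π₃ = [B, s.post (i + 1) q]) ∨
      (B ∉ postSeg τ (s.post (i + 1) q) ∧ FollowFrom (s.treePath (i + 1) q) B π₃)) ∧
    π = π₁ ++ π₂ ++ π₃

/-- `GoDownRepeat S τ s i m j p r π`: starting at `p`, perform `GoDown (j, m, m)` and increase `j`
by one, until `j = i`; the robot walks along `π` and ends at `r`. -/
inductive GoDownRepeat (S : Scene) (τ : ℝ) (s : RobotState) (i m : ℕ) :
    ℕ → Pt → Pt → List Pt → Prop
  | done (p : Pt) : GoDownRepeat S τ s i m i p p [p]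
  | call (j : ℕ) (p r : Pt) (π π' : List Pt) (hj : j < i) (h : GoDown S τ s j m p π)
      (hrest : GoDownRepeat S τ s i m (j + 1) (s.post (j + 1) m) r π') :
      GoDownRepeat S τ s i m j p r (π ++ π')

/-- The rectangle whose opposite corners are the centres of the `m`-th posts of the fences `j` and
`j + 1`. -/
def postRect (s : RobotState) (j m : ℕ) : Set Pt :=
  Set.uIcc (s.post j m) (s.post (j + 1) m)

/-- `GoBackDown S τ s i m q π`: the robot, starting at the `m`-th post of fence `i`, performs
`GoBackDown (i, m, q)`, and thereby walks along `π` to the `q`-th post of fence `i + 1`.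

1. Follow the tree path backward until `x = X_{i+1}^q`.
2. Go greedy down-left until either
   (a) the current point is in the rectangle spanned by `P_j^{m-1}` and `P_{j+1}^{m-1}`, for some
       `j < i`; in this case do the following until `j = i`: `GoDown (j, m-1, m-1)`, `j ← j + 1`;
   or (b) `y = Y_i^{m-1}`.
3. `GoDown (i, m-1, q)`. -/
def GoBackDown (S : Scene) (τ : ℝ) (s : RobotState) (i m q : ℕ) (π : List Pt) : Prop :=
  ∃ (A C D : Pt) (π₁ π₂ π₃ π₄ : List Pt),
    BackUntil (s.treePath i m) (s.post (i + 1) q).1 A π₁ ∧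
    GreedyDownLeft S
      {z | (∃ j, 1 ≤ j ∧ j < i ∧ z ∈ postRect s j (m - 1)) ∨ z.2 = (s.post i (m - 1)).2}
      A C π₂ ∧
    ((∃ j, 1 ≤ j ∧ j < i ∧ C ∈ postRect s j (m - 1) ∧
        GoDownRepeat S τ s i (m - 1) j C D π₃) ∨
      (C.2 = (s.post i (m - 1)).2 ∧ D = C ∧ π₃ = [C])) ∧
    GoDown S τ s i q D π₄ ∧
    π = π₁.reverse ++ π₂ ++ π₃ ++ π₄

/-! ## The procedure `FindFenceTree`

`k` is the number of fences and `M` the number of posts of each fence. -/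

/-- Condition of case 1: the current fence is ahead of the next lower fence, and the latter can be
extended from itself. -/
def Case1 (k : ℕ) (s : RobotState) : Prop :=
  s.cur < k ∧ s.X (s.cur + 1) < s.X s.cur ∧ s.cnt (s.cur + 1) + 1 < s.cnt s.cur

/-- Condition of case 2: the current fence is ahead of the next lower fence. -/
def Case2 (k : ℕ) (s : RobotState) : Prop :=
  s.cur < k ∧ s.X (s.cur + 1) < s.X s.cur

/-- Condition of case 3: the current fence can be extended from itself. -/
def Case3 (M : ℕ) (s : RobotState) : Prop :=
  (s.cur = 1 ∧ s.cnt s.cur < M) ∨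
    (1 < s.cur ∧
      (s.cnt s.cur + 1 < s.cnt (s.cur - 1) ∨
        (s.cnt (s.cur - 1) = s.cnt s.cur + 1 ∧ s.X (s.cur - 1) ≤ s.X s.cur)))

/-- Condition of case 4: the next lower fence can be extended from itself, and either the current
fence is completed, or it is determined that its next post will be ahead of the last post of the
next lower fence. -/
def Case4 (k M : ℕ) (s : RobotState) : Prop :=
  s.cur < k ∧ s.cnt (s.cur + 1) < s.cnt s.cur ∧
    (s.cnt s.cur = M ∨
      ∃ u, 1 ≤ u ∧ u < s.cur ∧ s.cnt u = s.cnt s.cur + 1 ∧ s.X (s.cur + 1) < s.X u)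

/-- Condition of case 5: the last post of the lowest fence has been found. -/
def Case5 (k M : ℕ) (s : RobotState) : Prop :=
  s.cur = k ∧ s.cnt s.cur = M

/-- One iteration of the procedure: the action of the first case that applies. -/
inductive FindFenceTreeStep (S : Scene) (τ : ℝ) (k M : ℕ) : RobotState → RobotState → Prop
  /-- Case 1: `GoBackDown (i, M_i, M_{i+1})`, `i ← i + 1`. -/
  | case1 (s : RobotState) (π : List Pt) (hrun : s.halted = false)
      (h : Case1 k s)
      (hgo : GoBackDown S τ s s.cur (s.cnt s.cur) (s.cnt (s.cur + 1)) π) :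
      FindFenceTreeStep S τ k M s
        (((s.walk π (s.post (s.cur + 1) (s.cnt (s.cur + 1)))).setLastPath
          (s.cur + 1) π).setCur (s.cur + 1))
  /-- Case 2: traverse a new down-edge, which ends at a post. -/
  | case2 (s : RobotState) (p : Pt) (π : List Pt) (hrun : s.halted = false)
      (h1 : ¬ Case1 k s) (h : Case2 k s)
      (hgo : TauPath S τ (s.pos.1, s.pos.2 - τ) p π) (hp : p.1 < S.n) :
      FindFenceTreeStep S τ k M s
        ((((s.walk (s.pos :: π) p).addPost
          (s.cur + 1) p (s.treePath s.cur (s.cnt s.cur) ++ s.pos :: π)).setLastPath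
          (s.cur + 1) (s.pos :: π)).setCur (s.cur + 1))
  /-- Case 2, when the wall is reached. -/
  | case2Wall (s : RobotState) (p : Pt) (π : List Pt) (hrun : s.halted = false)
      (h1 : ¬ Case1 k s) (h : Case2 k s)
      (hgo : TauPath S τ (s.pos.1, s.pos.2 - τ) p π) (hp : p.1 = S.n) :
      FindFenceTreeStep S τ k M s (s.walk (s.pos :: π) p).halt
  /-- Case 3: traverse a new up-edge, which ends at a post. -/
  | case3 (s : RobotState) (p : Pt) (π : List Pt) (hrun : s.halted = false)
      (h2 : ¬ Case2 k s) (h : Case3 M s)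
      (hgo : TauPath S τ (s.pos.1, s.pos.2 + τ) p π) (hp : p.1 < S.n) :
      FindFenceTreeStep S τ k M s
        (((s.walk (s.pos :: π) p).addPost
          s.cur p (s.treePath s.cur (s.cnt s.cur) ++ s.pos :: π)).setLastPath
          s.cur (s.lastPath s.cur ++ s.pos :: π))
  /-- Case 3, when the wall is reached. -/
  | case3Wall (s : RobotState) (p : Pt) (π : List Pt) (hrun : s.halted = false)
      (h2 : ¬ Case2 k s) (h : Case3 M s)
      (hgo : TauPath S τ (s.pos.1, s.pos.2 + τ) p π) (hp : p.1 = S.n) :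
      FindFenceTreeStep S τ k M s (s.walk (s.pos :: π) p).halt
  /-- Case 4: `GoDown (i, M_i, M_{i+1})`, `i ← i + 1`. -/
  | case4 (s : RobotState) (π : List Pt) (hrun : s.halted = false)
      (h2 : ¬ Case2 k s) (h3 : ¬ Case3 M s) (h : Case4 k M s)
      (hgo : GoDown S τ s s.cur (s.cnt (s.cur + 1)) s.pos π) :
      FindFenceTreeStep S τ k M s
        (((s.walk π (s.post (s.cur + 1) (s.cnt (s.cur + 1)))).setLastPath
          (s.cur + 1) π).setCur (s.cur + 1))
  /-- Case 5: halt. -/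
  | case5 (s : RobotState) (hrun : s.halted = false)
      (h2 : ¬ Case2 k s) (h3 : ¬ Case3 M s) (h4 : ¬ Case4 k M s) (h : Case5 k M s) :
      FindFenceTreeStep S τ k M s s.halt
  /-- Case 6: return to the last post of fence `i - 1` by the last path that was used to get to
  the current point; `i ← i - 1`. -/
  | case6 (s : RobotState) (hrun : s.halted = false)
      (h2 : ¬ Case2 k s) (h3 : ¬ Case3 M s) (h4 : ¬ Case4 k M s) (h5 : ¬ Case5 k M s)
      (hi : 1 < s.cur) :
      FindFenceTreeStep S τ k M s
        ((s.walk (s.lastPath s.cur).reverse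
          (s.post (s.cur - 1) (s.cnt (s.cur - 1)))).setCur (s.cur - 1))

/-- The state `s` occurs in an execution of the procedure that starts at the post `root`. -/
def Reachable (S : Scene) (τ : ℝ) (k M : ℕ) (root : Pt) (s : RobotState) : Prop :=
  Relation.ReflTransGen (FindFenceTreeStep S τ k M) (initState root) s

/-- Every execution of the procedure that starts at the post `root` terminates: it never gets
stuck before it halts, and it does not run forever. -/
def Terminates (S : Scene) (τ : ℝ) (k M : ℕ) (root : Pt) : Prop :=
  (∀ s, Reachable S τ k M root s → s.halted = false → ∃ s', FindFenceTreeStep S τ k M s s') ∧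
    ¬ ∃ f : ℕ → RobotState, f 0 = initState root ∧ ∀ j, FindFenceTreeStep S τ k M (f j) (f (j + 1))

/-! ## Segments and obstacles -/

/-! The bound is an amortised one. Returns retrace recorded paths, so forward walking is counted
twice: `StateInv.cost` keeps the distance walked plus the lengths of the paths still to be retraced
below twice a potential, `totalCost`. Each fence contributes to it multiples of τ·(a number of
posts) and of τ·(an abscissa minus x₀). Hence `totalCost_le` bounds it by k(19/2·Mτ + 15τΔx), and Mτ
≤ 3L yields 57L + 30τΔx per fence after doubling. The slack up to 60L + 62τΔx pays for a last edge
that ends at the wall.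

Edges. A detour around an obstacle costs less than 2τ vertically, and obstacles are at least 1 wide,
so an edge of horizontal extent Δ has length at most τ + (1+2τ)Δ (`IsEdge.pathLen_le`). This is
charged to `fenceCost`.

Geometry of the calls. Every edge starts at the rightmost of the two possible predecessors of the
new post, so abscissae increase in both indices (`FenceTree.fst_mono`). Successive posts of a fence
overlap vertically, so their obstacles form a gapless barrier leaning to the right
(`isBarrier_fenceObstacles`), which a greedy down-left path cannot cross. Therefore phase one of
`GoDown` ends at a point from which the greedy right-down path cannot miss the tree path or the
target post. Following the tree path from there is cheap unless it climbs through many posts to the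
right of the starting point (`FenceTree.exists_final_cheap`, `GoDown.spec`). In `GoBackDown` the
backward walk ends near a post `P v (μ+1)` heading a chain of down-edges; the descent is then caught
by the staircase of rectangles spanned by the posts number μ (`GreedyDownLeft.stairs`,
`GoBackDown.spec`).

Amortisation of the calls. When fence i calls fence i+1 again, the latter has caught up with the
source of the previous call, and the posts up to the previous target are left of the post that now
matters. So the costs are charged to increments of `src`, `tgt`, `tgtX` and `srcX`
(`CallInv.src_le_of_call`, `CallInv.tgtX_lt`, `CallInv.srcX_le`). The intermediate fences crossed by
`GoBackDown` are charged to `chain` and `chainX`; `CallInv.chain_lt` shows that successive crossings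
of a fence use strictly increasing post numbers.

Termination. New posts are limited by kM. After a call an up-edge is the next action, and otherwise
the fence number decreases, so finitely many steps lie between two new posts
(`StateInv.progress_lt`). Existence of all greedy paths, τ-paths and calls gives
`StateInv.exists_step`. -/

theorem mem_segment_of_snd_eq {p q z : Pt} (h : q.2 = p.2) :
    z ∈ segment ℝ p q ↔ z.2 = p.2 ∧ z.1 ∈ Set.uIcc p.1 q.1 := by
  obtain ⟨p1, p2⟩ := p
  obtain ⟨q1, q2⟩ := q
  obtain ⟨z1, z2⟩ := z
  simp only at h
  subst h
  rw [← Prod.image_mk_segment_left, ← segment_eq_uIcc]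
  simp only [Set.mem_image, Prod.mk.injEq]
  constructor
  · rintro ⟨x, h, rfl, rfl⟩; exact ⟨rfl, h⟩
  · rintro ⟨rfl, h⟩; exact ⟨z1, h, rfl, rfl⟩

theorem mem_segment_of_fst_eq {p q z : Pt} (h : q.1 = p.1) :
    z ∈ segment ℝ p q ↔ z.1 = p.1 ∧ z.2 ∈ Set.uIcc p.2 q.2 := by
  obtain ⟨p1, p2⟩ := p
  obtain ⟨q1, q2⟩ := q
  obtain ⟨z1, z2⟩ := z
  simp only at h
  subst h
  rw [← Prod.image_mk_segment_right, ← segment_eq_uIcc]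
  simp only [Set.mem_image, Prod.mk.injEq]
  constructor
  · rintro ⟨x, h, rfl, rfl⟩; exact ⟨rfl, h⟩
  · rintro ⟨rfl, h⟩; exact ⟨z2, h, rfl, rfl⟩

theorem fst_mem_uIcc_of_mem_segment {p q z : Pt} (h : z ∈ segment ℝ p q) :
    z.1 ∈ Set.uIcc p.1 q.1 := by
  rw [← segment_eq_uIcc]
  exact (Prod.segment_subset p q h).1

theorem snd_mem_uIcc_of_mem_segment {p q z : Pt} (h : z ∈ segment ℝ p q) :
    z.2 ∈ Set.uIcc p.2 q.2 := by
  rw [← segment_eq_uIcc]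
  exact (Prod.segment_subset p q h).2

theorem mem_segment_right_iff {p q z : Pt} (h : q.2 = p.2) (hx : p.1 ≤ q.1) :
    z ∈ segment ℝ p q ↔ z.2 = p.2 ∧ p.1 ≤ z.1 ∧ z.1 ≤ q.1 := by
  rw [mem_segment_of_snd_eq h, Set.uIcc_of_le hx, Set.mem_Icc]

theorem mem_segment_left_iff {p q z : Pt} (h : q.2 = p.2) (hx : q.1 ≤ p.1) :
    z ∈ segment ℝ p q ↔ z.2 = p.2 ∧ q.1 ≤ z.1 ∧ z.1 ≤ p.1 := by
  rw [mem_segment_of_snd_eq h, Set.uIcc_of_ge hx, Set.mem_Icc]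

theorem mem_segment_down_iff {p q z : Pt} (h : q.1 = p.1) (hy : q.2 ≤ p.2) :
    z ∈ segment ℝ p q ↔ z.1 = p.1 ∧ q.2 ≤ z.2 ∧ z.2 ≤ p.2 := by
  rw [mem_segment_of_fst_eq h, Set.uIcc_of_ge hy, Set.mem_Icc]

theorem Obstacle.left_lt_right (R : Obstacle) : (R.left : ℝ) + 1 ≤ R.right := by
  exact_mod_cast R.width_pos

/-- Overlapping coordinate ranges produce a common interior point. This is the form in which
disjointness of the obstacles is used everywhere below. -/
theorem Scene.eq_of_overlap (S : Scene) {R R' : Obstacle} (hR : R ∈ S.obstacles)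
    (hR' : R' ∈ S.obstacles) (h1 : (R.left : ℝ) < R'.right) (h2 : (R'.left : ℝ) < R.right)
    (h3 : R.bot < R'.top) (h4 : R'.bot < R.top) : R = R' := by
  by_contra hne
  have hd := S.disjoint hR hR' hne
  have w := R.left_lt_right
  have w' := R'.left_lt_right
  have t := R.height_ge
  have t' := R'.height_ge
  obtain ⟨x, hx1, hx2⟩ := exists_between
    (show max (R.left : ℝ) R'.left < min (R.right : ℝ) R'.right by
      rw [max_lt_iff, lt_min_iff, lt_min_iff]; exact ⟨⟨by linarith, h1⟩, h2, by linarith⟩)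
  obtain ⟨y, hy1, hy2⟩ := exists_between
    (show max R.bot R'.bot < min R.top R'.top by
      rw [max_lt_iff, lt_min_iff, lt_min_iff]; exact ⟨⟨by linarith, h3⟩, h4, by linarith⟩)
  rw [max_lt_iff] at hx1 hy1
  rw [lt_min_iff] at hx2 hy2
  refine Set.disjoint_left.1 hd (?_ : ((x, y) : Pt) ∈ R.interior) (?_ : ((x, y) : Pt) ∈ R'.interior)
  · exact ⟨⟨hx1.1, hx2.1⟩, hy1.1, hy2.1⟩
  · exact ⟨⟨hx1.2, hx2.2⟩, hy1.2, hy2.2⟩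

/-- The point `p` is not in the interior of an obstacle. -/
def Scene.Free (S : Scene) (p : Pt) : Prop := ∀ R ∈ S.obstacles, p ∉ R.interior

theorem Obstacle.mem_interior {R : Obstacle} {p : Pt} : p ∈ R.interior ↔
    ((R.left : ℝ) < p.1 ∧ p.1 < R.right) ∧ R.bot < p.2 ∧ p.2 < R.top := Iff.rfl

/-- Boundary points of obstacles are free. -/
theorem Scene.free_of_mem_closed (S : Scene) {R : Obstacle} (hR : R ∈ S.obstacles) {p : Pt}
    (h1 : (R.left : ℝ) ≤ p.1) (h2 : p.1 ≤ R.right) (h3 : R.bot ≤ p.2) (h4 : p.2 ≤ R.top)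
    (hp : p ∉ R.interior) : S.Free p := by
  intro R' hR' hmem
  obtain ⟨⟨a1, a2⟩, a3, a4⟩ := Obstacle.mem_interior.1 hmem
  have := S.eq_of_overlap hR hR' (by linarith) (by linarith) (by linarith) (by linarith)
  exact hp (this ▸ hmem)

theorem Scene.free_of_freeSeg (S : Scene) {p q z : Pt} (h : FreeSeg S p q)
    (hz : z ∈ segment ℝ p q) : S.Free z := fun R hR hmem =>
  Set.disjoint_left.1 (h R hR) hz hmem

theorem freeSeg_mono {S : Scene} {p q a b : Pt} (h : FreeSeg S p q) (ha : a ∈ segment ℝ p q)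
    (hb : b ∈ segment ℝ p q) : FreeSeg S a b := fun R hR =>
  (h R hR).mono_left ((convex_segment p q).segment_subset ha hb)

/-- The first point, on the way from `p` to `q`, of a closed set, or `q` if there is none. -/
theorem exists_first_mem_segment {C : Set Pt} (hC : IsClosed C) (p q : Pt) (hp : p ∉ C)
    (hpq : p ≠ q) :
    ∃ z ∈ segment ℝ p q, z ≠ p ∧ (∀ w ∈ segment ℝ p z, w ∈ C → w = z) ∧ (z ∈ C ∨ z = q) := by
  by_cases hne : (segment ℝ p q ∩ C).Nonempty
  · have hcomp : IsCompact (segment ℝ p q ∩ C) := by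
      have : IsCompact (segment ℝ p q) := by
        rw [segment_eq_image_lineMap]
        exact isCompact_Icc.image (by fun_prop)
      exact this.inter_right hC
    obtain ⟨z, hz, hmin⟩ := hcomp.exists_isMinOn hne (f := fun w => dist p w) (by fun_prop)
    refine ⟨z, hz.1, ?_, ?_, Or.inl hz.2⟩
    · rintro rfl; exact hp hz.2
    · intro w hw hwC
      have h1 : dist p z ≤ dist p w :=
        hmin ⟨(convex_segment p q).segment_subset (left_mem_segment ℝ p q) hz.1 hw, hwC⟩
      have h2 := dist_add_dist_of_mem_segment hw
      have h3 : dist w z ≤ 0 := by linarith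
      exact dist_le_zero.1 h3
  · refine ⟨q, right_mem_segment ℝ p q, hpq.symm, ?_, Or.inr rfl⟩
    intro w hw hwC
    exact absurd ⟨w, hw, hwC⟩ hne

/-- Moving right from a free point until an obstacle or the line `x = X` is hit. -/
theorem Scene.exists_move_right (S : Scene) {p : Pt} (hp : S.Free p) {X : ℝ} (hX : p.1 < X)
    (hb : ∀ R ∈ S.obstacles, ¬ BlocksRight R p) :
    ∃ q : Pt, p.1 < q.1 ∧ q.2 = p.2 ∧ q.1 ≤ X ∧ FreeSeg S p q ∧
      ((∃ R ∈ S.obstacles, BlocksRight R q) ∨ q.1 = X) := by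
  have key : ∀ q : Pt, q.2 = p.2 → p.1 < q.1 →
      (∀ R ∈ S.obstacles, R.bot < p.2 → p.2 < R.top → p.1 < (R.left : ℝ) → q.1 ≤ R.left) →
      FreeSeg S p q := by
    intro q h2 h1 h R hR
    rw [Set.disjoint_left]
    intro z hz hzR
    rw [mem_segment_right_iff h2 h1.le] at hz
    obtain ⟨⟨a1, a2⟩, a3, a4⟩ := Obstacle.mem_interior.1 hzR
    obtain ⟨b1, b2, b3⟩ := hz
    rw [b1] at a3 a4
    rcases lt_trichotomy p.1 (R.left : ℝ) with hlt | heq | hgt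
    · have := h R hR a3 a4 hlt; linarith
    · exact hb R hR ⟨heq.symm, a3, a4⟩
    · exact hp R hR ⟨⟨hgt, by linarith⟩, a3, a4⟩
  by_cases hex : ∃ l : ℤ, (∃ R ∈ S.obstacles, R.bot < p.2 ∧ p.2 < R.top ∧ R.left = l) ∧
      p.1 < (l : ℝ) ∧ (l : ℝ) ≤ X
  -- Left edges have integral abscissae, so a first one to the right of `p` exists even among
  -- infinitely many obstacles.
  · obtain ⟨l, ⟨⟨R, hR, h1, h2, rfl⟩, h3, h4⟩, hmin⟩ := Int.exists_least_of_bdd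
      (P := fun l : ℤ => (∃ R ∈ S.obstacles, R.bot < p.2 ∧ p.2 < R.top ∧ R.left = l) ∧
        p.1 < (l : ℝ) ∧ (l : ℝ) ≤ X) ⟨⌊p.1⌋, fun z hz => by
          have : p.1 < (z : ℝ) := hz.2.1
          have h := (Int.floor_le p.1).trans_lt this
          exact_mod_cast h.le⟩ hex
    refine ⟨((R.left : ℝ), p.2), h3, rfl, h4, key _ rfl h3 ?_, Or.inl ⟨R, hR, rfl, h1, h2⟩⟩
    intro R' hR' a b c
    by_contra hlt
    push Not at hlt
    have := hmin R'.left ⟨⟨R', hR', a, b, rfl⟩, c, by simp only at hlt; linarith⟩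
    simp only at hlt
    have h : (R.left : ℝ) ≤ R'.left := by exact_mod_cast this
    linarith
  · refine ⟨(X, p.2), hX, rfl, le_rfl, key _ rfl hX ?_, Or.inr rfl⟩
    intro R hR a b c
    by_contra hlt
    push Not at hlt
    exact hex ⟨R.left, ⟨R, hR, a, b, rfl⟩, c, hlt.le⟩

/-- Moving down from a free point until an obstacle or the line `y = Y` is hit. -/
theorem Scene.exists_move_down (S : Scene) {p : Pt} (hp : S.Free p) {Y : ℝ} (hY : Y < p.2)
    (hb : ∀ R ∈ S.obstacles, ¬ BlocksDown R p) :
    ∃ q : Pt, q.1 = p.1 ∧ q.2 < p.2 ∧ Y ≤ q.2 ∧ FreeSeg S p q ∧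
      ((∃ R ∈ S.obstacles, BlocksDown R q) ∨ q.2 = Y) := by
  have key : ∀ q : Pt, q.1 = p.1 → q.2 < p.2 →
      (∀ R ∈ S.obstacles, (R.left : ℝ) < p.1 → p.1 < R.right → R.top < p.2 → R.top ≤ q.2) →
      FreeSeg S p q := by
    intro q h1 h2 h R hR
    rw [Set.disjoint_left]
    intro z hz hzR
    rw [mem_segment_down_iff h1 h2.le] at hz
    obtain ⟨⟨a1, a2⟩, a3, a4⟩ := Obstacle.mem_interior.1 hzR
    obtain ⟨b1, b2, b3⟩ := hz
    rw [b1] at a1 a2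
    rcases lt_trichotomy p.2 R.top with hlt | heq | hgt
    · exact hp R hR ⟨⟨a1, a2⟩, by linarith, hlt⟩
    · exact hb R hR ⟨heq.symm, a1, a2⟩
    · have := h R hR a1 a2 hgt; linarith
  by_cases hex : ∃ R ∈ S.obstacles, (R.left : ℝ) < p.1 ∧ p.1 < R.right ∧ R.top < p.2 ∧ Y ≤ R.top
  · -- The tops of the obstacles on this vertical line are at least `1` apart.
    classical
    obtain ⟨N, ⟨R, hR, r1, r2, r3, r4, r5⟩, hmin⟩ := Nat.findX (p := fun N : ℕ =>
      ∃ R ∈ S.obstacles, (R.left : ℝ) < p.1 ∧ p.1 < R.right ∧ R.top < p.2 ∧ Y ≤ R.top ∧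
        p.2 - R.top ≤ N) (by
          obtain ⟨R, hR, r1, r2, r3, r4⟩ := hex
          obtain ⟨N, hN⟩ := exists_nat_ge (p.2 - R.top)
          exact ⟨N, R, hR, r1, r2, r3, r4, hN⟩)
    refine ⟨(p.1, R.top), rfl, r3, r4, key _ rfl r3 ?_, Or.inl ⟨R, hR, rfl, r1, r2⟩⟩
    intro R' hR' a b c
    by_contra hlt
    simp only [not_le] at hlt
    have hne : ¬ R = R' := by rintro rfl; exact lt_irrefl _ hlt
    have hle : R.top ≤ R'.bot := by
      by_contra hcon
      push Not at hcon
      have t := R.height_ge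
      have t' := R'.height_ge
      exact hne (S.eq_of_overlap hR hR' (by linarith) (by linarith) (by linarith) hcon)
    have t' := R'.height_ge
    rcases N with _ | N
    · simp only [Nat.cast_zero] at r5; linarith
    · refine hmin N (Nat.lt_succ_self N) ⟨R', hR', a, b, c, by linarith, ?_⟩
      push_cast at r5; linarith
  · refine ⟨(p.1, Y), rfl, hY, le_rfl, key _ rfl hY ?_, Or.inr rfl⟩
    intro R hR a b c
    by_contra hlt
    push Not at hlt
    exact hex ⟨R, hR, a, b, c, hlt.le⟩

/-! ## Polygonal paths -/

theorem pathLen_nonneg : ∀ l : List Pt, 0 ≤ pathLen l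
  | [] => le_rfl
  | [_] => le_rfl
  | a :: b :: l => by
    have := pathLen_nonneg (b :: l)
    simp only [pathLen]
    positivity

theorem pathLen_cons_cons (a b : Pt) (l : List Pt) :
    pathLen (a :: b :: l) = |b.1 - a.1| + |b.2 - a.2| + pathLen (b :: l) := rfl

theorem pathLen_cons_self (a : Pt) (l : List Pt) : pathLen (a :: a :: l) = pathLen (a :: l) := by
  simp [pathLen]

theorem eq_cons_of_head? {l : List Pt} {a : Pt} (h : l.head? = some a) : ∃ t, l = a :: t := by
  cases l with
  | nil => simp at h
  | cons b t => simp at h; exact ⟨t, by rw [h]⟩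

/-- Paths are glued by plain concatenation with the junction occurring twice; the degenerate segment
between the two copies contributes nothing. -/
theorem pathLen_append {l l' : List Pt} {a : Pt} (h : l.getLast? = some a)
    (h' : l'.head? = some a) : pathLen (l ++ l') = pathLen l + pathLen l' := by
  obtain ⟨t, rfl⟩ := eq_cons_of_head? h'
  induction l with
  | nil => simp at h
  | cons x l ih =>
    cases l with
    | nil =>
      simp at h; subst h
      simp [pathLen]
    | cons y l =>
      rw [List.getLast?_cons_cons] at h
      have := ih h
      simp only [List.cons_append, pathLen_cons_cons] at this ⊢
      rw [this]; ring

theorem pathPts_append {l l' : List Pt} {a : Pt} (h : l.getLast? = some a)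
    (h' : l'.head? = some a) : pathPts (l ++ l') = pathPts l ∪ pathPts l' := by
  obtain ⟨t, rfl⟩ := eq_cons_of_head? h'
  have hself : ∀ (a : Pt) (t : List Pt), a ∈ pathPts (a :: t) := by
    intro a t
    cases t with
    | nil => exact rfl
    | cons b t => exact Or.inl (left_mem_segment ℝ a b)
  induction l with
  | nil => simp at h
  | cons x l ih =>
    cases l with
    | nil =>
      simp at h; subst h
      simp [pathPts]
    | cons y l =>
      rw [List.getLast?_cons_cons] at h
      have := ih h
      simp only [List.cons_append, pathPts] at this ⊢
      rw [this, Set.union_assoc]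

theorem head_mem_pathPts {l : List Pt} {a : Pt} (h : l.head? = some a) : a ∈ pathPts l := by
  obtain ⟨t, rfl⟩ := eq_cons_of_head? h
  cases t with
  | nil => exact rfl
  | cons b t => exact Or.inl (left_mem_segment ℝ a b)

theorem mem_pathPts_of_mem {l : List Pt} {a : Pt} (h : a ∈ l) : a ∈ pathPts l := by
  induction l with
  | nil => simp at h
  | cons x l ih =>
    cases l with
    | nil => simp at h; subst h; exact rfl
    | cons y l =>
      rcases List.mem_cons.1 h with rfl | h
      · exact Or.inl (left_mem_segment ℝ _ _)
      · exact Or.inr (ih h)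

theorem getLast_mem_pathPts {l : List Pt} {a : Pt} (h : l.getLast? = some a) : a ∈ pathPts l :=
  mem_pathPts_of_mem (List.mem_of_getLast? h)

theorem pathLen_append_cons (l : List Pt) (b : Pt) (l' : List Pt) :
    pathLen (l ++ b :: l') = pathLen (l ++ [b]) + pathLen (b :: l') := by
  have := pathLen_append (l := l ++ [b]) (l' := b :: l') (a := b) (by simp) (by simp)
  rw [← this]
  induction l with
  | nil => simp [pathLen]
  | cons x l ih =>
    cases l with
    | nil => simp [pathLen]
    | cons y l =>
      simp only [List.cons_append, pathLen_cons_cons] at ih ⊢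
      rw [ih]
      exact pathLen_append (a := b) (l := y :: (l ++ [b]))
        (by rw [← List.cons_append, List.getLast?_append]; simp) rfl

theorem pathLen_reverse (l : List Pt) : pathLen l.reverse = pathLen l := by
  induction l with
  | nil => rfl
  | cons x l ih =>
    cases l with
    | nil => rfl
    | cons y l =>
      have h : (x :: y :: l).reverse = l.reverse ++ y :: [x] := by simp
      rw [h, pathLen_append_cons]
      have h2 : l.reverse ++ [y] = (y :: l).reverse := by simp
      rw [h2, ih, pathLen_cons_cons, pathLen_cons_cons, abs_sub_comm x.1, abs_sub_comm x.2]
      simp [pathLen]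
      ring

theorem pathLen_le_append (l : List Pt) (b : Pt) (l' : List Pt) :
    pathLen (b :: l') ≤ pathLen (l ++ b :: l') := by
  rw [pathLen_append_cons]
  have := pathLen_nonneg (l ++ [b])
  linarith

/-! ### Paths that are monotone in x. -/

/-- The vertices of the path move to the right, and its segments are axis-parallel. -/
def XMono : List Pt → Prop
  | [] => True
  | [_] => True
  | a :: b :: l => a.1 ≤ b.1 ∧ (a.1 = b.1 ∨ a.2 = b.2) ∧ XMono (b :: l)

theorem XMono.tail {a : Pt} {l : List Pt} (h : XMono (a :: l)) : XMono l := by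
  cases l with
  | nil => trivial
  | cons b l => exact h.2.2

theorem XMono.append {l l' : List Pt} {a : Pt} (hl : XMono l) (hl' : XMono l')
    (h : l.getLast? = some a) (h' : l'.head? = some a) : XMono (l ++ l') := by
  obtain ⟨t, rfl⟩ := eq_cons_of_head? h'
  induction l with
  | nil => simp at h
  | cons x l ih =>
    cases l with
    | nil =>
      simp at h; subst h
      exact ⟨le_rfl, Or.inl rfl, hl'⟩
    | cons y l =>
      rw [List.getLast?_cons_cons] at h
      exact ⟨hl.1, hl.2.1, ih hl.2.2 h⟩

theorem XMono.of_append {l l' : List Pt} (h : XMono (l ++ l')) : XMono l' := by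
  induction l with
  | nil => exact h
  | cons x l ih => exact ih h.tail

theorem XMono.head_le {l : List Pt} (hl : XMono l) {a : Pt} (h : l.head? = some a) {z : Pt}
    (hz : z ∈ pathPts l) : a.1 ≤ z.1 := by
  induction l generalizing a with
  | nil => simp at h
  | cons x l ih =>
    simp at h; subst h
    cases l with
    | nil => rw [show z = x from hz]
    | cons y l =>
      rcases hz with hz | hz
      · have := fst_mem_uIcc_of_mem_segment hz
        rw [Set.uIcc_of_le hl.1] at this
        exact this.1
      · exact hl.1.trans (ih hl.2.2 rfl hz)

theorem XMono.le_last {l : List Pt} (hl : XMono l) {b : Pt} (h : l.getLast? = some b) {z : Pt}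
    (hz : z ∈ pathPts l) : z.1 ≤ b.1 := by
  induction l generalizing z with
  | nil => simp at h
  | cons x l ih =>
    cases l with
    | nil => simp at h; subst h; rw [show z = x from hz]
    | cons y l =>
      rw [List.getLast?_cons_cons] at h
      rcases hz with hz | hz
      · have h1 := fst_mem_uIcc_of_mem_segment hz
        rw [Set.uIcc_of_le hl.1] at h1
        exact h1.2.trans (ih hl.2.2 h (head_mem_pathPts (a := y) rfl))
      · exact ih hl.2.2 h hz

theorem isClosed_pathPts : ∀ l : List Pt, IsClosed (pathPts l)
  | [] => isClosed_empty
  | [a] => isClosed_singleton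
  | a :: b :: l => by
    have h : IsClosed (segment ℝ a b) := by
      rw [segment_eq_image_lineMap]
      exact (isCompact_Icc.image (by fun_prop)).isClosed
    exact h.union (isClosed_pathPts (b :: l))

/-- The part of an `x`-monotone path between two of its points is connected. -/
theorem XMono.exists_preconnected {l : List Pt} (hl : XMono l) {s t : Pt} (hs : s ∈ pathPts l)
    (ht : t ∈ pathPts l) (hst : s.1 ≤ t.1) : ∃ K ⊆ pathPts l, IsPreconnected K ∧ s ∈ K ∧ t ∈ K ∧
      ∀ z ∈ K, s.1 ≤ z.1 ∧ z.1 ≤ t.1 := by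
  induction l generalizing s t with
  | nil => exact hs.elim
  | cons x l ih =>
    cases l with
    | nil =>
      refine ⟨{x}, subset_rfl, isPreconnected_singleton, hs, ht, ?_⟩
      rintro z rfl
      rw [show s = z from hs, show t = z from ht]; exact ⟨le_rfl, le_rfl⟩
    | cons y l =>
      have hy : y ∈ pathPts (y :: l) := head_mem_pathPts rfl
      have key : ∀ s t : Pt, s ∈ segment ℝ x y → t ∈ pathPts (y :: l) →
          ∃ K ⊆ pathPts (x :: y :: l), IsPreconnected K ∧ s ∈ K ∧ t ∈ K ∧
            ∀ z ∈ K, s.1 ≤ z.1 ∧ z.1 ≤ t.1 := by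
        intro s t hs ht
        have hyt : y.1 ≤ t.1 := hl.2.2.head_le rfl ht
        obtain ⟨K, hK, hpre, h1, h2, h3⟩ := ih hl.2.2 hy ht hyt
        have hsy : s.1 ≤ y.1 := by
          have := fst_mem_uIcc_of_mem_segment hs
          rw [Set.uIcc_of_le hl.1] at this
          exact this.2
        refine ⟨segment ℝ s y ∪ K, ?_, ?_, Or.inl (left_mem_segment ℝ s y), Or.inr h2, ?_⟩
        · apply Set.union_subset_union _ hK
          exact (convex_segment x y).segment_subset hs (right_mem_segment ℝ x y)
        · exact (convex_segment s y).isPreconnected.union y (right_mem_segment ℝ s y) h1 hpre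
        · rintro z (hz | hz)
          · have := fst_mem_uIcc_of_mem_segment hz
            rw [Set.uIcc_of_le hsy] at this
            exact ⟨this.1, this.2.trans hyt⟩
          · exact ⟨hsy.trans (h3 z hz).1, (h3 z hz).2⟩
      rcases hs with hs | hs <;> rcases ht with ht | ht
      · refine ⟨segment ℝ s t, ?_, (convex_segment s t).isPreconnected, left_mem_segment ℝ s t,
          right_mem_segment ℝ s t, ?_⟩
        · exact ((convex_segment x y).segment_subset hs ht).trans Set.subset_union_left
        · intro z hz
          have := fst_mem_uIcc_of_mem_segment hz
          rwa [Set.uIcc_of_le hst] at this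
      · exact key s t hs ht
      · obtain ⟨K, hK, hpre, h1, h2, h3⟩ := key t s ht hs
        have heq : s.1 = t.1 := le_antisymm hst (h3 t h1 |>.2)
        exact ⟨K, hK, hpre, h2, h1, fun z hz => ⟨heq ▸ (h3 z hz).1, heq ▸ (h3 z hz).2⟩⟩
      · obtain ⟨K, hK, h⟩ := ih hl.2.2 hs ht hst
        exact ⟨K, hK.trans Set.subset_union_right, h⟩

/-- An `x`-monotone path that passes from below a horizontal line to above it meets it. -/
theorem XMono.exists_mem_height {l : List Pt} (hl : XMono l) {s t : Pt} (hs : s ∈ pathPts l)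
    (ht : t ∈ pathPts l) (hst : s.1 ≤ t.1) {y : ℝ} (hy : y ∈ Set.uIcc s.2 t.2) :
    ∃ z ∈ pathPts l, z.2 = y ∧ s.1 ≤ z.1 ∧ z.1 ≤ t.1 := by
  obtain ⟨K, hK, hpre, h1, h2, h3⟩ := hl.exists_preconnected hs ht hst
  have himg : IsPreconnected (Prod.snd '' K) := hpre.image _ continuous_snd.continuousOn
  have hsub := himg.ordConnected.uIcc_subset (Set.mem_image_of_mem _ h1)
    (Set.mem_image_of_mem _ h2)
  obtain ⟨z, hz, hzy⟩ := hsub hy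
  exact ⟨z, hK hz, hzy, h3 z hz⟩

theorem XMono.exists_mem_abscissa {l : List Pt} (hl : XMono l) {s t : Pt} (hs : s ∈ pathPts l)
    (ht : t ∈ pathPts l) {x : ℝ} (hsx : s.1 ≤ x) (hxt : x ≤ t.1) :
    ∃ z ∈ pathPts l, z.1 = x := by
  obtain ⟨K, hK, hpre, h1, h2, h3⟩ := hl.exists_preconnected hs ht (hsx.trans hxt)
  have himg : IsPreconnected (Prod.fst '' K) := hpre.image _ continuous_fst.continuousOn
  have hsub := himg.ordConnected.uIcc_subset (Set.mem_image_of_mem _ h1)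
    (Set.mem_image_of_mem _ h2)
  obtain ⟨z, hz, hzy⟩ := hsub (Set.mem_uIcc_of_le hsx hxt)
  exact ⟨z, hK hz, hzy⟩

/-! ## Final portions of paths -/

theorem IsFinalPortion.append_left {δ π : List Pt} {B : Pt} (h : IsFinalPortion δ B π)
    (γ : List Pt) : IsFinalPortion (γ ++ δ) B π := by
  obtain ⟨γ₁, a, b, γ₂, rfl, h1, h2⟩ := h
  exact ⟨γ ++ γ₁, a, b, γ₂, by simp, h1, h2⟩

theorem IsFinalPortion.cons {δ π : List Pt} {B : Pt} (h : IsFinalPortion δ B π)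
    (a : Pt) : IsFinalPortion (a :: δ) B π := h.append_left [a]

theorem IsFinalPortion.append_right {γ π : List Pt} {B : Pt} (h : IsFinalPortion γ B π)
    (δ : List Pt) : IsFinalPortion (γ ++ δ) B (π ++ δ) := by
  obtain ⟨γ₁, a, b, γ₂, rfl, h1, rfl⟩ := h
  exact ⟨γ₁, a, b, γ₂ ++ δ, by simp, h1, by simp⟩

theorem IsFinalPortion.head? {γ π : List Pt} {B : Pt} (h : IsFinalPortion γ B π) :
    π.head? = some B := by
  obtain ⟨γ₁, a, b, γ₂, rfl, h1, rfl⟩ := h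
  rfl

theorem IsFinalPortion.getLast? {γ π : List Pt} {B : Pt} (h : IsFinalPortion γ B π) :
    π.getLast? = γ.getLast? := by
  obtain ⟨γ₁, a, b, γ₂, rfl, h1, rfl⟩ := h
  rw [List.getLast?_append_cons, List.getLast?_cons_cons, List.getLast?_cons_cons]

theorem IsFinalPortion.subset {γ π : List Pt} {B : Pt} (h : IsFinalPortion γ B π) :
    pathPts π ⊆ pathPts γ := by
  obtain ⟨γ₁, a, b, γ₂, rfl, h1, rfl⟩ := h
  have h2 : pathPts (B :: b :: γ₂) ⊆ pathPts (a :: b :: γ₂) := by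
    apply Set.union_subset_union_left
    exact (convex_segment a b).segment_subset h1 (right_mem_segment ℝ a b)
  refine h2.trans ?_
  clear h1 h2
  induction γ₁ with
  | nil => rfl
  | cons x l ih =>
    refine ih.trans ?_
    cases l with
    | nil => exact Set.subset_union_right
    | cons y l => exact Set.subset_union_right

theorem IsFinalPortion.mem {γ π : List Pt} {B : Pt} (h : IsFinalPortion γ B π) :
    B ∈ pathPts γ := h.subset (head_mem_pathPts h.head?)

theorem exists_isFinalPortion {γ : List Pt} (hγ : 2 ≤ γ.length) {B : Pt} (hB : B ∈ pathPts γ) :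
    ∃ π, IsFinalPortion γ B π := by
  induction γ with
  | nil => exact hB.elim
  | cons x l ih =>
    cases l with
    | nil => simp at hγ
    | cons y l =>
      rcases hB with hB | hB
      · exact ⟨_, [], x, y, l, rfl, hB, rfl⟩
      · cases l with
        | nil =>
          refine ⟨_, [], x, y, [], rfl, ?_, rfl⟩
          rw [show B = y from hB]; exact right_mem_segment ℝ x y
        | cons z l =>
          obtain ⟨π, hπ⟩ := ih (by simp) hB
          exact ⟨π, hπ.cons x⟩

theorem exists_followFrom {γ : List Pt} (hγ : 2 ≤ γ.length) {B : Pt} (hB : B ∈ pathPts γ) :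
    ∃ π, FollowFrom γ B π := by
  -- A final portion from `B` is determined by the suffix of vertices behind `B`.
  have hfin : {π | IsFinalPortion γ B π}.Finite := by
    refine ((γ.tails.map (B :: ·)).toFinset.finite_toSet).subset ?_
    rintro π ⟨γ₁, a, b, γ₂, rfl, h1, rfl⟩
    simp only [List.coe_toFinset, List.mem_map, List.mem_tails, Set.mem_ofPred_eq]
    exact ⟨b :: γ₂, ⟨γ₁ ++ [a], by simp⟩, rfl⟩
  obtain ⟨π, h1, h2⟩ := Set.exists_min_image _ pathLen hfin (exists_isFinalPortion hγ hB)
  exact ⟨π, h1, fun π' h' => h2 π' h'⟩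

/-- The third alternative is the degenerate segment at the doubled junction vertex. -/
theorem isFinalPortion_append {γ δ π : List Pt} {a B : Pt} (h : IsFinalPortion (γ ++ δ) B π)
    (hγ : γ.getLast? = some a) (hδ : δ.head? = some a) :
    IsFinalPortion δ B π ∨ (∃ π', IsFinalPortion γ B π' ∧ π = π' ++ δ) ∨
      (B = a ∧ π = B :: δ) := by
  obtain ⟨t, rfl⟩ := eq_cons_of_head? hδ
  obtain ⟨γ₁, u, v, γ₂, heq, h1, rfl⟩ := h
  rw [List.append_eq_append_iff] at heq
  rcases heq with ⟨l, rfl, h2⟩ | ⟨l, h2, h3⟩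
  · exact Or.inl ⟨l, u, v, γ₂, h2, h1, rfl⟩
  · cases l with
    | nil => exact Or.inl ⟨[], u, v, γ₂, by simpa using h3.symm, h1, rfl⟩
    | cons x l =>
      simp only [List.cons_append, List.cons.injEq] at h3
      obtain ⟨rfl, h3⟩ := h3
      cases l with
      | nil =>
        simp only [List.nil_append, List.cons.injEq] at h3
        obtain ⟨rfl, rfl⟩ := h3
        rw [h2] at hγ
        simp at hγ
        subst hγ
        right; right
        rw [segment_same] at h1
        rw [show B = u from h1]
        exact ⟨rfl, rfl⟩
      | cons y l =>
        simp only [List.cons_append, List.cons.injEq] at h3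
        obtain ⟨rfl, rfl⟩ := h3
        exact Or.inr (Or.inl ⟨_, ⟨γ₁, u, v, l, h2, h1, rfl⟩, by simp⟩)

theorem pathLen_le_of_mem_segment {a b B : Pt} (h : B ∈ segment ℝ a b) (l : List Pt) :
    pathLen (B :: b :: l) ≤ pathLen (a :: b :: l) := by
  simp only [pathLen_cons_cons]
  have h1 := Set.abs_sub_right_of_mem_uIcc (fst_mem_uIcc_of_mem_segment h)
  have h2 := Set.abs_sub_right_of_mem_uIcc (snd_mem_uIcc_of_mem_segment h)
  linarith

/-- Following a path backward until `x = c` is shortest among the final portions. -/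
theorem BackUntil.pathLen_le {γ π π' : List Pt} {c : ℝ} {A : Pt} (hmono : XMono γ)
    (h : BackUntil γ c A π) (h' : IsFinalPortion γ A π') : pathLen π ≤ pathLen π' := by
  obtain ⟨⟨γ₁, a, b, γ₂, rfl, h1, rfl⟩, hAc, huniq⟩ := h
  obtain ⟨γ₁', a', b', γ₂', heq, h1', rfl⟩ := h'
  rw [List.append_eq_append_iff] at heq
  rcases heq with ⟨l, rfl, h2⟩ | ⟨l, rfl, h3⟩
  · cases l with
    | nil =>
      simp only [List.nil_append, List.cons.injEq] at h2
      obtain ⟨rfl, rfl, rfl⟩ := h2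
      exact le_rfl
    -- The other portion starts on a later segment. By monotonicity the skipped vertices have
    -- abscissa `c`, and uniqueness identifies them with `A`, so the lengths agree.
    | cons x l =>
      simp only [List.cons_append, List.cons.injEq] at h2
      obtain ⟨rfl, h2⟩ := h2
      rw [h2] at huniq ⊢
      have hm : XMono (l ++ a' :: b' :: γ₂') := h2 ▸ hmono.of_append.tail
      have hm1 : ∀ (l' : List Pt), XMono (l' ++ a' :: b' :: γ₂') → ∀ w ∈ l' ++ [a'], w.1 ≤ a'.1 := by
        intro l'
        induction l' with
        | nil => intro _ w hw; simp at hw; rw [hw]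
        | cons x l' ih =>
          intro hx w hw
          rcases List.mem_cons.1 hw with rfl | hw
          · have h3 := hx.head_le (a := w) rfl
              (mem_pathPts_of_mem (l := w :: l' ++ a' :: b' :: γ₂') (a := a') (by simp))
            exact h3
          · exact ih hx.tail w hw
      have ha' : a'.1 ≤ A.1 := by
        have h3 := fst_mem_uIcc_of_mem_segment h1'
        rw [Set.uIcc_of_le hm.of_append.1] at h3
        exact h3.1
      have hbA : A.1 ≤ b.1 := by
        have h3 := fst_mem_uIcc_of_mem_segment h1
        rw [Set.uIcc_of_le hmono.of_append.1] at h3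
        exact h3.2
      have hall : ∀ w ∈ l ++ [a'], w = A := by
        intro w hw
        have hw' : w ∈ l ++ a' :: b' :: γ₂' := by
          simp only [List.mem_append, List.mem_cons, List.not_mem_nil, or_false] at hw ⊢
          tauto
        apply huniq w (mem_pathPts_of_mem (List.mem_cons_of_mem _ hw'))
        refine le_antisymm ?_ ?_
        · rw [← hAc]; exact (hm1 l hm w hw).trans ha'
        · rw [← hAc]
          refine hbA.trans (hm.head_le ?_ (mem_pathPts_of_mem hw'))
          rw [← h2]; rfl
      have hlen : ∀ l' : List Pt, (∀ w ∈ l' ++ [a'], w = A) →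
          pathLen (A :: (l' ++ a' :: b' :: γ₂')) = pathLen (A :: b' :: γ₂') := by
        intro l'
        induction l' with
        | nil =>
          intro hw
          rw [hw a' (by simp), List.nil_append, pathLen_cons_self]
        | cons x l' ih =>
          intro hw
          rw [hw x (by simp), List.cons_append, pathLen_cons_self]
          exact ih fun w hw' => hw w (by simp at hw' ⊢; tauto)
      rw [hlen l hall]
  · cases l with
    | nil =>
      simp only [List.nil_append, List.cons.injEq] at h3
      obtain ⟨rfl, rfl, rfl⟩ := h3
      exact le_rfl
    -- The other portion starts on an earlier segment and contains everything walked here.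
    | cons x l =>
      simp only [List.cons_append, List.cons.injEq] at h3
      obtain ⟨rfl, h3⟩ := h3
      rw [h3]
      refine (pathLen_le_of_mem_segment h1 _).trans ?_
      exact pathLen_le_append (A :: l) a (b :: γ₂)

/-- The first segment whose right end lies strictly beyond `c` is horizontal, hence meets the line x
= c once, and the rest of the path stays to the right of it. -/
theorem exists_backUntil {γ : List Pt} (hmono : XMono γ) {a b : Pt} (ha : γ.head? = some a)
    (hb : γ.getLast? = some b) {c : ℝ} (hac : a.1 ≤ c) (hcb : c < b.1) :
    ∃ A π, BackUntil γ c A π := by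
  induction γ generalizing a with
  | nil => simp at ha
  | cons x l ih =>
    simp at ha; subst ha
    cases l with
    | nil => simp at hb; subst hb; exact absurd hcb (not_lt.2 hac)
    | cons y l =>
      rw [List.getLast?_cons_cons] at hb
      rcases le_or_gt y.1 c with hy | hy
      · obtain ⟨A, π, h1, h2⟩ := ih hmono.2.2 rfl hb hy
        exact ⟨A, π, h1.cons x, h2⟩
      · have hxy : x.2 = y.2 := hmono.2.1.resolve_left (by intro h; linarith)
        refine ⟨(c, x.2), _, ⟨[], x, y, l, rfl, ?_, rfl⟩, rfl, ?_⟩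
        · rw [mem_segment_right_iff hxy.symm hmono.1]
          exact ⟨rfl, hac, hy.le⟩
        · rintro z (hz | hz) hzc
          · rw [mem_segment_right_iff (by exact hxy.symm) hy.le] at hz
            exact Prod.ext hzc hz.1
          · have := hmono.2.2.head_le rfl hz
            linarith

/-! ## Greedy paths -/

theorem Scene.free_left_edge (S : Scene) {R : Obstacle} (hR : R ∈ S.obstacles) {p : Pt}
    (h1 : (R.left : ℝ) = p.1) (h3 : R.bot ≤ p.2) (h4 : p.2 ≤ R.top) : S.Free p :=
  S.free_of_mem_closed hR h1.le (by have := R.left_lt_right; linarith) h3 h4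
    fun h => by have := (Obstacle.mem_interior.1 h).1.1; linarith

theorem Scene.free_right_edge (S : Scene) {R : Obstacle} (hR : R ∈ S.obstacles) {p : Pt}
    (h1 : p.1 = (R.right : ℝ)) (h3 : R.bot ≤ p.2) (h4 : p.2 ≤ R.top) : S.Free p :=
  S.free_of_mem_closed hR (by have := R.left_lt_right; linarith) h1.le h3 h4
    fun h => by have := (Obstacle.mem_interior.1 h).1.2; linarith

theorem Scene.free_top_edge (S : Scene) {R : Obstacle} (hR : R ∈ S.obstacles) {p : Pt}
    (h1 : p.2 = R.top) (h3 : (R.left : ℝ) ≤ p.1) (h4 : p.1 ≤ R.right) : S.Free p :=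
  S.free_of_mem_closed hR h3 h4 (by have := R.height_ge; linarith) h1.le
    fun h => by have := (Obstacle.mem_interior.1 h).2.2; linarith

theorem Scene.free_bot_edge (S : Scene) {R : Obstacle} (hR : R ∈ S.obstacles) {p : Pt}
    (h1 : p.2 = R.bot) (h3 : (R.left : ℝ) ≤ p.1) (h4 : p.1 ≤ R.right) : S.Free p :=
  S.free_of_mem_closed hR h3 h4 h1.ge (by have := R.height_ge; linarith)
    fun h => by have := (Obstacle.mem_interior.1 h).2.1; linarith

theorem GreedyDownLeft.spec {S : Scene} {C : Set Pt} {p r : Pt} {π : List Pt}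
    (h : GreedyDownLeft S C p r π) : π.head? = some p ∧ π.getLast? = some r ∧ r ∈ C ∧
      r.1 ≤ p.1 ∧ r.2 ≤ p.2 ∧ pathLen π = (p.1 - r.1) + (p.2 - r.2) := by
  induction h with
  | reached p h => simp [h, pathLen]
  | down p q r π hx hy hfree hfirst hend hrest ih =>
    obtain ⟨h1, h2, h3, h4, h5, h6⟩ := ih
    obtain ⟨t, rfl⟩ := eq_cons_of_head? h1
    refine ⟨rfl, by rw [List.getLast?_cons_cons, h2], h3, by linarith, by linarith, ?_⟩
    rw [pathLen_cons_cons, h6, hx, abs_of_neg (by linarith : q.2 - p.2 < 0)]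
    simp
    ring
  | left p q r R π hR hblock hx hx' hy hfirst hend hrest ih =>
    obtain ⟨h1, h2, h3, h4, h5, h6⟩ := ih
    obtain ⟨t, rfl⟩ := eq_cons_of_head? h1
    refine ⟨rfl, by rw [List.getLast?_cons_cons, h2], h3, by linarith, by linarith, ?_⟩
    rw [pathLen_cons_cons, h6, hy, abs_of_neg (by linarith : q.1 - p.1 < 0)]
    simp
    ring

theorem GreedyDownLeft.free {S : Scene} {C : Set Pt} {p r : Pt} {π : List Pt}
    (h : GreedyDownLeft S C p r π) (hp : S.Free p) : S.Free r := by
  induction h with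
  | reached p h => exact hp
  | down p q r π hx hy hfree hfirst hend hrest ih =>
    exact ih (S.free_of_freeSeg hfree (right_mem_segment ℝ p q))
  | left p q r R π hR hblock hx hx' hy hfirst hend hrest ih =>
    exact ih (S.free_top_edge hR (hy.trans hblock.1.symm) hx' (by linarith [hblock.2.2]))

theorem GreedyDownLeft.eq_of_mem {S : Scene} {C : Set Pt} {p r : Pt} {π : List Pt}
    (h : GreedyDownLeft S C p r π) (hp : p ∈ C) : r = p ∧ π = [p] := by
  cases h with
  | reached p h => exact ⟨rfl, rfl⟩
  | down p q r π hx hy hfree hfirst hend hrest =>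
    have := hfirst p (left_mem_segment ℝ p q) hp
    rw [← this] at hy; exact absurd hy (lt_irrefl _)
  | left p q r R π hR hblock hx hx' hy hfirst hend hrest =>
    have := hfirst p (left_mem_segment ℝ p q) hp
    rw [← this] at hx; exact absurd hx (lt_irrefl _)

/-- A greedy path with respect to a larger target that ends in the smaller target. -/
theorem GreedyDownLeft.of_subset {S : Scene} {C C' : Set Pt} {p r : Pt} {π : List Pt}
    (h : GreedyDownLeft S C' p r π) (hC : C ⊆ C') (hr : r ∈ C) : GreedyDownLeft S C p r π := by
  induction h with
  | reached p h => exact .reached p hr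
  | down p q r π hx hy hfree hfirst hend hrest ih =>
    refine .down p q r π hx hy hfree (fun z hz hzC => hfirst z hz (hC hzC)) ?_ (ih hr)
    rcases hend with hq | hq
    · left; rw [← (hrest.eq_of_mem hq).1]; exact hr
    · exact Or.inr hq
  | left p q r R π hR hblock hx hx' hy hfirst hend hrest ih =>
    refine .left p q r R π hR hblock hx hx' hy (fun z hz hzC => hfirst z hz (hC hzC)) ?_ (ih hr)
    rcases hend with hq | hq
    · left; rw [← (hrest.eq_of_mem hq).1]; exact hr
    · exact Or.inr hq

/-- A left move that misses `C` ends at an integral abscissa strictly to the left of its start, so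
only finitely many fit before `xlo`. Where a target lacks one of the half-planes, it is enlarged for
this lemma and reduced afterwards by `GreedyDownLeft.of_subset`. -/
theorem exists_greedyDownLeft {S : Scene} {C : Set Pt} (hC : IsClosed C) {xlo ylo : ℝ}
    (hx : ∀ z : Pt, z.1 ≤ xlo → z ∈ C) (hy : ∀ z : Pt, z.2 ≤ ylo → z ∈ C) {p : Pt}
    (hp : S.Free p) : ∃ r π, GreedyDownLeft S C p r π := by
  obtain ⟨n, hn⟩ : ∃ n : ℕ, ⌈p.1⌉ - ⌈xlo⌉ ≤ n := ⟨(⌈p.1⌉ - ⌈xlo⌉).toNat, Int.self_le_toNat _⟩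
  induction n using Nat.strong_induction_on generalizing p with
  | _ n ih =>
    -- A downward move leaves the measure unchanged but ends in `C` or on an obstacle, so the
    -- blocked case is settled first.
    have hblk : ∀ p : Pt, ⌈p.1⌉ - ⌈xlo⌉ ≤ n → p ∉ C → (∃ R ∈ S.obstacles, BlocksDown R p) →
        ∃ r π, GreedyDownLeft S C p r π := by
      rintro p hn hpC ⟨R, hR, hb⟩
      have hlt : (R.left : ℝ) < p.1 := hb.2.1
      obtain ⟨z, hz, hzp, hfirst, hend⟩ := exists_first_mem_segment hC p ((R.left : ℝ), p.2) hpC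
        (fun h => by rw [Prod.ext_iff] at h; exact hlt.ne' h.1)
      rw [mem_segment_left_iff (by exact rfl) hlt.le] at hz
      obtain ⟨z1, z2, z3⟩ := hz
      have hzlt : z.1 < p.1 := lt_of_le_of_ne z3 fun h => hzp (Prod.ext h z1)
      suffices h : ∃ r π, GreedyDownLeft S C z r π by
        obtain ⟨r, π, h⟩ := h
        refine ⟨r, _, .left p z r R π hR hb hzlt z2 z1 hfirst ?_ h⟩
        rcases hend with h | h
        · exact Or.inl h
        · exact Or.inr (by rw [h])
      by_cases hzC : z ∈ C
      · exact ⟨z, _, .reached z hzC⟩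
      · have hzl : z.1 = R.left := by rw [hend.resolve_left hzC]
        have hfree : S.Free z := S.free_top_edge hR (z1.trans hb.1.symm) z2
          (by have := hb.2.2; linarith)
        have h1 : xlo < R.left := by
          by_contra hcon; exact hzC (hx z (by rw [hzl]; linarith))
        have h2 : R.left < ⌈p.1⌉ := by
          have := hlt.trans_le (Int.le_ceil p.1); exact_mod_cast this
        have h3 : ⌈xlo⌉ ≤ R.left := Int.ceil_le.2 h1.le
        have h4 : ⌈z.1⌉ = R.left := by rw [hzl, Int.ceil_intCast]
        exact ih (n - 1) (by omega) hfree (by rw [h4]; omega)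
    by_cases hpC : p ∈ C
    · exact ⟨p, _, .reached p hpC⟩
    · by_cases hb : ∃ R ∈ S.obstacles, BlocksDown R p
      · exact hblk p hn hpC hb
      · have hylo : ylo < p.2 := by
          by_contra hcon; exact hpC (hy p (not_lt.1 hcon))
        push Not at hb
        obtain ⟨q, q1, q2, q3, q4, q5⟩ := S.exists_move_down hp hylo hb
        obtain ⟨z, hz, hzp, hfirst, hend⟩ := exists_first_mem_segment hC p q hpC
          (fun h => by rw [h] at q2; exact lt_irrefl _ q2)
        have hz' := hz
        rw [mem_segment_down_iff q1 q2.le] at hz'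
        obtain ⟨z1, z2, z3⟩ := hz'
        have hzlt : z.2 < p.2 := lt_of_le_of_ne z3 fun h => hzp (Prod.ext z1 h)
        have hzend : z ∈ C ∨ ∃ R ∈ S.obstacles, BlocksDown R z := by
          rcases hend with h | rfl
          · exact Or.inl h
          · rcases q5 with h | h
            · exact Or.inr h
            · exact Or.inl (hy _ h.le)
        suffices h : ∃ r π, GreedyDownLeft S C z r π by
          obtain ⟨r, π, h⟩ := h
          exact ⟨r, _, .down p z r π z1 hzlt (freeSeg_mono q4 (left_mem_segment ℝ p q) hz)
            hfirst hzend h⟩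
        by_cases hzC : z ∈ C
        · exact ⟨z, _, .reached z hzC⟩
        · exact hblk z (by rw [z1]; exact hn) hzC (hzend.resolve_left hzC)

theorem GreedyRightDown.spec {S : Scene} {C : Set Pt} {p r : Pt} {π : List Pt}
    (h : GreedyRightDown S C p r π) : π.head? = some p ∧ π.getLast? = some r ∧ r ∈ C ∧
      p.1 ≤ r.1 ∧ r.2 ≤ p.2 ∧ pathLen π = (r.1 - p.1) + (p.2 - r.2) := by
  induction h with
  | reached p h => simp [h, pathLen]
  | right p q r π hx hy hfree hfirst hend hrest ih =>
    obtain ⟨h1, h2, h3, h4, h5, h6⟩ := ih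
    obtain ⟨t, rfl⟩ := eq_cons_of_head? h1
    refine ⟨rfl, by rw [List.getLast?_cons_cons, h2], h3, by linarith, by linarith, ?_⟩
    rw [pathLen_cons_cons, h6, hy, abs_of_pos (by linarith : 0 < q.1 - p.1)]
    simp
    ring
  | down p q r R π hR hblock hx hy hy' hfirst hend hrest ih =>
    obtain ⟨h1, h2, h3, h4, h5, h6⟩ := ih
    obtain ⟨t, rfl⟩ := eq_cons_of_head? h1
    refine ⟨rfl, by rw [List.getLast?_cons_cons, h2], h3, by linarith, by linarith, ?_⟩
    rw [pathLen_cons_cons, h6, hx, abs_of_neg (by linarith : q.2 - p.2 < 0)]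
    simp
    ring

theorem GreedyRightDown.eq_of_mem {S : Scene} {C : Set Pt} {p r : Pt} {π : List Pt}
    (h : GreedyRightDown S C p r π) (hp : p ∈ C) : r = p ∧ π = [p] := by
  cases h with
  | reached p h => exact ⟨rfl, rfl⟩
  | right p q r π hx hy hfree hfirst hend hrest =>
    have := hfirst p (left_mem_segment ℝ p q) hp
    rw [← this] at hx; exact absurd hx (lt_irrefl _)
  | down p q r R π hR hblock hx hy hy' hfirst hend hrest =>
    have := hfirst p (left_mem_segment ℝ p q) hp
    rw [← this] at hy; exact absurd hy (lt_irrefl _)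

theorem GreedyRightDown.of_subset {S : Scene} {C C' : Set Pt} {p r : Pt} {π : List Pt}
    (h : GreedyRightDown S C' p r π) (hC : C ⊆ C') (hr : r ∈ C) :
    GreedyRightDown S C p r π := by
  induction h with
  | reached p h => exact .reached p hr
  | right p q r π hx hy hfree hfirst hend hrest ih =>
    refine .right p q r π hx hy hfree (fun z hz hzC => hfirst z hz (hC hzC)) ?_ (ih hr)
    rcases hend with hq | hq
    · left; rw [← (hrest.eq_of_mem hq).1]; exact hr
    · exact Or.inr hq
  | down p q r R π hR hblock hx hy hy' hfirst hend hrest ih =>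
    refine .down p q r R π hR hblock hx hy hy' (fun z hz hzC => hfirst z hz (hC hzC)) ?_ (ih hr)
    rcases hend with hq | hq
    · left; rw [← (hrest.eq_of_mem hq).1]; exact hr
    · exact Or.inr hq

/-- If a greedy right-down path only goes down, it stops at the highest target point below its
start. -/
theorem GreedyRightDown.le_of_fst_eq {S : Scene} {C : Set Pt} {p r : Pt} {π : List Pt}
    (h : GreedyRightDown S C p r π) (hr : r.1 = p.1) {z : Pt} (hz : z ∈ C) (hz1 : z.1 = p.1)
    (hz2 : z.2 ≤ p.2) : z.2 ≤ r.2 := by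
  induction h with
  | reached p h => exact hz2
  | right p q r π hx hy hfree hfirst hend hrest ih =>
    have := hrest.spec.2.2.2.1
    linarith
  | down p q r R π hR hblock hx hy hy' hfirst hend hrest ih =>
    by_cases hzq : z.2 ≤ q.2
    · exact ih (by rw [hr, hx]) (by rw [hz1, hx]) hzq
    · have : z = q := hfirst z ((mem_segment_down_iff hx hy.le).2 ⟨hz1, by linarith, hz2⟩) hz
      rw [this] at hzq; exact absurd le_rfl hzq

/-- One half-plane suffices here: downward moves run along left edges of obstacles, and a right move
that misses `C` ends at a larger integral abscissa. -/
theorem exists_greedyRightDown {S : Scene} {C : Set Pt} (hC : IsClosed C) {xhi : ℝ}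
    (hx : ∀ z : Pt, xhi ≤ z.1 → z ∈ C) {p : Pt}
    (hp : S.Free p) : ∃ r π, GreedyRightDown S C p r π := by
  obtain ⟨n, hn⟩ : ∃ n : ℕ, ⌊xhi⌋ - ⌊p.1⌋ ≤ n := ⟨(⌊xhi⌋ - ⌊p.1⌋).toNat, Int.self_le_toNat _⟩
  induction n using Nat.strong_induction_on generalizing p with
  | _ n ih =>
    have hright : ∀ p : Pt, S.Free p → ⌊xhi⌋ - ⌊p.1⌋ ≤ n → p ∉ C →
        (∀ R ∈ S.obstacles, ¬ BlocksRight R p) → ∃ r π, GreedyRightDown S C p r π := by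
      intro p hp hn hpC hb
      have hxhi : p.1 < xhi := by
        by_contra hcon; exact hpC (hx p (not_lt.1 hcon))
      obtain ⟨q, q1, q2, q3, q4, q5⟩ := S.exists_move_right hp hxhi hb
      obtain ⟨z, hz, hzp, hfirst, hend⟩ := exists_first_mem_segment hC p q hpC
        (fun h => by rw [h] at q1; exact lt_irrefl _ q1)
      have hz' := hz
      rw [mem_segment_right_iff q2 q1.le] at hz'
      obtain ⟨z1, z2, z3⟩ := hz'
      have hzlt : p.1 < z.1 := lt_of_le_of_ne z2 fun h => hzp (Prod.ext h.symm z1)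
      have hzend : z ∈ C ∨ ∃ R ∈ S.obstacles, BlocksRight R z := by
        rcases hend with h | rfl
        · exact Or.inl h
        · rcases q5 with h | h
          · exact Or.inr h
          · exact Or.inl (hx _ h.ge)
      suffices h : ∃ r π, GreedyRightDown S C z r π by
        obtain ⟨r, π, h⟩ := h
        exact ⟨r, _, .right p z r π hzlt z1 (freeSeg_mono q4 (left_mem_segment ℝ p q) hz)
          hfirst hzend h⟩
      by_cases hzC : z ∈ C
      · exact ⟨z, _, .reached z hzC⟩
      · obtain ⟨R, hR, hb⟩ := hzend.resolve_left hzC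
        have hzl : (R.left : ℝ) = z.1 := hb.1
        have h1 : (R.left : ℝ) < xhi := by
          by_contra hcon; exact hzC (hx z (by rw [← hzl]; linarith))
        have h2 : ⌊p.1⌋ < R.left := by
          have := (Int.floor_le p.1).trans_lt hzlt; rw [← hzl] at this; exact_mod_cast this
        have h3 : R.left ≤ ⌊xhi⌋ := Int.le_floor.2 h1.le
        have h4 : ⌊z.1⌋ = R.left := by rw [← hzl, Int.floor_intCast]
        exact ih (n - 1) (by omega) (S.free_of_freeSeg q4 hz) (by rw [h4]; omega)
    by_cases hpC : p ∈ C
    · exact ⟨p, _, .reached p hpC⟩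
    · by_cases hb : ∃ R ∈ S.obstacles, BlocksRight R p
      · obtain ⟨R, hR, hb⟩ := hb
        obtain ⟨b1, b2, b3⟩ := hb
        obtain ⟨z, hz, hzp, hfirst, hend⟩ := exists_first_mem_segment hC p (p.1, R.bot) hpC
          (fun h => by rw [Prod.ext_iff] at h; exact b2.ne' h.2)
        rw [mem_segment_down_iff (by exact rfl) b2.le] at hz
        obtain ⟨z1, z2, z3⟩ := hz
        have hzlt : z.2 < p.2 := lt_of_le_of_ne z3 fun h => hzp (Prod.ext z1 h)
        have hfree : S.Free z := S.free_left_edge hR (by rw [b1, z1]) z2 (by linarith)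
        suffices h : ∃ r π, GreedyRightDown S C z r π by
          obtain ⟨r, π, h⟩ := h
          refine ⟨r, _, .down p z r R π hR ⟨b1, b2, b3⟩ z1 hzlt z2 hfirst ?_ h⟩
          rcases hend with h | h
          · exact Or.inl h
          · exact Or.inr (by rw [h])
        by_cases hzC : z ∈ C
        · exact ⟨z, _, .reached z hzC⟩
        · have hzb : z.2 = R.bot := by rw [hend.resolve_left hzC]
          refine hright z hfree (by rw [z1]; exact hn) hzC ?_
          -- Nothing blocks the way at the lower corner of `R`: such an obstacle would overlap `R`
          -- just above that corner.
          rintro R' hR' ⟨c1, c2, c3⟩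
          have w := R.left_lt_right
          have w' := R'.left_lt_right
          have := S.eq_of_overlap hR hR' (by linarith) (by linarith) (by linarith) (by linarith)
          rw [← this] at c2
          linarith
      · push Not at hb
        exact hright p hp hn hpC hb

/-! ## Obstacles as barriers for greedy down-left paths -/

/-- The point `z` is not to the left of those obstacles of `𝓑` whose bottoms are lower. -/
def RightOf (𝓑 : Set Obstacle) (z : Pt) : Prop :=
  ∀ R ∈ 𝓑, R.bot < z.2 → (R.left : ℝ) ≤ z.1

/-- Up to the height `H`, the left edges of the obstacles of `𝓑` form a barrier without gaps, which
retreats to the left as one goes down. -/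
def IsBarrier (S : Scene) (𝓑 : Set Obstacle) (H : ℝ) : Prop :=
  𝓑 ⊆ S.obstacles ∧ ∀ R ∈ 𝓑, ∀ y, R.bot < y → y ≤ H →
    ∃ R' ∈ 𝓑, R.left ≤ R'.left ∧ R'.bot < y ∧ y ≤ R'.top

/-- At the height of `p` some barrier obstacle covers the level from below. If the obstacle carrying
`p` extended to the left of its left edge, the two would overlap just below `p`; so walking left on
top of an obstacle never crosses the barrier. -/
theorem IsBarrier.rightOf_left {S : Scene} {𝓑 : Set Obstacle} {H : ℝ} (hB : IsBarrier S 𝓑 H)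
    {p q : Pt} (hp : RightOf 𝓑 p) (hH : p.2 ≤ H) {R' : Obstacle} (hR' : R' ∈ S.obstacles)
    (hb : BlocksDown R' p) (hq1 : (R'.left : ℝ) ≤ q.1) (hq2 : q.2 = p.2) : RightOf 𝓑 q := by
  intro R hR hbot
  rw [hq2] at hbot
  obtain ⟨R₁, hR₁, h1, h2, h3⟩ := hB.2 R hR p.2 hbot hH
  have h4 := hp R₁ hR₁ h2
  have h5 : (R.left : ℝ) ≤ R₁.left := by exact_mod_cast h1
  refine h5.trans (le_trans ?_ hq1)
  by_contra hcon
  push Not at hcon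
  obtain ⟨b1, b2, b3⟩ := hb
  have w := R₁.left_lt_right
  have t := R'.height_ge
  have := S.eq_of_overlap (hB.1 hR₁) hR' (by linarith) (by linarith) (by linarith) (by linarith)
  rw [this] at hcon
  exact lt_irrefl _ hcon

theorem RightOf.down {𝓑 : Set Obstacle} {p q : Pt} (hp : RightOf 𝓑 p) (h1 : q.1 = p.1)
    (h2 : q.2 ≤ p.2) : RightOf 𝓑 q := fun R hR h => by
  rw [h1]; exact hp R hR (by linarith)

/-- A greedy down-left path that goes down to the height `Y` at most stays to the right of a barrier
that extends down to `Y`. -/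
theorem GreedyDownLeft.left_le_of_barrier {S : Scene} {C : Set Pt} {Y : ℝ} {p r : Pt}
    {π : List Pt} (h : GreedyDownLeft S C p r π) (hC : ∀ z : Pt, z.2 ≤ Y → z ∈ C)
    {𝓑 : Set Obstacle} {H : ℝ}
    (hB : IsBarrier S 𝓑 H) (hp : RightOf 𝓑 p) (hH : p.2 ≤ H) (hY : Y < p.2) {R : Obstacle}
    (hR : R ∈ 𝓑) (hRY : R.bot ≤ Y) : (R.left : ℝ) ≤ r.1 ∧ Y ≤ r.2 := by
  induction h with
  | reached p h => exact ⟨hp R hR (hRY.trans_lt hY), hY.le⟩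
  | down p q r π hx hy hfree hfirst hend hrest ih =>
    rcases le_or_gt q.2 Y with hq | hq
    · have hrq := (hrest.eq_of_mem (hC q hq)).1
      subst hrq
      refine ⟨by rw [hx]; exact hp R hR (by linarith), ?_⟩
      -- The descent meets the half-plane y ≤ Y first at height exactly `Y` and stops there.
      have hmem : ((p.1, Y) : Pt) ∈ segment ℝ p r :=
        (mem_segment_down_iff hx hy.le).2 ⟨rfl, hq, hY.le⟩
      have := hfirst _ hmem (hC _ (le_refl Y))
      rw [← this]
    · exact ih (hp.down hx hy.le) (by linarith) hq
  | left p q r R' π hR' hblock hx hx' hy hfirst hend hrest ih =>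
    exact ih (hB.rightOf_left hp hH hR' hblock hx' hy) (by linarith) (by linarith)

/-! ## `τ`-paths -/

theorem TauPath.spec {S : Scene} {τ : ℝ} {p q : Pt} {π : List Pt} (h : TauPath S τ p q π)
    (hp : p.1 ≤ S.n) : π.head? = some p ∧ π.getLast? = some q ∧ p.1 ≤ q.1 ∧ q.1 ≤ S.n ∧
      XMono π := by
  induction h with
  | post p hpn h => exact ⟨rfl, rfl, le_rfl, hpn.le, trivial⟩
  | wall p hpn => exact ⟨rfl, rfl, le_rfl, hpn.le, trivial⟩
  | move p q r π hx hy hn hfree hend hrest ih =>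
    obtain ⟨h1, h2, h3, h4, h5⟩ := ih hn
    obtain ⟨t, rfl⟩ := eq_cons_of_head? h1
    exact ⟨rfl, by rw [List.getLast?_cons_cons, h2], hx.le.trans h3, h4, hx.le, Or.inr hy.symm, h5⟩
  | around p r R c π hR hblock hc hn hrest ih =>
    obtain ⟨h1, h2, h3, h4, h5⟩ := ih hn.le
    obtain ⟨t, rfl⟩ := eq_cons_of_head? h1
    have hw := R.left_lt_right
    have hl := hblock.1
    refine ⟨rfl, by simp only [List.getLast?_cons_cons]; exact h2, ?_, h4, le_rfl, Or.inl rfl, ?_,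
      Or.inr rfl, le_rfl, Or.inl rfl, h5⟩
    · simp only at h3; linarith
    · simp only; linarith
  | aroundToWall p R c hR hblock hc hpn hn =>
    exact ⟨rfl, rfl, hpn.le, le_rfl, le_rfl, Or.inl rfl, hpn.le, Or.inr rfl, trivial⟩

theorem TauPath.isPost {S : Scene} {τ : ℝ} {p q : Pt} {π : List Pt} (h : TauPath S τ p q π)
    (hq : q.1 < S.n) : q.2 = p.2 ∧ IsPost S τ q := by
  induction h with
  | post p hp h => exact ⟨rfl, h⟩
  | wall p hp => exact absurd hp hq.ne
  | move p q r π hx hy hn hfree hend hrest ih =>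
    obtain ⟨h1, h2⟩ := ih hq
    exact ⟨h1.trans hy, h2⟩
  | around p r R c π hR hblock hc hn hrest ih => exact ih hq
  | aroundToWall p R c hR hblock hc hp hn => exact absurd rfl hq.ne

theorem TauPath.abs_snd_sub_lt {S : Scene} {τ : ℝ} (hτ : 0 < τ) {p q : Pt} {π : List Pt}
    (h : TauPath S τ p q π) (hp : p.1 ≤ S.n) {z : Pt} (hz : z ∈ pathPts π) :
    |z.2 - p.2| < τ := by
  have key : ∀ p c x : ℝ, |c - p| < τ → x ∈ Set.uIcc p c → |x - p| < τ := by
    intro p c x hc hx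
    exact (Set.abs_sub_left_of_mem_uIcc hx).trans_lt hc
  induction h with
  | post p hp h => rw [show z = p from hz]; simpa using hτ
  | wall p hp => rw [show z = p from hz]; simpa using hτ
  | move p q r π hx hy hn hfree hend hrest ih =>
    obtain ⟨t, rfl⟩ := eq_cons_of_head? (hrest.spec hn).1
    rcases hz with hz | hz
    · rw [((mem_segment_right_iff hy hx.le).1 hz).1]; simpa using hτ
    · rw [← hy]; exact ih hn hz
  | around p r R c π hR hblock hc hn hrest ih =>
    obtain ⟨t, rfl⟩ := eq_cons_of_head? (hrest.spec hn.le).1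
    rcases hz with hz | hz | hz | hz
    · exact key _ c _ hc.2 (snd_mem_uIcc_of_mem_segment hz)
    · have := ((mem_segment_of_snd_eq (by exact rfl)).1 hz).1
      rw [this]; exact hc.2
    · have := snd_mem_uIcc_of_mem_segment hz
      rw [Set.uIcc_comm] at this
      exact key _ c _ hc.2 this
    · exact ih hn.le hz
  | aroundToWall p R c hR hblock hc hp hn =>
    rcases hz with hz | hz | hz
    · exact key _ c _ hc.2 (snd_mem_uIcc_of_mem_segment hz)
    · have := ((mem_segment_of_snd_eq (by exact rfl)).1 hz).1
      rw [this]; exact hc.2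
    · rw [show z = (S.n, c) from hz]; exact hc.2

theorem TauPath.free {S : Scene} {τ : ℝ} {p q : Pt} {π : List Pt}
    (h : TauPath S τ p q π) (hp : S.Free p) (hq : q.1 < S.n) {z : Pt} (hz : z ∈ pathPts π) :
    S.Free z := by
  induction h with
  | post p _ h => rwa [show z = p from hz]
  | wall p _ => rwa [show z = p from hz]
  | move p q r π hx hy hn hfree hend hrest ih =>
    obtain ⟨t, rfl⟩ := eq_cons_of_head? (hrest.spec hn).1
    rcases hz with hz | hz
    · exact S.free_of_freeSeg hfree hz
    · exact ih (S.free_of_freeSeg hfree (right_mem_segment ℝ p q)) hq hz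
  | around p r R c π hR hblock hc hn hrest ih =>
    obtain ⟨t, rfl⟩ := eq_cons_of_head? (hrest.spec hn.le).1
    obtain ⟨b1, b2, b3⟩ := hblock
    have hw := R.left_lt_right
    have ht := R.height_ge
    have hcc : R.bot ≤ c ∧ c ≤ R.top := by
      rcases hc.1 with ⟨h, _⟩ | ⟨h, _⟩ <;> rw [h] <;> constructor <;> linarith
    have hseg : ∀ y ∈ Set.uIcc p.2 c, R.bot ≤ y ∧ y ≤ R.top := by
      intro y hy
      have h1 : Set.uIcc p.2 c ⊆ Set.Icc R.bot R.top :=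
        Set.uIcc_subset_Icc ⟨b2.le, b3.le⟩ hcc
      exact h1 hy
    rcases hz with hz | hz | hz | hz
    · obtain ⟨h1, h2⟩ := (mem_segment_of_fst_eq (by exact rfl)).1 hz
      exact S.free_left_edge hR (b1.trans h1.symm) (hseg _ h2).1 (hseg _ h2).2
    · obtain ⟨h1, h2, h3⟩ := (mem_segment_right_iff (by exact rfl)
        (by simp only; linarith)).1 hz
      simp only at h1 h2 h3
      rcases hc.1 with ⟨h, _⟩ | ⟨h, _⟩
      · exact S.free_top_edge hR (h1.trans h) (by linarith) h3
      · exact S.free_bot_edge hR (h1.trans h) (by linarith) h3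
    · obtain ⟨h1, h2⟩ := (mem_segment_of_fst_eq (by exact rfl)).1 hz
      rw [Set.uIcc_comm] at h2
      exact S.free_right_edge hR h1 (hseg _ h2).1 (hseg _ h2).2
    · exact ih (S.free_right_edge hR rfl b2.le b3.le) hq hz
  | aroundToWall p R c hR hblock hc hp hn => exact absurd rfl hq.ne

/-- Above the level of a `τ`-path, the free points are not below the path. -/
theorem TauPath.exists_le {S : Scene} {τ : ℝ} {p q : Pt} {π : List Pt}
    (h : TauPath S τ p q π) (hq : q.1 < S.n) {z : Pt} (hz : S.Free z) (hz2 : p.2 ≤ z.2)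
    (hz1 : p.1 ≤ z.1) (hz1' : z.1 ≤ q.1) : ∃ t ∈ pathPts π, t.1 = z.1 ∧ t.2 ≤ z.2 := by
  induction h with
  | post p _ h => exact ⟨p, rfl, le_antisymm hz1 hz1', hz2⟩
  | wall p _ => exact ⟨p, rfl, le_antisymm hz1 hz1', hz2⟩
  | move p q r π hx hy hn hfree hend hrest ih =>
    obtain ⟨t, rfl⟩ := eq_cons_of_head? (hrest.spec hn).1
    rcases le_total z.1 q.1 with hzq | hzq
    · exact ⟨(z.1, p.2), Or.inl ((mem_segment_right_iff hy hx.le).2 ⟨rfl, hz1, hzq⟩), rfl, hz2⟩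
    · obtain ⟨t, ht, h1⟩ := ih hq (by rw [hy]; exact hz2) hzq hz1'
      exact ⟨t, Or.inr ht, h1⟩
  | around p r R c π hR hblock hc hn hrest ih =>
    obtain ⟨t, rfl⟩ := eq_cons_of_head? (hrest.spec hn.le).1
    obtain ⟨b1, b2, b3⟩ := hblock
    have hw := R.left_lt_right
    rcases le_or_gt (R.right : ℝ) z.1 with hzq | hzq
    · obtain ⟨t, ht, h1⟩ := ih hq hz2 hzq hz1'
      exact ⟨t, Or.inr (Or.inr (Or.inr ht)), h1⟩
    · rcases eq_or_lt_of_le hz1 with heq | hlt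
      · exact ⟨p, Or.inl (left_mem_segment ℝ _ _), heq, hz2⟩
      · by_cases hcz : c ≤ z.2
        · exact ⟨(z.1, c), Or.inr (Or.inl ((mem_segment_right_iff (by exact rfl)
            (by simp only; linarith)).2 ⟨rfl, hz1, hzq.le⟩)), rfl, hcz⟩
        -- A point at or above the level but below the detour lies inside `R` if the detour passes
        -- over the top; it cannot exist if the detour passes under the bottom.
        · exfalso
          rcases hc.1 with ⟨h, _⟩ | ⟨h, _⟩
          · exact hz R hR ⟨⟨by linarith, hzq⟩, by linarith, by linarith⟩
          · exact hcz (by linarith)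
  | aroundToWall p R c hR hblock hc hp hn => exact absurd rfl hq.ne

/-- Where a `τ`-path is above its level, it goes around an obstacle. -/
theorem TauPath.exists_obstacle {S : Scene} {τ : ℝ} {p q : Pt} {π : List Pt}
    (h : TauPath S τ p q π) (hq : q.1 < S.n) {A : Pt} (hA : A ∈ pathPts π) (hA2 : p.2 < A.2) :
    ∃ R ∈ S.obstacles, R.bot < p.2 ∧ A.2 ≤ R.top ∧ (R.left : ℝ) ≤ A.1 ∧ p.1 ≤ R.left := by
  induction h with
  | post p _ h => rw [show A = p from hA] at hA2; exact absurd hA2 (lt_irrefl _)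
  | wall p _ => rw [show A = p from hA] at hA2; exact absurd hA2 (lt_irrefl _)
  | move p q r π hx hy hn hfree hend hrest ih =>
    obtain ⟨t, rfl⟩ := eq_cons_of_head? (hrest.spec hn).1
    rcases hA with hA | hA
    · have := ((mem_segment_right_iff hy hx.le).1 hA).1
      linarith
    · obtain ⟨R, h1, h2, h3, h4, h5⟩ := ih hq hA (by rw [hy]; exact hA2)
      exact ⟨R, h1, by rw [← hy]; exact h2, h3, h4, hx.le.trans h5⟩
  | around p r R c π hR hblock hc hn hrest ih =>
    obtain ⟨t, rfl⟩ := eq_cons_of_head? (hrest.spec hn.le).1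
    obtain ⟨b1, b2, b3⟩ := hblock
    have hw := R.left_lt_right
    have ht := R.height_ge
    have hct : c ≤ R.top := by
      rcases hc.1 with ⟨h, _⟩ | ⟨h, _⟩ <;> rw [h]; linarith
    have hseg : ∀ y ∈ Set.uIcc p.2 c, y ≤ R.top := by
      intro y hy
      exact hy.2.trans (sup_le b3.le hct)
    have hself : A.2 ≤ R.top → (R.left : ℝ) ≤ A.1 → ∃ R ∈ S.obstacles, R.bot < p.2 ∧
        A.2 ≤ R.top ∧ (R.left : ℝ) ≤ A.1 ∧ p.1 ≤ R.left := fun h1 h2 =>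
      ⟨R, hR, b2, h1, h2, b1.ge⟩
    rcases hA with hA | hA | hA | hA
    · obtain ⟨h1, h2⟩ := (mem_segment_of_fst_eq (by exact rfl)).1 hA
      exact hself (hseg _ h2) (by linarith)
    · obtain ⟨h1, h2, h3⟩ := (mem_segment_right_iff (by exact rfl)
        (by simp only; linarith)).1 hA
      simp only at h1 h2 h3
      exact hself (by linarith) (by linarith)
    · obtain ⟨h1, h2⟩ := (mem_segment_of_fst_eq (by exact rfl)).1 hA
      rw [Set.uIcc_comm] at h2
      simp only at h1
      exact hself (hseg _ h2) (by linarith)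
    · obtain ⟨R', h1, h2, h3, h4, h5⟩ := ih hq hA hA2
      exact ⟨R', h1, h2, h3, h4, by simp only at h5; linarith⟩
  | aroundToWall p R c hR hblock hc hp hn => exact absurd rfl hq.ne

/-- Both vertical legs of a detour together cost less than 2τ, paid by the width of the obstacle.
Only the leg of a last detour cut off by the wall may lack that width, whence the additional τ. -/
theorem TauPath.pathLen_le {S : Scene} {τ : ℝ} (hτ : 0 < τ) {p q : Pt} {π : List Pt}
    (h : TauPath S τ p q π) (hp : p.1 ≤ S.n) :
    pathLen π ≤ (1 + 2 * τ) * (q.1 - p.1) + τ ∧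
      (q.1 < S.n → pathLen π ≤ (1 + 2 * τ) * (q.1 - p.1)) := by
  induction h with
  | post p hp h => simp [pathLen, hτ.le]
  | wall p hp => simp [pathLen, hτ.le]
  | move p q r π hx hy hn hfree hend hrest ih =>
    obtain ⟨t, rfl⟩ := eq_cons_of_head? (hrest.spec hn).1
    have h1 : |q.1 - p.1| + |q.2 - p.2| ≤ (1 + 2 * τ) * (q.1 - p.1) := by
      rw [hy, sub_self, abs_zero, abs_of_pos (by linarith)]
      nlinarith
    rw [pathLen_cons_cons]
    exact ⟨by linarith [(ih hn).1], fun hq => by linarith [(ih hn).2 hq]⟩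
  | around p r R c π hR hblock hc hn hrest ih =>
    obtain ⟨t, rfl⟩ := eq_cons_of_head? (hrest.spec hn.le).1
    have hw := R.left_lt_right
    have hb := hblock.1
    have hc2 := hc.2
    simp only [pathLen_cons_cons, sub_self, abs_zero, abs_sub_comm p.2 c]
    rw [abs_of_pos (by linarith : (0 : ℝ) < R.right - p.1)]
    have h2 : 2 * τ ≤ 2 * τ * (R.right - p.1) := by nlinarith
    obtain ⟨ih1, ih2⟩ := ih hn.le
    simp only at ih1 ih2
    exact ⟨by linarith, fun hq => by linarith [ih2 hq]⟩
  | aroundToWall p R c hR hblock hc hp hn =>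
    refine ⟨?_, fun hq => absurd rfl hq.ne⟩
    have hc2 := hc.2
    simp only [pathLen, sub_self, abs_zero]
    rw [abs_of_pos (by linarith : (0 : ℝ) < S.n - p.1)]
    nlinarith

/-- The vertex `a` in front supplies a segment to cut even when the τ-path is a single point. In an
edge, `a` is the post the edge starts from. -/
theorem TauPath.exists_isFinalPortion {S : Scene} {τ : ℝ} (hτ : 0 < τ) {p q : Pt} {π : List Pt}
    (h : TauPath S τ p q π) (hq : q.1 < S.n) (a : Pt) {B : Pt} (hB : B ∈ pathPts π) :
    ∃ π', IsFinalPortion (a :: π) B π' ∧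
      pathLen π' ≤ (1 + 2 * τ) * (q.1 - B.1) + |B.2 - p.2| := by
  induction h generalizing a with
  | post p _ h =>
    rw [show B = p from hB]
    exact ⟨_, ⟨[], a, p, [], rfl, right_mem_segment ℝ a p, rfl⟩, by simp [pathLen]⟩
  | wall p _ =>
    rw [show B = p from hB]
    exact ⟨_, ⟨[], a, p, [], rfl, right_mem_segment ℝ a p, rfl⟩, by simp [pathLen]⟩
  | move p q r π hx hy hn hfree hend hrest ih =>
    have hlen := (hrest.pathLen_le hτ hn).2 hq
    obtain ⟨t, rfl⟩ := eq_cons_of_head? (hrest.spec hn).1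
    rcases hB with hB | hB
    · refine ⟨_, ⟨[a], p, q, t, rfl, hB, rfl⟩, ?_⟩
      obtain ⟨h1, h2, h3⟩ := (mem_segment_right_iff hy hx.le).1 hB
      rw [pathLen_cons_cons, h1, hy, sub_self, abs_zero, abs_of_nonneg (by linarith)]
      nlinarith
    · obtain ⟨π', h1, h2⟩ := ih hq p hB
      exact ⟨π', h1.cons a, by rw [← hy]; exact h2⟩
  | around p r R c π hR hblock hc hn hrest ih =>
    have hlen := (hrest.pathLen_le hτ hn.le).2 hq
    obtain ⟨t, rfl⟩ := eq_cons_of_head? (hrest.spec hn.le).1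
    have hw := R.left_lt_right
    have hb := hblock.1
    have hc2 := hc.2
    simp only at hlen
    rcases hB with hB | hB | hB | hB
    · refine ⟨_, ⟨[a], p, (p.1, c), _, rfl, hB, rfl⟩, ?_⟩
      obtain ⟨h1, h2⟩ := (mem_segment_of_fst_eq (by exact rfl)).1 hB
      have h3 := Set.abs_sub_right_of_mem_uIcc h2
      simp only [pathLen_cons_cons, h1, sub_self, abs_zero, abs_sub_comm p.2 c] at h3 ⊢
      rw [abs_of_pos (by linarith : (0 : ℝ) < R.right - p.1)]
      have h4 : 2 * τ ≤ 2 * τ * (R.right - p.1) := by nlinarith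
      have h5 := abs_nonneg (B.2 - p.2)
      linarith
    · refine ⟨_, ⟨[a, p], (p.1, c), ((R.right : ℝ), c), _, rfl, hB, rfl⟩, ?_⟩
      obtain ⟨h1, h2, h3⟩ := (mem_segment_right_iff (by exact rfl)
        (by simp only; linarith)).1 hB
      simp only at h1 h2 h3
      simp only [pathLen_cons_cons, h1, sub_self, abs_zero, abs_sub_comm p.2 c]
      rw [abs_of_nonneg (by linarith : (0 : ℝ) ≤ R.right - B.1)]
      nlinarith
    · refine ⟨_, ⟨[a, p, (p.1, c)], ((R.right : ℝ), c), ((R.right : ℝ), p.2), _, rfl, hB, rfl⟩, ?_⟩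
      obtain ⟨h1, h2⟩ := (mem_segment_of_fst_eq (by exact rfl)).1 hB
      simp only at h1
      simp only [pathLen_cons_cons, h1, sub_self, abs_zero, abs_sub_comm p.2 B.2]
      linarith
    · obtain ⟨π', h1, h2⟩ := ih hq ((R.right : ℝ), c) hB
      exact ⟨π', ((h1.cons (p.1, c)).cons p).cons a, h2⟩
  | aroundToWall p R c hR hblock hc hp hn => exact absurd rfl hq.ne

/-- Every obstacle that is passed ends at an integral abscissa farther right, so the wall bounds
their number. An obstacle that blocks without offering a post has a corner closer than τ. -/
theorem exists_tauPath {S : Scene} {τ : ℝ} {x : ℤ} {y : ℝ} (hx : (x : ℝ) ≤ S.n)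
    (hp : S.Free ((x : ℝ), y)) : ∃ q π, TauPath S τ ((x : ℝ), y) q π := by
  obtain ⟨N, hN⟩ : ∃ N : ℕ, ⌈S.n⌉ - x ≤ N := ⟨(⌈S.n⌉ - x).toNat, Int.self_le_toNat _⟩
  induction N using Nat.strong_induction_on generalizing x with
  | _ N ih =>
    have hblk : ∀ x : ℤ, ⌈S.n⌉ - x ≤ N → (x : ℝ) < S.n → ∀ R ∈ S.obstacles,
        BlocksRight R ((x : ℝ), y) → ∃ q π, TauPath S τ ((x : ℝ), y) q π := by
      intro x hN hx R hR hb
      obtain ⟨b1, b2, b3⟩ := id hb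
      simp only at b1 b2 b3
      have hw := R.left_lt_right
      by_cases hpost : IsPost S τ ((x : ℝ), y)
      · exact ⟨_, _, .post _ hx hpost⟩
      · obtain ⟨c, hc⟩ : ∃ c, NearCorner R τ ((x : ℝ), y) c := by
          rcases le_total (R.top - y) (y - R.bot) with hle | hle
          · refine ⟨R.top, Or.inl ⟨rfl, hle⟩, ?_⟩
            simp only
            rw [abs_of_pos (by linarith)]
            by_contra hcon
            exact hpost ⟨R, hR, b1, by simp only; linarith, by simp only; linarith⟩
          · refine ⟨R.bot, Or.inr ⟨rfl, hle⟩, ?_⟩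
            simp only
            rw [abs_of_neg (by linarith)]
            by_contra hcon
            exact hpost ⟨R, hR, b1, by simp only; linarith, by simp only; linarith⟩
        by_cases hn : (R.right : ℝ) < S.n
        · have hlt : x < R.right := by
            have : (x : ℝ) < R.right := by linarith
            exact_mod_cast this
          have hceil : x < ⌈S.n⌉ := Int.lt_ceil.2 hx
          obtain ⟨q, π, h⟩ := ih (N - 1) (by omega) hn.le
            (S.free_right_edge hR rfl b2.le b3.le) (by omega)
          exact ⟨q, _, .around _ q R c π hR hb hc hn h⟩
        · exact ⟨_, _, .aroundToWall _ R c hR hb hc hx (not_lt.1 hn)⟩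
    rcases eq_or_lt_of_le hx with heq | hlt
    · exact ⟨_, _, .wall _ heq⟩
    · by_cases hb : ∃ R ∈ S.obstacles, BlocksRight R ((x : ℝ), y)
      · obtain ⟨R, hR, hb⟩ := hb
        exact hblk x hN hlt R hR hb
      · push Not at hb
        obtain ⟨q, q1, q2, q3, q4, q5⟩ := S.exists_move_right hp hlt hb
        simp only at q1 q2
        suffices h : ∃ r π, TauPath S τ q r π by
          obtain ⟨r, π, h⟩ := h
          exact ⟨r, _, .move _ q r π q1 q2 q3 q4 q5 h⟩
        rcases eq_or_lt_of_le q3 with heq | hqn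
        · exact ⟨_, _, .wall _ heq⟩
        · obtain ⟨R, hR, hbq⟩ := q5.resolve_right hqn.ne
          have hq : q = ((R.left : ℝ), y) := Prod.ext hbq.1.symm q2
          rw [hq] at hbq hqn q1 ⊢
          have : x < R.left := by simp only at q1; exact_mod_cast q1
          exact hblk R.left (by omega) hqn R hR hbq

/-! ## Edges of the tree -/

/-- `δ` is the edge from the post `P` to the post `Q`: go vertically to the height `y`, and then
along a `τ`-path. -/
def IsEdge (S : Scene) (τ y : ℝ) (P Q : Pt) (δ : List Pt) : Prop :=
  |P.2 - y| = τ ∧ P.1 < S.n ∧ Q.1 < S.n ∧ ∃ π, δ = P :: π ∧ TauPath S τ (P.1, y) Q π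

namespace IsEdge

variable {S : Scene} {τ y : ℝ} {P Q : Pt} {δ : List Pt}

theorem head? (h : IsEdge S τ y P Q δ) : δ.head? = some P := by
  obtain ⟨_, _, _, π, rfl, _⟩ := h
  rfl

theorem getLast? (h : IsEdge S τ y P Q δ) : δ.getLast? = some Q := by
  obtain ⟨_, hP, _, π, rfl, hπ⟩ := h
  obtain ⟨h1, h2, _⟩ := hπ.spec hP.le
  obtain ⟨t, rfl⟩ := eq_cons_of_head? h1
  rw [List.getLast?_cons_cons, h2]

theorem xMono (h : IsEdge S τ y P Q δ) : XMono δ := by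
  obtain ⟨_, hP, _, π, rfl, hπ⟩ := h
  obtain ⟨h1, _, _, _, h5⟩ := hπ.spec hP.le
  obtain ⟨t, rfl⟩ := eq_cons_of_head? h1
  exact ⟨le_rfl, Or.inl rfl, h5⟩

theorem two_le_length (h : IsEdge S τ y P Q δ) : 2 ≤ δ.length := by
  obtain ⟨_, hP, _, π, rfl, hπ⟩ := h
  obtain ⟨t, rfl⟩ := eq_cons_of_head? (hπ.spec hP.le).1
  simp

theorem fst_le (h : IsEdge S τ y P Q δ) : P.1 ≤ Q.1 := by
  obtain ⟨_, hP, _, π, rfl, hπ⟩ := h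
  exact (hπ.spec hP.le).2.2.1

theorem snd_eq (h : IsEdge S τ y P Q δ) : Q.2 = y := by
  obtain ⟨_, hP, hQ, π, rfl, hπ⟩ := h
  exact (hπ.isPost hQ).1

theorem isPost (h : IsEdge S τ y P Q δ) : IsPost S τ Q := by
  obtain ⟨_, hP, hQ, π, rfl, hπ⟩ := h
  exact (hπ.isPost hQ).2

theorem mem_of_fst_eq (h : IsEdge S τ y P Q δ) {z : Pt} (hz : z.1 = P.1)
    (hz2 : z.2 ∈ Set.uIcc P.2 y) : z ∈ pathPts δ := by
  obtain ⟨_, hP, hQ, π, rfl, hπ⟩ := h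
  obtain ⟨t, rfl⟩ := eq_cons_of_head? (hπ.spec hP.le).1
  exact Or.inl ((mem_segment_of_fst_eq (by exact rfl)).2 ⟨hz, hz2⟩)

theorem abs_snd_sub_le (h : IsEdge S τ y P Q δ) (hτ : 0 < τ) {z : Pt} (hz : z ∈ pathPts δ) :
    |z.2 - Q.2| ≤ τ := by
  have hQy := h.snd_eq
  obtain ⟨hy, hP, hQ, π, rfl, hπ⟩ := h
  have h1 := fun z hz => (hπ.abs_snd_sub_lt hτ hP.le (z := z) hz).le
  obtain ⟨t, rfl⟩ := eq_cons_of_head? (hπ.spec hP.le).1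
  rw [hQy]
  rcases hz with hz | hz
  · have h2 := (mem_segment_of_fst_eq (by exact rfl)).1 hz
    rw [← hy, abs_sub_comm z.2, abs_sub_comm P.2]
    exact Set.abs_sub_right_of_mem_uIcc h2.2
  · exact h1 z hz

theorem pathLen_le (h : IsEdge S τ y P Q δ) (hτ : 0 < τ) :
    pathLen δ ≤ τ + (1 + 2 * τ) * (Q.1 - P.1) := by
  obtain ⟨hy, hP, hQ, π, rfl, hπ⟩ := h
  have h1 := (hπ.pathLen_le hτ hP.le).2 hQ
  obtain ⟨t, rfl⟩ := eq_cons_of_head? (hπ.spec hP.le).1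
  rw [pathLen_cons_cons, sub_self, abs_zero, abs_sub_comm, hy]
  simp only at h1
  linarith

theorem exists_isFinalPortion (h : IsEdge S τ y P Q δ) (hτ : 0 < τ) {B : Pt}
    (hB : B ∈ pathPts δ) :
    ∃ π, IsFinalPortion δ B π ∧ pathLen π ≤ (1 + 2 * τ) * (Q.1 - B.1) + |B.2 - Q.2| := by
  have hQy := h.snd_eq
  obtain ⟨hy, hP, hQ, π, rfl, hπ⟩ := h
  have hlen := (hπ.pathLen_le hτ hP.le).2 hQ
  have hfp := fun B hB => hπ.exists_isFinalPortion hτ hQ P (B := B) hB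
  obtain ⟨t, rfl⟩ := eq_cons_of_head? (hπ.spec hP.le).1
  rw [hQy]
  rcases hB with hB | hB
  · refine ⟨_, ⟨[], P, (P.1, y), t, rfl, hB, rfl⟩, ?_⟩
    have h2 := (mem_segment_of_fst_eq (by exact rfl)).1 hB
    rw [pathLen_cons_cons, h2.1, sub_self, abs_zero, abs_sub_comm]
    simp only at hlen ⊢
    linarith
  · exact hfp B hB

theorem exists_le (h : IsEdge S τ y P Q δ) {z : Pt} (hz : S.Free z) (hz2 : y ≤ z.2)
    (hz1 : P.1 ≤ z.1) (hz1' : z.1 ≤ Q.1) : ∃ t ∈ pathPts δ, t.1 = z.1 ∧ t.2 ≤ z.2 := by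
  obtain ⟨hy, hP, hQ, π, rfl, hπ⟩ := h
  obtain ⟨t, ht, h1⟩ := hπ.exists_le hQ hz hz2 hz1 hz1'
  obtain ⟨t', rfl⟩ := eq_cons_of_head? (hπ.spec hP.le).1
  exact ⟨t, Or.inr ht, h1⟩

/-- Going backward along an edge until `x = c`, one stops at the `τ`-path. -/
theorem mem_tauPath_of_back (h : IsEdge S τ y P Q δ) {A : Pt} {ρ : List Pt}
    (hρ : IsFinalPortion δ A ρ) (huniq : ∀ z ∈ pathPts ρ, z.1 = A.1 → z = A) :
    ∃ π, TauPath S τ (P.1, y) Q π ∧ A ∈ pathPts π := by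
  obtain ⟨hy, hP, hQ, π, rfl, hπ⟩ := h
  refine ⟨π, hπ, ?_⟩
  obtain ⟨h1, h2, h3, _⟩ := hπ.spec hP.le
  obtain ⟨t, rfl⟩ := eq_cons_of_head? h1
  obtain ⟨γ₁, a, b, γ₂, heq, hA, rfl⟩ := hρ
  cases γ₁ with
  | nil =>
    simp only [List.nil_append, List.cons.injEq] at heq
    obtain ⟨rfl, rfl, rfl⟩ := heq
    have hA1 := ((mem_segment_of_fst_eq (by exact rfl)).1 hA).1
    have hb : ((P.1, y) : Pt) ∈ pathPts ((P.1, y) :: t) := head_mem_pathPts rfl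
    rw [← huniq (P.1, y) (Or.inr hb) hA1.symm]
    exact hb
  | cons x γ₁ =>
    simp only [List.cons_append, List.cons.injEq] at heq
    exact IsFinalPortion.mem (π := A :: b :: γ₂) ⟨γ₁, a, b, γ₂, heq.2, hA, rfl⟩

end IsEdge

theorem IsPost.free {S : Scene} {τ : ℝ} {p : Pt} (h : IsPost S τ p) {z : Pt}
    (hz1 : z.1 = p.1) (hz2 : |z.2 - p.2| ≤ τ) : S.Free z := by
  obtain ⟨R, hR, h1, h2, h3⟩ := h
  rw [abs_le] at hz2
  exact S.free_left_edge hR (h1.trans hz1.symm) (by linarith) (by linarith)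

/-! ## The tree of posts -/

/-- The `p`-th post of fence `j` has been found, where `m i` posts of fence `i` have been found. -/
def InTree (k : ℕ) (m : ℕ → ℕ) (j p : ℕ) : Prop := 1 ≤ j ∧ j ≤ k ∧ 1 ≤ p ∧ p ≤ m j

/-- The posts `P j p` and the tree paths `T j p` to them form a tree as it is constructed by the
procedure. -/
structure FenceTree (S : Scene) (τ L x₀ : ℝ) (k : ℕ) (m : ℕ → ℕ) (P : ℕ → ℕ → Pt)
    (T : ℕ → ℕ → List Pt) : Prop where
  one_le_tau : 1 ≤ τ
  start_pos : 0 < x₀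
  one_le_cnt : 1 ≤ m 1
  anti : ∀ j, 1 ≤ j → j < k → m (j + 1) ≤ m j
  root : P 1 1 = (x₀, -L)
  root_path : T 1 1 = [P 1 1]
  post_zero : ∀ j, (P j 0).1 = 0
  height : ∀ j p, InTree k m j p → (P j p).2 = -L + ((p : ℝ) - j) * τ
  post : ∀ j p, InTree k m j p → IsPost S τ (P j p)
  lt_wall : ∀ j p, InTree k m j p → (P j p).1 < S.n
  edge : ∀ j p, InTree k m j p → (j = 1 ∧ p = 1) ∨
    (∃ p', 1 ≤ p' ∧ p = p' + 1 ∧ (∀ j', 1 ≤ j' → j = j' + 1 → (P j' p).1 ≤ (P j p').1) ∧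
      ∃ δ, IsEdge S τ ((P j p').2 + τ) (P j p') (P j p) δ ∧ T j p = T j p' ++ δ) ∨
    (∃ j', 1 ≤ j' ∧ j = j' + 1 ∧ (∀ p', 1 ≤ p' → p = p' + 1 → (P j p').1 < (P j' p).1) ∧
      ∃ δ, IsEdge S τ ((P j' p).2 - τ) (P j' p) (P j p) δ ∧ T j p = T j' p ++ δ)

namespace FenceTree

variable {S : Scene} {τ L x₀ : ℝ} {k : ℕ} {m : ℕ → ℕ} {P : ℕ → ℕ → Pt} {T : ℕ → ℕ → List Pt}

theorem tau_pos (h : FenceTree S τ L x₀ k m P T) : 0 < τ := zero_lt_one.trans_le h.one_le_tau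

theorem cnt_le (h : FenceTree S τ L x₀ k m P T) {i j : ℕ} (hi : 1 ≤ i) (hij : i ≤ j) (hj : j ≤ k) :
    m j ≤ m i := by
  induction j, hij using Nat.le_induction with
  | base => exact le_rfl
  | succ j hij ih => exact (h.anti j (hi.trans hij) hj).trans (ih (by omega))

theorem inTree_of_le (h : FenceTree S τ L x₀ k m P T) {i j p q : ℕ} (hj : InTree k m j q)
    (hi : 1 ≤ i) (hij : i ≤ j) (hp : 1 ≤ p) (hpq : p ≤ q) : InTree k m i p :=
  ⟨hi, hij.trans hj.2.1, hp, hpq.trans (hj.2.2.2.trans (h.cnt_le hi hij hj.2.1))⟩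

/-- Induction along the tree. -/
theorem induction (h : FenceTree S τ L x₀ k m P T) {motive : ℕ → ℕ → Prop} (root : motive 1 1)
    (up : ∀ j p δ, 1 ≤ p → InTree k m j (p + 1) →
      (∀ j', 1 ≤ j' → j = j' + 1 → (P j' (p + 1)).1 ≤ (P j p).1) →
      IsEdge S τ ((P j p).2 + τ) (P j p) (P j (p + 1)) δ → T j (p + 1) = T j p ++ δ →
      motive j p → motive j (p + 1))
    (down : ∀ j p δ, 1 ≤ j → InTree k m (j + 1) p →
      (∀ p', 1 ≤ p' → p = p' + 1 → (P (j + 1) p').1 < (P j p).1) →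
      IsEdge S τ ((P j p).2 - τ) (P j p) (P (j + 1) p) δ → T (j + 1) p = T j p ++ δ →
      motive j p → motive (j + 1) p) {j p : ℕ} (hjp : InTree k m j p) : motive j p := by
  obtain ⟨n, hn⟩ : ∃ n, n = j + p := ⟨_, rfl⟩
  induction n using Nat.strong_induction_on generalizing j p with
  | _ n ih =>
    rcases h.edge j p hjp with ⟨rfl, rfl⟩ | ⟨p', hp', rfl, hc, δ, hδ, hT⟩ |
      ⟨j', hj', rfl, hc, δ, hδ, hT⟩
    · exact root
    · exact up j p' δ hp' hjp hc hδ hT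
        (ih (j + p') (by omega) (h.inTree_of_le hjp hjp.1 le_rfl hp' (by omega)) rfl)
    · exact down j' p δ hj' hjp hc hδ hT
        (ih (j' + p) (by omega) (h.inTree_of_le hjp hj' (by omega) hjp.2.2.1 le_rfl) rfl)

/-- For an up-edge this is monotonicity of the edge. For a down-edge the side condition recorded in
`edge` puts its source to the right of the preceding post of the fence. -/
theorem fst_le_succ (h : FenceTree S τ L x₀ k m P T) {j p : ℕ} (hj : InTree k m j (p + 1)) :
    1 ≤ p → (P j p).1 ≤ (P j (p + 1)).1 := by
  intro hp
  rcases h.edge j (p + 1) hj with ⟨_, hp1⟩ | ⟨p', hp', heq, hc, δ, hδ, hT⟩ |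
      ⟨j', hj', rfl, hc, δ, hδ, hT⟩
  · omega
  · obtain rfl : p = p' := by omega
    exact hδ.fst_le
  · exact (hc p hp rfl).le.trans hδ.fst_le

/-- Dual to `fst_le_succ`: here the side condition of the up-edge is the one that is needed. -/
theorem fst_le_fence_succ (h : FenceTree S τ L x₀ k m P T) {j p : ℕ} (hj : InTree k m (j + 1) p)
    (h1 : 1 ≤ j) : (P j p).1 ≤ (P (j + 1) p).1 := by
  rcases h.edge (j + 1) p hj with ⟨h2, hp1⟩ | ⟨p', hp', rfl, hc, δ, hδ, hT⟩ |
      ⟨j', hj', heq, hc, δ, hδ, hT⟩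
  · omega
  · exact (hc j h1 rfl).trans hδ.fst_le
  · obtain rfl : j = j' := by omega
    exact hδ.fst_le

theorem fst_mono (h : FenceTree S τ L x₀ k m P T) {i j p q : ℕ} (hj : InTree k m j q)
    (hi : 1 ≤ i) (hij : i ≤ j) (hp : 1 ≤ p) (hpq : p ≤ q) : (P i p).1 ≤ (P j q).1 := by
  have h1 : (P i p).1 ≤ (P i q).1 := by
    have hiq := h.inTree_of_le hj hi hij (hp.trans hpq) le_rfl
    clear hj
    induction q, hpq using Nat.le_induction with
    | base => exact le_rfl
    | succ q hpq ih =>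
      exact (ih (h.inTree_of_le hiq hi le_rfl (hp.trans hpq) (Nat.le_succ q))).trans
        (h.fst_le_succ hiq (hp.trans hpq))
  refine h1.trans ?_
  clear h1
  induction j, hij using Nat.le_induction with
  | base => exact le_rfl
  | succ j hij ih =>
    exact (ih (h.inTree_of_le hj (hi.trans hij) (Nat.le_succ j) (hp.trans hpq) le_rfl)).trans
      (h.fst_le_fence_succ hj (hi.trans hij))

theorem start_le (h : FenceTree S τ L x₀ k m P T) {j p : ℕ} (hj : InTree k m j p) :
    x₀ ≤ (P j p).1 := by
  have := h.fst_mono hj le_rfl hj.1 le_rfl hj.2.2.1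
  rwa [h.root] at this

theorem height_succ (h : FenceTree S τ L x₀ k m P T) {j p : ℕ} (hj : InTree k m j (p + 1))
    (hp : 1 ≤ p) : (P j (p + 1)).2 = (P j p).2 + τ := by
  rw [h.height _ _ hj, h.height _ _ (h.inTree_of_le hj hj.1 le_rfl hp (Nat.le_succ p))]
  push_cast; ring

theorem height_fence_succ (h : FenceTree S τ L x₀ k m P T) {j p : ℕ}
    (hj : InTree k m (j + 1) p) (h1 : 1 ≤ j) : (P (j + 1) p).2 = (P j p).2 - τ := by
  rw [h.height _ _ hj, h.height _ _ (h.inTree_of_le hj h1 (Nat.le_succ j) hj.2.2.1 le_rfl)]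
  push_cast; ring

theorem path_spec (h : FenceTree S τ L x₀ k m P T) {j p : ℕ} (hj : InTree k m j p) :
    (T j p).head? = some (P 1 1) ∧ (T j p).getLast? = some (P j p) ∧ XMono (T j p) := by
  have key : ∀ γ δ : List Pt, ∀ Q Q' y, IsEdge S τ y Q Q' δ → (γ.head? = some (P 1 1) ∧
      γ.getLast? = some Q ∧ XMono γ) →
      ((γ ++ δ).head? = some (P 1 1) ∧ (γ ++ δ).getLast? = some Q' ∧ XMono (γ ++ δ)) := by
    rintro γ δ Q Q' y hδ ⟨h1, h2, h3⟩
    obtain ⟨t, rfl⟩ := eq_cons_of_head? h1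
    refine ⟨rfl, ?_, h3.append hδ.xMono h2 hδ.head?⟩
    rw [List.getLast?_append, hδ.getLast?]; rfl
  refine h.induction (motive := fun j p => (T j p).head? = some (P 1 1) ∧
    (T j p).getLast? = some (P j p) ∧ XMono (T j p)) ?_ ?_ ?_ hj
  · rw [h.root_path]; simp [XMono]
  · intro j p δ hp hjp hc hδ hT ih
    rw [hT]; exact key _ _ _ _ _ hδ ih
  · intro j p δ hp hjp hc hδ hT ih
    rw [hT]; exact key _ _ _ _ _ hδ ih

theorem two_le_length (h : FenceTree S τ L x₀ k m P T) {j p : ℕ} (hj : InTree k m (j + 1) p)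
    (h1 : 1 ≤ j) : 2 ≤ (T (j + 1) p).length := by
  rcases h.edge (j + 1) p hj with ⟨h2, _⟩ | ⟨p', _, _, _, δ, hδ, hT⟩ | ⟨j', _, _, _, δ, hδ, hT⟩
  · omega
  all_goals
    rw [hT, List.length_append]
    have := hδ.two_le_length
    omega

/-- A point of the tree path to a post which is at the last abscissa of the path, not lower than
the post: the final portion from there goes straight down. -/
theorem exists_final_straight_down (h : FenceTree S τ L x₀ k m P T) {j p : ℕ}
    (hj : InTree k m j p) : (∀ p', 1 ≤ p' → p = p' + 1 → (P j p').1 < (P j p).1) →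
    ∀ B ∈ pathPts (T j p), B.1 = (P j p).1 → (P j p).2 ≤ B.2 → ∀ δ : List Pt,
      δ.head? = some (P j p) →
      ∃ π, IsFinalPortion (T j p ++ δ) B π ∧ pathLen π ≤ (B.2 - (P j p).2) + pathLen δ := by
  have hτ := h.tau_pos
  have key : ∀ (γ ε δ : List Pt) (Q Q' B : Pt) (y : ℝ), IsEdge S τ y Q Q' ε → B ∈ pathPts ε →
      B.1 = Q'.1 → Q'.2 ≤ B.2 → δ.head? = some Q' →
      ∃ π, IsFinalPortion (γ ++ ε ++ δ) B π ∧ pathLen π ≤ (B.2 - Q'.2) + pathLen δ := by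
    intro γ ε δ Q Q' B y hε hB hB1 hB2 hδ
    obtain ⟨π, h1, h2⟩ := hε.exists_isFinalPortion hτ hB
    refine ⟨π ++ δ, (h1.append_left γ).append_right δ, ?_⟩
    rw [pathLen_append (h1.getLast?.trans hε.getLast?) hδ]
    rw [hB1, abs_of_nonneg (by linarith)] at h2
    linarith
  refine h.induction (motive := fun j p =>
    (∀ p', 1 ≤ p' → p = p' + 1 → (P j p').1 < (P j p).1) →
    ∀ B ∈ pathPts (T j p), B.1 = (P j p).1 → (P j p).2 ≤ B.2 → ∀ δ : List Pt,
      δ.head? = some (P j p) →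
      ∃ π, IsFinalPortion (T j p ++ δ) B π ∧ pathLen π ≤ (B.2 - (P j p).2) + pathLen δ)
    ?_ ?_ ?_ hj
  · intro _ B hB hB1 hB2 δ hδ
    obtain ⟨t, rfl⟩ := eq_cons_of_head? hδ
    rw [h.root_path] at hB ⊢
    rw [show B = P 1 1 from hB]
    exact ⟨_, ⟨[], P 1 1, P 1 1, t, rfl, left_mem_segment ℝ _ _, rfl⟩,
      by rw [pathLen_cons_self]; linarith⟩
  · intro j p ε hp hjp hc hε hT ih hcond B hB hB1 hB2 δ hδ
    rw [hT] at hB ⊢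
    have hspec := h.path_spec (h.inTree_of_le hjp hjp.1 le_rfl hp (Nat.le_succ p))
    rw [pathPts_append hspec.2.1 hε.head?] at hB
    rcases hB with hB | hB
    · have h1 := hspec.2.2.le_last hspec.2.1 hB
      have h2 := hcond p hp rfl
      linarith
    · exact key _ _ _ _ _ _ _ hε hB hB1 hB2 hδ
  · intro j p ε hj1 hjp hc hε hT ih hcond B hB hB1 hB2 δ hδ
    rw [hT] at hB ⊢
    have hjp' := h.inTree_of_le hjp hj1 (Nat.le_succ j) hjp.2.2.1 le_rfl
    have hspec := h.path_spec hjp'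
    rw [pathPts_append hspec.2.1 hε.head?] at hB
    by_cases hBε : B ∈ pathPts ε
    · exact key _ _ _ _ _ _ _ hε hBε hB1 hB2 hδ
    · have hB := hB.resolve_right hBε
      have h1 := hspec.2.2.le_last hspec.2.1 hB
      have h2 := hε.fst_le
      have hB1' : B.1 = (P j p).1 := by linarith
      have hy := hε.snd_eq
      -- Below the source of the down-edge, `B` would lie on the vertical part of that edge.
      have hB2' : (P j p).2 ≤ B.2 := by
        by_contra hcon
        push Not at hcon
        exact hBε (hε.mem_of_fst_eq hB1' (Set.mem_uIcc_of_ge (by linarith) hcon.le))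
      obtain ⟨π, h3, h4⟩ := ih (fun p' hp' heq => by
        have h5 := h.fst_le_fence_succ (h.inTree_of_le hjp hjp.1 le_rfl hp' (by omega)) hj1
        have h6 := hcond p' hp' heq
        linarith) B hB hB1' hB2' (ε ++ δ) (by
          obtain ⟨t, rfl⟩ := eq_cons_of_head? hε.head?; rfl)
      refine ⟨π, by rw [List.append_assoc]; exact h3, ?_⟩
      rw [pathLen_append hε.getLast? hδ] at h4
      have h5 := hε.pathLen_le hτ
      have h6 : (P (j + 1) p).1 - (P j p).1 = 0 := by linarith
      rw [h6, mul_zero] at h5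
      linarith

/-- The cost of the second and third phase of `GoDown`, apart from the horizontal part of the
second phase. -/
theorem exists_final_cheap (h : FenceTree S τ L x₀ k m P T) {j : ℕ} (hj1 : 1 ≤ j) {c A₂ : ℝ}
    {B : Pt} (hcB : c ≤ B.1) {q : ℕ} (hq : InTree k m (j + 1) q)
    (hB : B ∈ pathPts (T (j + 1) q)) (hc : (P j q).1 ≤ c) (hA : (P (j + 1) q).2 ≤ A₂)
    (hBA : B.2 ≤ A₂)
    (hfirst : B.1 = c → ∀ z ∈ pathPts (T (j + 1) q), z.1 = c → z.2 ≤ A₂ → z.2 ≤ B.2) :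
    ∃ r, 1 ≤ r ∧ r ≤ q ∧ (∀ p, r ≤ p → p ≤ q → c ≤ (P (j + 1) p).1) ∧
      ∃ π, IsFinalPortion (T (j + 1) q) B π ∧ pathLen π + (A₂ - B.2) ≤
        (1 + 2 * τ) * ((P (j + 1) q).1 - B.1) + (A₂ - (P (j + 1) q).2) +
          2 * ((q : ℝ) - r + 1) * τ := by
  have hτ := h.tau_pos
  -- On the last edge `B` is within τ of the height of the target, so descending too far and
  -- climbing back costs at most 2τ; this is the case r = q.
  have hedge : ∀ (q : ℕ) (γ ε : List Pt) (Q : Pt) (y : ℝ), InTree k m (j + 1) q →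
      IsEdge S τ y Q (P (j + 1) q) ε → B ∈ pathPts ε →
      ∃ r, 1 ≤ r ∧ r ≤ q ∧ (∀ p, r ≤ p → p ≤ q → c ≤ (P (j + 1) p).1) ∧
        ∃ π, IsFinalPortion (γ ++ ε) B π ∧ pathLen π + (A₂ - B.2) ≤
          (1 + 2 * τ) * ((P (j + 1) q).1 - B.1) + (A₂ - (P (j + 1) q).2) +
            2 * ((q : ℝ) - r + 1) * τ := by
    intro q γ ε Q y hq hε hB
    refine ⟨q, hq.2.2.1, le_rfl, ?_, ?_⟩
    · intro p hp1 hp2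
      obtain rfl : p = q := le_antisymm hp2 hp1
      exact hcB.trans (hε.xMono.le_last hε.getLast? hB)
    · obtain ⟨π, h1, h2⟩ := hε.exists_isFinalPortion hτ hB
      refine ⟨π, h1.append_left γ, ?_⟩
      have h3 := hε.abs_snd_sub_le hτ hB
      have h4 : (P (j + 1) q).2 - B.2 + |B.2 - (P (j + 1) q).2| ≤ 2 * τ := by
        have := neg_le_abs (B.2 - (P (j + 1) q).2)
        linarith
      have h5 : 2 * ((q : ℝ) - q + 1) * τ = 2 * τ := by ring
      rw [h5]; linarith
  induction q with
  | zero => exact absurd hq.2.2.1 (by norm_num)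
  | succ q ih =>
    rcases h.edge (j + 1) (q + 1) hq with ⟨h2, _⟩ | ⟨p', hp', heq, hcond, ε, hε, hT⟩ |
      ⟨j', hj', heq, hcond, ε, hε, hT⟩
    · omega
    · obtain rfl : q = p' := by omega
      have hq' := h.inTree_of_le hq hq.1 le_rfl hp' (Nat.le_succ q)
      have hspec := h.path_spec hq'
      rw [hT] at hB hfirst ⊢
      rw [pathPts_append hspec.2.1 hε.head?] at hB hfirst
      by_cases hBε : B ∈ pathPts ε
      · exact hedge (q + 1) _ ε _ _ hq hε hBε
      · have hB := hB.resolve_right hBε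
        have hy := hε.snd_eq
        obtain ⟨r, h1, h2, h3, π, h4, h5⟩ := ih hq' hB
          ((h.fst_le_succ (h.inTree_of_le hq hj1 (Nat.le_succ j) (by omega) le_rfl) hp').trans hc)
          (by linarith) (fun hBc z hz => hfirst hBc z (Or.inl hz))
        refine ⟨r, h1, by omega, ?_, π ++ ε, h4.append_right ε, ?_⟩
        · intro p hp1 hp2
          rcases Nat.lt_or_ge q p with hlt | hge
          · obtain rfl : p = q + 1 := by omega
            exact (h3 q h2 le_rfl).trans hε.fst_le
          · exact h3 p hp1 hge
        · rw [pathLen_append (h4.getLast?.trans hspec.2.1) hε.head?]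
          -- Each further up-edge costs τ for its climb and raises the target by τ, which uses up
          -- the 2τ gained from q + 1.
          have h6 := hε.pathLen_le hτ
          push_cast
          have h7 : (1 + 2 * τ) * ((P (j + 1) (q + 1)).1 - B.1) =
            (1 + 2 * τ) * ((P (j + 1) (q + 1)).1 - (P (j + 1) q).1) +
              (1 + 2 * τ) * ((P (j + 1) q).1 - B.1) := by ring
          have h8 : 2 * ((q : ℝ) + 1 - r + 1) * τ = 2 * ((q : ℝ) - r + 1) * τ + 2 * τ := by ring
          rw [h7, h8]
          linarith
    · obtain rfl : j = j' := by omega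
      have hq' := h.inTree_of_le hq hj1 (Nat.le_succ j) hq.2.2.1 le_rfl
      have hspec := h.path_spec hq'
      rw [hT] at hB hfirst ⊢
      rw [pathPts_append hspec.2.1 hε.head?] at hB hfirst
      by_cases hBε : B ∈ pathPts ε
      · exact hedge (q + 1) _ ε _ _ hq hε hBε
      · have hB := hB.resolve_right hBε
        have hy := hε.snd_eq
        have h1 := hspec.2.2.le_last hspec.2.1 hB
        -- Before the down-edge the path does not get beyond `P j (q + 1)`, whose abscissa is at
        -- most `c`. So `B` is straight above that post, and `hfirst` excludes that the vertical
        -- part of the down-edge was met instead.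
        have hBc : B.1 = c := by linarith
        have hcP : c = (P j (q + 1)).1 := by linarith
        have hA' : (P j (q + 1)).2 ≤ A₂ := by
          by_contra hcon
          push Not at hcon
          have hmem : ((c, A₂) : Pt) ∈ pathPts ε :=
            hε.mem_of_fst_eq hcP (Set.mem_uIcc_of_ge (by simp only; linarith) hcon.le)
          have h2 := hfirst hBc _ (Or.inr hmem) rfl le_rfl
          exact hBε (by
            rw [show B = (c, A₂) from Prod.ext hBc (le_antisymm hBA h2)]; exact hmem)
        have hB2 : (P j (q + 1)).2 ≤ B.2 :=
          hfirst hBc _ (Or.inl (getLast_mem_pathPts hspec.2.1)) hcP.symm hA'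
        obtain ⟨π, h3, h4⟩ := h.exists_final_straight_down hq' (fun p' hp' heq => by
          have h5 := h.fst_le_fence_succ (h.inTree_of_le hq hq.1 le_rfl hp' (by omega)) hj1
          have h6 := hcond p' hp' heq
          linarith) B hB (by linarith) hB2 ε hε.head?
        refine ⟨q + 1, by omega, le_rfl, ?_, π, h3, ?_⟩
        · intro p hp1 hp2
          obtain rfl : p = q + 1 := le_antisymm hp2 hp1
          exact hcP.le.trans hε.fst_le
        · have h6 := hε.pathLen_le hτ
          rw [hBc, hcP]
          have h8 : 2 * (((q + 1 : ℕ) : ℝ) - (q + 1 : ℕ) + 1) * τ = 2 * τ := by ring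
          rw [h8]
          linarith

end FenceTree

/-! ## Greedy right-down paths meet the tree -/

/-- The point `z` is on or above the path `γ`. -/
def OnOrAbove (γ : List Pt) (z : Pt) : Prop := ∃ t ∈ pathPts γ, t.1 = z.1 ∧ t.2 ≤ z.2

/-- A move that crossed `γ` would meet it at an earlier point, by the intermediate value property,
and would have stopped there. The point `e` guarantees that `γ` extends far enough to the right. -/
theorem GreedyRightDown.onOrAbove {S : Scene} {C : Set Pt} {p r : Pt} {π : List Pt}
    (h : GreedyRightDown S C p r π) {γ : List Pt} (hγ : XMono γ) (hC : pathPts γ ⊆ C) {e : Pt}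
    (he : e ∈ pathPts γ) (hre : r.1 ≤ e.1) (hp : OnOrAbove γ p) : OnOrAbove γ r := by
  induction h with
  | reached p h => exact hp
  | right p q r π hx hy hfree hfirst hend hrest ih =>
    apply ih hre
    obtain ⟨t, ht, ht1, ht2⟩ := hp
    have hqr := hrest.spec.2.2.2.1
    obtain ⟨t', ht', h1⟩ := hγ.exists_mem_abscissa ht he (x := q.1) (by linarith) (by linarith)
    by_cases h2 : t'.2 ≤ q.2
    · exact ⟨t', ht', h1, h2⟩
    · obtain ⟨z, hz, hz2, hz1, hz1'⟩ := hγ.exists_mem_height ht ht' (by linarith) (y := p.2)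
        (Set.mem_uIcc_of_le ht2 (by linarith))
      have : z = q := hfirst z ((mem_segment_right_iff hy hx.le).2
        ⟨hz2, by linarith, by linarith⟩) (hC hz)
      subst this
      exact ⟨z, hz, rfl, le_rfl⟩
  | down p q r R π hR hblock hx hy hy' hfirst hend hrest ih =>
    apply ih hre
    obtain ⟨t, ht, ht1, ht2⟩ := hp
    by_cases h2 : t.2 ≤ q.2
    · exact ⟨t, ht, by rw [ht1, hx], h2⟩
    · have : t = q := hfirst t ((mem_segment_down_iff hx hy.le).2 ⟨ht1, by linarith, ht2⟩) (hC ht)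
      exact absurd (by rw [this]) h2

theorem GreedyRightDown.fst_le {S : Scene} {C : Set Pt} {p r : Pt} {π : List Pt}
    (h : GreedyRightDown S C p r π) {X : ℝ} (hC : ∀ z : Pt, X ≤ z.1 → z ∈ C) (hp : p.1 ≤ X) :
    r.1 ≤ X := by
  induction h with
  | reached p h => exact hp
  | right p q r π hx hy hfree hfirst hend hrest ih =>
    apply ih
    by_contra hcon
    push Not at hcon
    have : ((X, p.2) : Pt) = q := hfirst _ ((mem_segment_right_iff hy hx.le).2
      ⟨rfl, hp, hcon.le⟩) (hC _ (le_refl X))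
    rw [← this] at hcon
    exact lt_irrefl _ hcon
  | down p q r R π hR hblock hx hy hy' hfirst hend hrest ih => exact ih (by rw [hx]; exact hp)

theorem isClosed_postSeg (τ : ℝ) (p : Pt) : IsClosed (postSeg τ p) := by
  apply IsClosed.inter
  · exact isClosed_eq continuous_fst continuous_const
  · exact isClosed_le (f := fun z : Pt => |z.2 - p.2|) (by fun_prop) continuous_const

/-! ### Reaching the target of `GoDown` from the end of its first phase. -/

namespace FenceTree

variable {S : Scene} {τ L x₀ : ℝ} {k : ℕ} {m : ℕ → ℕ} {P : ℕ → ℕ → Pt} {T : ℕ → ℕ → List Pt}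

/-- The last two phases of `GoDown`, with the target `P (j + 1) q`. -/
theorem goDown_end_spec (h : FenceTree S τ L x₀ k m P T) {j q : ℕ} (hj1 : 1 ≤ j)
    (hq : InTree k m (j + 1) q) {A B : Pt} {π₂ π₃ : List Pt} (hA1 : (P j q).1 ≤ A.1)
    (hA2 : (P (j + 1) q).2 ≤ A.2)
    (h2 : GreedyRightDown S (postSeg τ (P (j + 1) q) ∪ pathPts (T (j + 1) q)) A B π₂)
    (h3 : (B ∈ postSeg τ (P (j + 1) q) ∧ π₃ = [B, P (j + 1) q]) ∨
      (B ∉ postSeg τ (P (j + 1) q) ∧ FollowFrom (T (j + 1) q) B π₃))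
    {g : ℕ} (hg : ∀ p, 1 ≤ p → p ≤ g → (P (j + 1) p).1 < A.1) :
    A.1 ≤ (P (j + 1) q).1 ∧ π₃.head? = some B ∧ π₃.getLast? = some (P (j + 1) q) ∧
      pathLen π₂ + pathLen π₃ ≤ (1 + 2 * τ) * ((P (j + 1) q).1 - A.1) +
        (A.2 - (P (j + 1) q).2) + 2 * ((q : ℝ) - g) * τ := by
  have hτ := h.tau_pos
  have hspec := h.path_spec hq
  obtain ⟨s1, s2, s3, s4, s5, s6⟩ := h2.spec
  -- The first `g` posts are strictly left of `A`, so the number q − r + 1 of posts climbed is at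
  -- most q − g.
  have hgr : ∀ r : ℕ, 1 ≤ r → A.1 ≤ (P (j + 1) r).1 → (g : ℝ) + 1 ≤ r := by
    intro r hr hle
    by_contra hcon
    have : r ≤ g := by
      by_contra hlt
      apply hcon
      exact_mod_cast (not_le.1 hlt)
    exact absurd (hg r hr this) (not_lt.2 hle)
  rcases h3 with ⟨hB, rfl⟩ | ⟨hB, hfollow⟩
  · obtain ⟨hB1, hB2⟩ := hB
    have hAX : A.1 ≤ (P (j + 1) q).1 := by linarith
    refine ⟨hAX, rfl, rfl, ?_⟩
    rw [s6, pathLen_cons_cons, hB1, sub_self, abs_zero]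
    simp only [pathLen]
    have hr := hgr q hq.2.2.1 hAX
    -- Moving along the post to its centre wastes at most 2τ, and q itself is not among the first
    -- `g` numbers.
    have h4 : 2 * τ ≤ 2 * ((q : ℝ) - g) * τ := by nlinarith
    have h5 : (P (j + 1) q).2 - B.2 + |(P (j + 1) q).2 - B.2| ≤ 2 * τ := by
      rw [abs_sub_comm] at hB2
      have := le_abs_self ((P (j + 1) q).2 - B.2)
      linarith
    have h6 : 0 ≤ 2 * τ * ((P (j + 1) q).1 - A.1) :=
      mul_nonneg (by linarith) (by linarith)
    linarith
  · have hBT : B ∈ pathPts (T (j + 1) q) := hfollow.1.mem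
    have hBX := hspec.2.2.le_last hspec.2.1 hBT
    refine ⟨s4.trans hBX, hfollow.1.head?, hfollow.1.getLast?.trans hspec.2.1, ?_⟩
    obtain ⟨r, hr1, hr2, hr3, π, hπ, hlen⟩ := h.exists_final_cheap hj1 s4 hq hBT hA1 hA2 s5
      (fun hBA z hz hz1 hz2 => h2.le_of_fst_eq hBA (Or.inr hz) hz1 hz2)
    have h4 := hfollow.2 π hπ
    have h5 := hgr r hr1 (hr3 r le_rfl hr2)
    have h6 : 2 * ((q : ℝ) - r + 1) * τ ≤ 2 * ((q : ℝ) - g) * τ := by nlinarith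
    have h7 : 0 ≤ 2 * τ * (B.1 - A.1) := mul_nonneg (by linarith) (by linarith)
    rw [s6]
    linarith

/-- The path is first run with the half-plane right of the target post added to the goal. It stays
on or above the tree path, so on arriving at the abscissa of the post it is either on the tree path
or at most τ above the centre, that is, on the post. -/
theorem exists_goDown_end (h : FenceTree S τ L x₀ k m P T) {j q : ℕ} (hj1 : 1 ≤ j)
    (hq : InTree k m (j + 1) q) {A : Pt} (hA : S.Free A) (hAX : A.1 ≤ (P (j + 1) q).1)
    (hA2 : A.2 ≤ (P (j + 1) q).2 + τ) (hab : OnOrAbove (T (j + 1) q) A) :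
    ∃ B π₂ π₃, GreedyRightDown S (postSeg τ (P (j + 1) q) ∪ pathPts (T (j + 1) q)) A B π₂ ∧
    ((B ∈ postSeg τ (P (j + 1) q) ∧ π₃ = [B, P (j + 1) q]) ∨
      (B ∉ postSeg τ (P (j + 1) q) ∧ FollowFrom (T (j + 1) q) B π₃)) := by
  have hspec := h.path_spec hq
  set C := postSeg τ (P (j + 1) q) ∪ pathPts (T (j + 1) q) with hCdef
  have hC : IsClosed C := (isClosed_postSeg _ _).union (isClosed_pathPts _)
  set X := (P (j + 1) q).1 with hX
  obtain ⟨B, π₂, hgr⟩ := exists_greedyRightDown (C := C ∪ {z | X ≤ z.1})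
    (hC.union (isClosed_le continuous_const continuous_fst)) (xhi := X)
    (fun z hz => Or.inr hz) hA
  have hBX : B.1 ≤ X := hgr.fst_le (fun z hz => Or.inr hz) hAX
  have hend : P (j + 1) q ∈ pathPts (T (j + 1) q) := getLast_mem_pathPts hspec.2.1
  have hBab : OnOrAbove (T (j + 1) q) B :=
    hgr.onOrAbove hspec.2.2 (fun z hz => Or.inl (Or.inr hz)) hend hBX hab
  obtain ⟨s1, s2, s3, s4, s5, s6⟩ := hgr.spec
  have hBC : B ∈ C := by
    rcases s3 with hB | hB
    · exact hB
    · have hB1 : B.1 = X := le_antisymm hBX hB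
      obtain ⟨t, ht, ht1, ht2⟩ := hBab
      by_cases hB2 : B.2 ≤ (P (j + 1) q).2
      · right
        obtain ⟨z, hz, hz2, hz1, hz1'⟩ := hspec.2.2.exists_mem_height ht hend
          (by linarith) (y := B.2) (Set.mem_uIcc_of_le ht2 hB2)
        rwa [show B = z from Prod.ext (by linarith) hz2.symm]
      · left
        refine ⟨hB1, ?_⟩
        rw [abs_of_nonneg (by linarith)]
        linarith
  have hgr' := hgr.of_subset Set.subset_union_left hBC
  by_cases hBp : B ∈ postSeg τ (P (j + 1) q)
  · exact ⟨B, π₂, _, hgr', Or.inl ⟨hBp, rfl⟩⟩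
  · obtain ⟨π₃, hπ₃⟩ := exists_followFrom (h.two_le_length hq hj1) (hBC.resolve_left hBp)
    exact ⟨B, π₂, π₃, hgr', Or.inr ⟨hBp, hπ₃⟩⟩

/-- Points of the last edge are within τ of the height of its end, and the up-edges before it end
lower. In this range of abscissae only up-edges precede, until a down-edge leaves fence `j`. -/
theorem exists_le_height (h : FenceTree S τ L x₀ k m P T) {j q : ℕ} (hj1 : 1 ≤ j)
    (hq : InTree k m (j + 1) q) {x : ℝ} (hx1 : (P j q).1 ≤ x) (hx2 : x ≤ (P (j + 1) q).1) :
    ∃ t ∈ pathPts (T (j + 1) q), t.1 = x ∧ t.2 ≤ (P (j + 1) q).2 + τ := by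
  have hτ := h.tau_pos
  have hedge : ∀ (q : ℕ) (ε : List Pt) (Q : Pt) (y : ℝ), x ≤ (P (j + 1) q).1 →
      IsEdge S τ y Q (P (j + 1) q) ε → Q.1 ≤ x →
      ∃ t ∈ pathPts ε, t.1 = x ∧ t.2 ≤ (P (j + 1) q).2 + τ := by
    intro q ε Q y hxq hε hQ
    obtain ⟨t, ht, ht1⟩ := hε.xMono.exists_mem_abscissa (head_mem_pathPts hε.head?)
      (getLast_mem_pathPts hε.getLast?) hQ hxq
    have := (abs_le.1 (hε.abs_snd_sub_le hτ ht)).2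
    exact ⟨t, ht, ht1, by linarith⟩
  induction q with
  | zero => exact absurd hq.2.2.1 (by norm_num)
  | succ q ih =>
    rcases h.edge (j + 1) (q + 1) hq with ⟨h2, _⟩ | ⟨p', hp', heq, hcond, ε, hε, hT⟩ |
      ⟨j', hj', heq, hcond, ε, hε, hT⟩
    · omega
    · obtain rfl : q = p' := by omega
      have hq' := h.inTree_of_le hq hq.1 le_rfl hp' (Nat.le_succ q)
      have hspec := h.path_spec hq'
      rw [hT, pathPts_append hspec.2.1 hε.head?]
      rcases le_total (P (j + 1) q).1 x with hle | hle
      · obtain ⟨t, ht, h1⟩ := hedge _ _ _ _ hx2 hε hle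
        exact ⟨t, Or.inr ht, h1⟩
      · obtain ⟨t, ht, h1, h2⟩ := ih hq' ((h.fst_le_succ (h.inTree_of_le hq hj1 (Nat.le_succ j)
          (by omega) le_rfl) hp').trans hx1) hle
        have := hε.snd_eq
        exact ⟨t, Or.inl ht, h1, by linarith⟩
    · obtain rfl : j = j' := by omega
      have hspec := h.path_spec (h.inTree_of_le hq hj1 (Nat.le_succ j) hq.2.2.1 le_rfl)
      rw [hT, pathPts_append hspec.2.1 hε.head?]
      obtain ⟨t, ht, h1⟩ := hedge _ _ _ _ hx2 hε hx1
      exact ⟨t, Or.inr ht, h1⟩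

/-- The start of a call inside a rectangle of posts may be lower than the bound of
`exists_le_height`. Over the last edge one uses that no free point at or above its level lies under
its τ-path. -/
theorem onOrAbove_of_free (h : FenceTree S τ L x₀ k m P T) {j q : ℕ} (hj1 : 1 ≤ j)
    (hq : InTree k m (j + 1) q) {z : Pt} (hz : S.Free z) (hx1 : (P j q).1 ≤ z.1)
    (hx2 : z.1 ≤ (P (j + 1) q).1) (hz2 : (P (j + 1) q).2 ≤ z.2) :
    OnOrAbove (T (j + 1) q) z := by
  have hedge : ∀ (ε : List Pt) (Q : Pt) (y : ℝ), IsEdge S τ y Q (P (j + 1) q) ε → Q.1 ≤ z.1 →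
      OnOrAbove ε z := by
    intro ε Q y hε hQ
    exact hε.exists_le hz (by rw [← hε.snd_eq]; exact hz2) hQ hx2
  rcases h.edge (j + 1) q hq with ⟨h2, _⟩ | ⟨p', hp', rfl, hcond, ε, hε, hT⟩ |
    ⟨j', hj', heq, hcond, ε, hε, hT⟩
  · omega
  · have hq' := h.inTree_of_le hq hq.1 le_rfl hp' (Nat.le_succ p')
    have hspec := h.path_spec hq'
    rw [OnOrAbove, hT, pathPts_append hspec.2.1 hε.head?]
    rcases le_total (P (j + 1) p').1 z.1 with hle | hle
    · obtain ⟨t, ht, h1⟩ := hedge _ _ _ hε hle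
      exact ⟨t, Or.inr ht, h1⟩
    · obtain ⟨t, ht, h1, h2⟩ := h.exists_le_height hj1 hq' ((h.fst_le_succ (h.inTree_of_le hq hj1
        (Nat.le_succ j) (by omega) le_rfl) hp').trans hx1) hle
      have := hε.snd_eq
      exact ⟨t, Or.inl ht, h1, by linarith⟩
  · obtain rfl : j = j' := by omega
    have hspec := h.path_spec (h.inTree_of_le hq hj1 (Nat.le_succ j) hq.2.2.1 le_rfl)
    rw [OnOrAbove, hT, pathPts_append hspec.2.1 hε.head?]
    obtain ⟨t, ht, h1⟩ := hedge _ _ _ hε hx1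
    exact ⟨t, Or.inr ht, h1⟩

/-- The obstacles of the posts number `q, …, m'` of fence `i`. -/
def fenceObstacles (S : Scene) (τ : ℝ) (P : ℕ → ℕ → Pt) (i q m' : ℕ) : Set Obstacle :=
  {R | R ∈ S.obstacles ∧ ∃ p, q ≤ p ∧ p ≤ m' ∧ (R.left : ℝ) = (P i p).1 ∧
    R.bot ≤ (P i p).2 - τ ∧ (P i p).2 + τ ≤ R.top}

/-- Posts reach τ above and below centres that are spaced by τ, so there is no gap, and their
abscissae increase upwards. -/
theorem isBarrier_fenceObstacles (h : FenceTree S τ L x₀ k m P T) {i q m' : ℕ} (hq : 1 ≤ q)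
    (hm' : InTree k m i m') :
    IsBarrier S (fenceObstacles S τ P i q m') (P i m').2 := by
  have hτ := h.tau_pos
  refine ⟨fun R hR => hR.1, ?_⟩
  rintro R ⟨hR, p, hp1, hp2, hl, hb, ht⟩ y hy hyH
  by_cases hyt : y ≤ R.top
  · exact ⟨R, ⟨hR, p, hp1, hp2, hl, hb, ht⟩, le_rfl, hy, hyt⟩
  · classical
    -- Take the first post from number `p` upwards whose segment reaches `y`; the segment of its
    -- predecessor ends at its centre, which is therefore below `y`.
    have hex : ∃ p', y ≤ (P i (p + p')).2 + τ := by
      refine ⟨m' - p, ?_⟩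
      rw [Nat.add_sub_of_le hp2]; linarith
    obtain ⟨d, hd, hmin⟩ := Nat.findX hex
    have hd0 : d ≠ 0 := by
      rintro rfl
      rw [add_zero] at hd
      linarith
    obtain ⟨d, rfl⟩ := Nat.exists_eq_succ_of_ne_zero hd0
    have hdm : p + (d + 1) ≤ m' := by
      by_contra hcon
      refine hmin (m' - p) (by omega) ?_
      rw [Nat.add_sub_of_le hp2]; linarith
    have hin : InTree k m i (p + d + 1) :=
      h.inTree_of_le hm' hm'.1 le_rfl (by omega) (by omega)
    have h1 := h.height_succ hin (by omega)
    have h2 := hmin d (Nat.lt_succ_self d)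
    push Not at h2
    have h5 := h.fst_mono hin hin.1 le_rfl (hq.trans hp1) (by omega : p ≤ p + d + 1)
    obtain ⟨R', hR', hl', hb', ht'⟩ := h.post _ _ hin
    refine ⟨R', ⟨hR', p + d + 1, by omega, by omega, hl', hb', ht'⟩, ?_, by linarith, ?_⟩
    · have : (R.left : ℝ) ≤ R'.left := by rw [hl, hl']; exact h5
      exact_mod_cast this
    · rw [Nat.succ_eq_add_one, ← add_assoc] at hd; linarith

theorem rightOf_fenceObstacles (h : FenceTree S τ L x₀ k m P T) {i q m' : ℕ} (hq : 1 ≤ q)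
    (hm' : InTree k m i m') {z : Pt} (hz : (P i m').1 ≤ z.1) :
    RightOf (fenceObstacles S τ P i q m') z := by
  rintro R ⟨hR, p, hp1, hp2, hl, hb, ht⟩ _
  rw [hl]
  exact (h.fst_mono hm' hm'.1 le_rfl (hq.trans hp1) hp2).trans hz

end FenceTree

/-! ## `GoDown` -/

section GoDown

variable {S : Scene} {τ L x₀ : ℝ} {k : ℕ} {s : RobotState}

/-- The barrier of the posts q + 1, …, m' of fence `i` stops the descent at height Y_i^q, not left
of X_i^{q+1}. The leftward part of phase one adds one more horizontal extent, hence the factor 2 +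
2τ. The start is any suitable point level with post m', as needed at the end of `GoBackDown`. -/
theorem GoDown.spec (h : FenceTree S τ L x₀ k s.cnt s.post s.treePath) {i q m' : ℕ}
    (hi : 1 ≤ i) (hq : InTree k s.cnt (i + 1) q) (hm' : InTree k s.cnt i m') (hqm : q < m')
    {p : Pt} (hp1 : (s.post i m').1 ≤ p.1) (hp1' : p.1 ≤ (s.post (i + 1) q).1)
    (hp2 : p.2 = (s.post i m').2) {π : List Pt}
    (hgo : GoDown S τ s i q p π) {g : ℕ}
    (hg : ∀ p, 1 ≤ p → p ≤ g → (s.post (i + 1) p).1 < (s.post i (q + 1)).1) :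
    π.head? = some p ∧ π.getLast? = some (s.post (i + 1) q) ∧
      pathLen π ≤ (2 + 2 * τ) * ((s.post (i + 1) q).1 - (s.post i (q + 1)).1) +
        (((m' : ℝ) - q) + 1 + 2 * ((q : ℝ) - g)) * τ := by
  have hτ := h.tau_pos
  obtain ⟨A, B, π₁, π₂, π₃, h1, h2, h3, rfl⟩ := hgo
  have hq1 : InTree k s.cnt i (q + 1) := h.inTree_of_le hm' hi le_rfl (by omega) hqm
  have hq0 : InTree k s.cnt i q := h.inTree_of_le hm' hi le_rfl hq.2.2.1 hqm.le
  have hY : (s.post (i + 1) q).2 + τ = (s.post i q).2 := by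
    have := h.height_fence_succ hq hi; linarith
  have hY' := h.height_succ hq1 hq.2.2.1
  have hYm : (s.post i m').2 = (s.post i q).2 + ((m' : ℝ) - q) * τ := by
    rw [h.height _ _ hm', h.height _ _ hq0]; ring
  have hqm' : (q : ℝ) + 1 ≤ m' := by exact_mod_cast hqm
  have hlt : (s.post i q).2 < p.2 := by rw [hp2, hYm]; nlinarith
  obtain ⟨R, hR, hl, hb, ht⟩ := h.post _ _ hq1
  -- The segment of post q + 1 reaches down exactly to the height at which phase one stops.
  have hbar := h1.left_le_of_barrier (Y := (s.post (i + 1) q).2 + τ) (fun z hz => hz)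
    (h.isBarrier_fenceObstacles (Nat.succ_pos q) hm')
    (h.rightOf_fenceObstacles (Nat.succ_pos q) hm' hp1) hp2.le (by rw [hY]; exact hlt)
    (R := R) ⟨hR, q + 1, le_rfl, hqm, hl, hb, ht⟩ (by linarith)
  obtain ⟨s1, s2, s3, s4, s5, s6⟩ := h1.spec
  have hA2 : A.2 = (s.post i q).2 := by rw [← hY]; exact le_antisymm s3 hbar.2
  have hA1 : (s.post i (q + 1)).1 ≤ A.1 := by rw [← hl]; exact hbar.1
  obtain ⟨e1, e2, e3, e4⟩ := h.goDown_end_spec hi hq ((h.fst_le_succ hq1 hq.2.2.1).trans hA1)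
    (by linarith) h2 h3 (g := g) (fun p hp hpg => (hg p hp hpg).trans_le hA1)
  obtain ⟨u1, u2, u3, u4, u5, u6⟩ := h2.spec
  obtain ⟨t1, rfl⟩ := eq_cons_of_head? s1
  refine ⟨rfl, ?_, ?_⟩
  · rw [List.getLast?_append, e3]; rfl
  · rw [pathLen_append (a := B) (by rw [List.getLast?_append, u2]; rfl) e2,
      pathLen_append s2 u1, s6, hA2, hp2, hYm]
    have h4 : (1 + 2 * τ) * ((s.post (i + 1) q).1 - A.1) ≤
        (1 + 2 * τ) * ((s.post (i + 1) q).1 - (s.post i (q + 1)).1) := by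
      apply mul_le_mul_of_nonneg_left _ (by linarith)
      linarith
    rw [hA2] at e4
    linarith

/-- The half-plane x ≤ x₀ − 1 only makes the greedy path exist; the barrier, which is right of x₀,
shows that it is never reached. -/
theorem exists_goDown (h : FenceTree S τ L x₀ k s.cnt s.post s.treePath) {i q m' : ℕ}
    (hi : 1 ≤ i) (hq : InTree k s.cnt (i + 1) q) (hm' : InTree k s.cnt i m') (hqm : q < m')
    {p : Pt} (hp : S.Free p) (hp1 : (s.post i m').1 ≤ p.1)
    (hp1' : p.1 ≤ (s.post (i + 1) q).1) (hp2 : p.2 = (s.post i m').2) :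
    ∃ π, GoDown S τ s i q p π := by
  have hτ := h.tau_pos
  have hq1 : InTree k s.cnt i (q + 1) := h.inTree_of_le hm' hi le_rfl (by omega) hqm
  have hq0 : InTree k s.cnt i q := h.inTree_of_le hm' hi le_rfl hq.2.2.1 hqm.le
  have hY : (s.post (i + 1) q).2 + τ = (s.post i q).2 := by
    have := h.height_fence_succ hq hi; linarith
  have hY' := h.height_succ hq1 hq.2.2.1
  have hYm : (s.post i m').2 = (s.post i q).2 + ((m' : ℝ) - q) * τ := by
    rw [h.height _ _ hm', h.height _ _ hq0]; ring
  have hqm' : (q : ℝ) + 1 ≤ m' := by exact_mod_cast hqm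
  have hlt : (s.post i q).2 < p.2 := by rw [hp2, hYm]; nlinarith
  obtain ⟨R, hR, hl, hb, ht⟩ := h.post _ _ hq1
  obtain ⟨A, π₁, h1⟩ := exists_greedyDownLeft
    (C := {z : Pt | z.2 ≤ (s.post (i + 1) q).2 + τ} ∪ {z | z.1 ≤ x₀ - 1})
    ((isClosed_le continuous_snd continuous_const).union
      (isClosed_le continuous_fst continuous_const))
    (fun z hz => Or.inr hz) (fun z hz => Or.inl hz) hp
  have hbar := h1.left_le_of_barrier (Y := (s.post (i + 1) q).2 + τ) (fun z hz => Or.inl hz)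
    (h.isBarrier_fenceObstacles (Nat.succ_pos q) hm')
    (h.rightOf_fenceObstacles (Nat.succ_pos q) hm' hp1) hp2.le (by rw [hY]; exact hlt)
    (R := R) ⟨hR, q + 1, le_rfl, hqm, hl, hb, ht⟩ (by linarith)
  have hA1 : (s.post i (q + 1)).1 ≤ A.1 := by rw [← hl]; exact hbar.1
  have hx₀ := h.start_le hq1
  obtain ⟨s1, s2, s3, s4, s5, s6⟩ := h1.spec
  have hAC : A ∈ {z : Pt | z.2 ≤ (s.post (i + 1) q).2 + τ} := by
    refine s3.resolve_right fun hA => ?_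
    have : A.1 ≤ x₀ - 1 := hA
    linarith
  have hA2 : A.2 = (s.post i q).2 := by rw [← hY]; exact le_antisymm hAC hbar.2
  have hAX : A.1 ≤ (s.post (i + 1) q).1 := s4.trans hp1'
  obtain ⟨t, ht, ht1, ht2⟩ := h.exists_le_height hi hq
    ((h.fst_le_succ hq1 hq.2.2.1).trans hA1) hAX
  obtain ⟨B, π₂, π₃, h2, h3⟩ := h.exists_goDown_end hi hq (h1.free hp) hAX (by linarith)
    ⟨t, ht, ht1, by linarith⟩
  exact ⟨_, A, B, π₁, π₂, π₃, h1.of_subset Set.subset_union_left hAC, h2, h3, rfl⟩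

/-- `GoDown` from a point of the rectangle spanned by the posts number `q` of two fences. -/
theorem GoDown.spec_of_le (h : FenceTree S τ L x₀ k s.cnt s.post s.treePath) {j q : ℕ}
    (hj : 1 ≤ j) (hq : InTree k s.cnt (j + 1) q)
    {p : Pt} (hp1 : (s.post j q).1 ≤ p.1)
    (hp2 : (s.post (j + 1) q).2 ≤ p.2) (hp2' : p.2 ≤ (s.post j q).2) {π : List Pt}
    (hgo : GoDown S τ s j q p π) {g : ℕ}
    (hg : ∀ p, 1 ≤ p → p ≤ g → (s.post (j + 1) p).1 < (s.post j q).1) :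
    π.head? = some p ∧ π.getLast? = some (s.post (j + 1) q) ∧
      pathLen π ≤ (1 + 2 * τ) * ((s.post (j + 1) q).1 - (s.post j q).1) +
        (p.2 - (s.post (j + 1) q).2) + 2 * ((q : ℝ) - g) * τ := by
  have hτ := h.tau_pos
  obtain ⟨A, B, π₁, π₂, π₃, h1, h2, h3, rfl⟩ := hgo
  have hY : (s.post (j + 1) q).2 + τ = (s.post j q).2 := by
    have := h.height_fence_succ hq hj; linarith
  obtain ⟨rfl, rfl⟩ := h1.eq_of_mem (show p.2 ≤ _ by linarith)
  obtain ⟨e1, e2, e3, e4⟩ := h.goDown_end_spec hj hq hp1 hp2 h2 h3 (g := g)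
    (fun p hp hpg => (hg p hp hpg).trans_le hp1)
  obtain ⟨u1, u2, u3, u4, u5, u6⟩ := h2.spec
  refine ⟨rfl, ?_, ?_⟩
  · rw [List.getLast?_append, e3]; rfl
  · rw [pathLen_append (a := B) (by rw [List.getLast?_append, u2]; rfl) e2,
      pathLen_append (a := A) rfl u1]
    have h4 : (1 + 2 * τ) * ((s.post (j + 1) q).1 - A.1) ≤
        (1 + 2 * τ) * ((s.post (j + 1) q).1 - (s.post j q).1) := by
      apply mul_le_mul_of_nonneg_left _ (by linarith)
      linarith
    simp only [pathLen]
    linarith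

/-- `GoDown` from a point that touches the target post. -/
theorem GoDown.spec_of_mem {j q : ℕ}
    {p : Pt} (hp : p ∈ postSeg τ (s.post (j + 1) q)) {π : List Pt}
    (hgo : GoDown S τ s j q p π) :
    π.head? = some p ∧ π.getLast? = some (s.post (j + 1) q) ∧
      pathLen π = |p.2 - (s.post (j + 1) q).2| := by
  obtain ⟨A, B, π₁, π₂, π₃, h1, h2, h3, rfl⟩ := hgo
  have hp2 := (abs_le.1 hp.2).2
  obtain ⟨rfl, rfl⟩ := h1.eq_of_mem (show p.2 ≤ _ by linarith)
  obtain ⟨rfl, rfl⟩ := h2.eq_of_mem (Or.inl hp)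
  rcases h3 with ⟨_, rfl⟩ | ⟨hB, _⟩
  · simp [pathLen, hp.1, abs_sub_comm]
  · exact absurd hp hB

theorem exists_goDown_of_le (h : FenceTree S τ L x₀ k s.cnt s.post s.treePath) {j q : ℕ}
    (hj : 1 ≤ j) (hq : InTree k s.cnt (j + 1) q)
    {p : Pt} (hp : S.Free p) (hp1 : (s.post j q).1 ≤ p.1) (hp1' : p.1 ≤ (s.post (j + 1) q).1)
    (hp2 : (s.post (j + 1) q).2 ≤ p.2) (hp2' : p.2 ≤ (s.post j q).2) :
    ∃ π, GoDown S τ s j q p π := by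
  have hY : (s.post (j + 1) q).2 + τ = (s.post j q).2 := by
    have := h.height_fence_succ hq hj; linarith
  obtain ⟨B, π₂, π₃, h2, h3⟩ := h.exists_goDown_end hj hq hp hp1' (by linarith)
    (h.onOrAbove_of_free hj hq hp hp1 hp1' hp2)
  exact ⟨_, p, B, _, π₂, π₃, .reached p (show p.2 ≤ _ by linarith), h2, h3, rfl⟩

end GoDown

/-! ## Following the tree path backward -/

/-- The walk stops on the τ-path of the edge. If it stops above the level of the edge, the obstacle
of the current detour covers the heights in between; it will extend the barrier below. -/
theorem IsEdge.backUntil_spec {S : Scene} {τ y : ℝ} {P Q : Pt} {ε : List Pt} (hτ : 0 < τ)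
    (hε : IsEdge S τ y P Q ε) (hP : IsPost S τ P) {γ : List Pt} (hγ : γ.getLast? = some P)
    (hmono : XMono γ) {c : ℝ} (hPc : P.1 ≤ c) {A : Pt} {π : List Pt}
    (hback : BackUntil (γ ++ ε) c A π) :
    |A.2 - Q.2| < τ ∧ S.Free A ∧
      (Q.2 < A.2 → ∃ R ∈ S.obstacles, R.bot < Q.2 ∧ A.2 ≤ R.top ∧ (R.left : ℝ) ≤ A.1 ∧
        P.1 ≤ R.left) ∧
      pathLen π ≤ (1 + 2 * τ) * (Q.1 - c) + τ := by
  have hm := hmono.append hε.xMono hγ hε.head?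
  have hcorner : ((P.1, y) : Pt) ∈ pathPts ε := hε.mem_of_fst_eq rfl Set.right_mem_uIcc
  have hne : ((P.1, y) : Pt) ≠ P := by
    intro heq
    have h1 := hε.1
    rw [Prod.ext_iff] at heq
    rw [← heq.2, sub_self, abs_zero] at h1
    exact hτ.ne h1
  obtain ⟨hfin, hAc, huniq⟩ := id hback
  have hno : ∀ z ∈ pathPts π, c ≤ z.1 := by
    obtain ⟨γ₁, a, b, γ₂, heq, hA, rfl⟩ := hfin
    rw [heq] at hm
    have h1 := hm.of_append
    intro z hz
    rw [← hAc]
    rcases hz with hz | hz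
    · have h5 := fst_mem_uIcc_of_mem_segment hA
      have h6 := fst_mem_uIcc_of_mem_segment hz
      rw [Set.uIcc_of_le h1.1] at h5
      rw [Set.uIcc_of_le h5.2] at h6
      exact h6.1
    · have h3 := h1.2.2.head_le rfl hz
      have h5 := fst_mem_uIcc_of_mem_segment hA
      rw [Set.uIcc_of_le h1.1] at h5
      exact h5.2.trans h3
  have hAε : IsFinalPortion ε A π := by
    rcases isFinalPortion_append hfin hγ hε.head? with h1 | ⟨π', h1, rfl⟩ | ⟨rfl, rfl⟩
    · exact h1
    -- Going past the edge would require two distinct points with abscissa `c` on the portion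
    -- walked, its source and the foot of its τ-path.
    · exfalso
      have hsub : pathPts (π' ++ ε) = _ := pathPts_append (h1.getLast?.trans hγ) hε.head?
      rw [hsub] at huniq hno
      have h2 := hno P (Or.inr (head_mem_pathPts hε.head?))
      have hPc' : P.1 = c := le_antisymm hPc h2
      have h3 := huniq P (Or.inr (head_mem_pathPts hε.head?)) hPc'
      have h4 := huniq (P.1, y) (Or.inr hcorner) hPc'
      exact hne (h4.trans h3.symm)
    · exfalso
      refine hne (huniq (A.1, y) ?_ hAc)
      obtain ⟨t, rfl⟩ := eq_cons_of_head? hε.head?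
      exact Or.inr hcorner
  obtain ⟨ρ, hρ, hAρ⟩ := hε.mem_tauPath_of_back hAε (fun z hz hz1 => huniq z hz (hz1.trans hAc))
  have hd : |A.2 - Q.2| < τ := by
    have := hρ.abs_snd_sub_lt hτ (by exact hε.2.1.le) hAρ
    rwa [hε.snd_eq]
  refine ⟨hd, ?_, ?_, ?_⟩
  · refine hρ.free (hP.free rfl ?_) hε.2.2.1 hAρ
    simp only
    rw [abs_sub_comm]
    exact hε.1.le
  · intro hlt
    rw [hε.snd_eq] at hlt ⊢
    exact hρ.exists_obstacle hε.2.2.1 hAρ hlt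
  · obtain ⟨π', h1, h2⟩ := hε.exists_isFinalPortion hτ hAε.mem
    have := hback.pathLen_le hm (h1.append_left γ)
    rw [hAc] at h2
    linarith

/-- The result of following the tree path to `P j (μ + 1)` backward until `x = c`: one stops near
the height of the first post `P v (μ + 1)` of a chain of down-edges that ends at `P j (μ + 1)`. -/
theorem FenceTree.backUntil_spec {S : Scene} {τ L x₀ : ℝ} {k : ℕ} {m : ℕ → ℕ} {P : ℕ → ℕ → Pt}
    {T : ℕ → ℕ → List Pt} (h : FenceTree S τ L x₀ k m P T) {j μ : ℕ} (hμ : 1 ≤ μ)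
    (hj : InTree k m j (μ + 1)) {c : ℝ} (hc : (P j μ).1 ≤ c) (hc' : c < (P j (μ + 1)).1) {A : Pt}
    {π : List Pt} (hback : BackUntil (T j (μ + 1)) c A π) :
    ∃ v, 1 ≤ v ∧ v ≤ j ∧ (∀ j', v ≤ j' → j' ≤ j → c < (P j' (μ + 1)).1) ∧
      |A.2 - (P v (μ + 1)).2| < τ ∧ S.Free A ∧
      ((P v (μ + 1)).2 < A.2 → ∃ R ∈ S.obstacles, R.bot < (P v (μ + 1)).2 ∧ A.2 ≤ R.top ∧
        (R.left : ℝ) ≤ A.1 ∧ (P v μ).1 ≤ R.left) ∧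
      pathLen π ≤ (1 + 2 * τ) * ((P j (μ + 1)).1 - c) + (((j : ℝ) - v) + 1) * τ := by
  have hτ := h.tau_pos
  -- The walk ends on the last edge: either an up-edge, or a down-edge whose source is not right of
  -- `c`.
  have base : ∀ π j γ ε y Q, InTree k m j (μ + 1) → c < (P j (μ + 1)).1 →
      IsEdge S τ y Q (P j (μ + 1)) ε → IsPost S τ Q → γ.getLast? = some Q → XMono γ → Q.1 ≤ c →
      (P j μ).1 ≤ Q.1 → BackUntil (γ ++ ε) c A π →
      ∃ v, 1 ≤ v ∧ v ≤ j ∧ (∀ j', v ≤ j' → j' ≤ j → c < (P j' (μ + 1)).1) ∧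
        |A.2 - (P v (μ + 1)).2| < τ ∧ S.Free A ∧
        ((P v (μ + 1)).2 < A.2 → ∃ R ∈ S.obstacles, R.bot < (P v (μ + 1)).2 ∧ A.2 ≤ R.top ∧
          (R.left : ℝ) ≤ A.1 ∧ (P v μ).1 ≤ R.left) ∧
        pathLen π ≤ (1 + 2 * τ) * ((P j (μ + 1)).1 - c) + (((j : ℝ) - v) + 1) * τ := by
    intro π j γ ε y Q hj hc' hε hQ hγ hmono hQc hle hback
    obtain ⟨h1, h2, h3, h4⟩ := hε.backUntil_spec hτ hQ hγ hmono hQc hback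
    refine ⟨j, hj.1, le_rfl, ?_, h1, h2, ?_, ?_⟩
    · intro j' h5 h6
      rwa [le_antisymm h6 h5]
    · intro hlt
      obtain ⟨R, hR, r1, r2, r3, r4⟩ := h3 hlt
      exact ⟨R, hR, r1, r2, r3, hle.trans r4⟩
    · rw [sub_self, zero_add, one_mul]; exact h4
  induction j generalizing π with
  | zero => exact absurd hj.1 (by norm_num)
  | succ j ih =>
    rcases h.edge (j + 1) (μ + 1) hj with ⟨_, h2⟩ | ⟨p', hp', heq, hcond, ε, hε, hT⟩ |
      ⟨j', hj', heq, hcond, ε, hε, hT⟩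
    · omega
    · obtain rfl : μ = p' := by omega
      have hq := h.inTree_of_le hj hj.1 le_rfl hμ (Nat.le_succ μ)
      have hspec := h.path_spec hq
      rw [hT] at hback
      exact base _ _ _ _ _ _ hj hc' hε (h.post _ _ hq) hspec.2.1 hspec.2.2 hc le_rfl hback
    · obtain rfl : j = j' := by omega
      have hq := h.inTree_of_le hj hj' (Nat.le_succ j) hj.2.2.1 le_rfl
      have hspec := h.path_spec hq
      rw [hT] at hback
      rcases le_or_gt (P j (μ + 1)).1 c with hle | hlt
      · exact base _ _ _ _ _ _ hj hc' hε (h.post _ _ hq) hspec.2.1 hspec.2.2 hle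
          (hcond μ hμ rfl).le hback
      -- The source of the down-edge is still right of `c`, so the whole edge is walked back, at the
      -- price of one more τ, and the chain grows by one.
      · have hrest : ∃ π', IsFinalPortion (T j (μ + 1)) A π' ∧ π = π' ++ ε := by
          rcases isFinalPortion_append hback.1 hspec.2.1 hε.head? with h1 | h1 | ⟨rfl, _⟩
          · have h2 := hε.xMono.head_le hε.head? h1.mem
            rw [hback.2.1] at h2
            linarith
          · exact h1
          · have := hback.2.1
            linarith
        obtain ⟨π', h1, rfl⟩ := hrest
        have hpts := pathPts_append (h1.getLast?.trans hspec.2.1) hε.head?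
        have hμj : (P j μ).1 ≤ c := (h.fst_le_fence_succ
          (h.inTree_of_le hj hj.1 le_rfl hμ (Nat.le_succ μ)) hj').trans hc
        obtain ⟨v, v1, v2, v3, v4, v5, v6, v7⟩ := ih hq hμj hlt (π := π')
          ⟨h1, hback.2.1, fun z hz => hback.2.2 z (by rw [hpts]; exact Or.inl hz)⟩
        refine ⟨v, v1, by omega, ?_, v4, v5, v6, ?_⟩
        · intro j' h2 h3
          rcases Nat.lt_or_ge j j' with h4 | h4
          · rwa [show j' = j + 1 by omega]
          · exact v3 j' h2 h4
        · rw [pathLen_append (h1.getLast?.trans hspec.2.1) hε.head?]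
          have h2 := hε.pathLen_le hτ
          push_cast
          linarith

/-! ## Greedy paths above a staircase -/

/-- A greedy down-left path that stays to the right of a barrier and stops at the rectangles spanned
by successive points `P v, …, P i` of a descending staircase: it remains above the staircase. -/
theorem GreedyDownLeft.stairs {S : Scene} {C : Set Pt} {p r : Pt} {π : List Pt}
    (h : GreedyDownLeft S C p r π) {P : ℕ → Pt} {v i : ℕ}
    (hx : ∀ j, v ≤ j → j < i → (P j).1 ≤ (P (j + 1)).1)
    (hy : ∀ j, v ≤ j → j < i → (P (j + 1)).2 < (P j).2)
    (hC : ∀ j, v ≤ j → j < i → ∀ z : Pt, (P j).1 ≤ z.1 → z.1 ≤ (P (j + 1)).1 →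
      (P (j + 1)).2 ≤ z.2 → z.2 ≤ (P j).2 → z ∈ C)
    (hC' : ∀ z : Pt, z.2 = (P i).2 → z ∈ C) {𝓑 : Set Obstacle} {H : ℝ}
    (hB : IsBarrier S 𝓑 H) {R : Obstacle} (hR : R ∈ 𝓑) (hRl : (R.left : ℝ) = (P v).1)
    (hRb : R.bot < (P v).2) (hH : p.2 ≤ H) (hp : RightOf 𝓑 p) (hpi : (P i).2 ≤ p.2)
    (hps : ∀ j, v ≤ j → j ≤ i → p.2 ≤ (P j).2 → (P j).1 ≤ p.1) :
    RightOf 𝓑 r ∧ (P i).2 ≤ r.2 ∧ ∀ j, v ≤ j → j ≤ i → r.2 ≤ (P j).2 → (P j).1 ≤ r.1 := by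
  have hyanti : ∀ j j', v ≤ j → j ≤ j' → j' ≤ i → (P j').2 ≤ (P j).2 := by
    intro j j' hj hjj' hj'
    induction j', hjj' using Nat.le_induction with
    | base => exact le_rfl
    | succ j' hjj' ih => exact (hy j' (hj.trans hjj') hj').le.trans (ih (by omega))
  have hxmono : ∀ j j', v ≤ j → j ≤ j' → j' ≤ i → (P j).1 ≤ (P j').1 := by
    intro j j' hj hjj' hj'
    induction j', hjj' using Nat.le_induction with
    | base => exact le_rfl
    | succ j' hjj' ih => exact (ih (by omega)).trans (hx j' (hj.trans hjj') hj')
  induction h with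
  | reached p h => exact ⟨hp, hpi, hps⟩
  | down p q r π hqx hqy hfree hfirst hend hrest ih =>
    have hpC : p ∉ C := fun hpC => by
      have := hfirst p (left_mem_segment ℝ p q) hpC
      rw [← this] at hqy; exact lt_irrefl _ hqy
    have hmeet : ∀ y, y ≤ p.2 → ((p.1, y) : Pt) ∈ C → q.2 ≤ y → q.2 = y := by
      intro y hy1 hy2 hy3
      have := hfirst (p.1, y) ((mem_segment_down_iff hqx hqy.le).2 ⟨rfl, hy3, hy1⟩) hy2
      rw [← this]
    have hqi : (P i).2 ≤ q.2 := by
      by_contra hcon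
      push Not at hcon
      have := hmeet (P i).2 hpi (hC' _ rfl) hcon.le
      linarith
    refine ih (by linarith) (hp.down hqx hqy.le) hqi ?_
    intro j hj1 hj2 hqj
    rw [hqx]
    by_contra hcon
    push Not at hcon
    have hv : (P v).1 ≤ p.1 := by
      rcases le_or_gt p.2 (P v).2 with h1 | h1
      · exact hps v le_rfl (hj1.trans hj2) h1
      · rw [← hRl]; exact hp R hR (by linarith)
    -- The step of the staircase whose range of abscissae contains `p`: a descent passing below it
    -- would first meet the top of its rectangle.
    obtain ⟨l, l1, l2, l3, l4⟩ : ∃ l, v ≤ l ∧ l < j ∧ (P l).1 ≤ p.1 ∧ p.1 < (P (l + 1)).1 := by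
      clear hqj
      induction j, hj1 using Nat.le_induction with
      | base => linarith
      | succ j hj ihj =>
        rcases le_or_gt (P j).1 p.1 with h1 | h1
        · exact ⟨j, hj, Nat.lt_succ_self j, h1, hcon⟩
        · obtain ⟨l, h2, h3, h4⟩ := ihj (by omega) h1
          exact ⟨l, h2, by omega, h4⟩
    have hly : (P (l + 1)).2 < p.2 := by
      by_contra h1
      push Not at h1
      have := hps (l + 1) (by omega) (by omega) h1
      linarith
    have hly' : (P l).2 < p.2 := by
      by_contra h1
      push Not at h1
      exact hpC (hC l l1 (by omega) p l3 l4.le hly.le h1)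
    have h1 := hy l l1 (by omega)
    have h2 := hyanti (l + 1) j (by omega) l2 hj2
    have := hmeet (P l).2 hly'.le (hC l l1 (by omega) _ l3 l4.le h1.le le_rfl) (by linarith)
    linarith
  | left p q r R' π hR' hblock hqx hqx' hqy hfirst hend hrest ih =>
    have hpC : p ∉ C := fun hpC => by
      have := hfirst p (left_mem_segment ℝ p q) hpC
      rw [← this] at hqx; exact lt_irrefl _ hqx
    refine ih (by linarith) (hB.rightOf_left hp hH hR' hblock hqx' hqy) (by linarith) ?_
    intro j hj1 hj2 hqj
    rw [hqy] at hqj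
    by_contra hcon
    push Not at hcon
    -- The step whose range of heights contains `p`: a left move passing it would first meet the
    -- right side of its rectangle.
    obtain ⟨l, l1, l2, l3, l4⟩ : ∃ l, j ≤ l ∧ l < i ∧ (P (l + 1)).2 ≤ p.2 ∧ p.2 ≤ (P l).2 := by
      have hlt : j < i := by
        refine lt_of_le_of_ne hj2 ?_
        rintro rfl
        exact hpC (hC' p (le_antisymm hqj hpi))
      clear hcon hj2
      obtain ⟨d, rfl⟩ : ∃ d, i = j + (d + 1) := ⟨i - j - 1, by omega⟩
      clear ih hC hC' hps hx hy hyanti hxmono hlt hj1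
      induction d generalizing j with
      | zero => exact ⟨j, le_rfl, by omega, hpi, hqj⟩
      | succ d ihd =>
        rcases le_or_gt p.2 (P (j + 1)).2 with h1 | h1
        · obtain ⟨l, h2, h3, h4⟩ := ihd _ h1 (by rwa [show j + 1 + (d + 1) = j + (d + 1 + 1) by ring])
          exact ⟨l, by omega, by omega, h4⟩
        · exact ⟨j, le_rfl, by omega, h1.le, hqj⟩
    have h1 := hps l (by omega) l2.le l4
    have h2 : (P (l + 1)).1 < p.1 := by
      by_contra h2
      push Not at h2
      exact hpC (hC l (by omega) l2 p h1 h2 l3 l4)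
    have h3 := hxmono j (l + 1) hj1 (by omega) l2
    have := hfirst ((P (l + 1)).1, p.2) ((mem_segment_left_iff hqy hqx.le).2
      ⟨rfl, by simp only; linarith, h2.le⟩)
      (hC l (by omega) l2 _ (hx l (by omega) l2) le_rfl l3 l4)
    rw [← this] at hcon
    simp only at hcon
    linarith

/-! ## `GoBackDown` -/

section GoBackDown

variable {S : Scene} {τ L x₀ : ℝ} {k : ℕ} {s : RobotState}

/-- The bound for the length of `GoDown` from the `μ`-th post of fence `j` to that of fence `j + 1`,
where `g` posts of fence `j + 1` are to the left of the former. -/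
noncomputable def fenceStepCost (τ : ℝ) (P : ℕ → ℕ → Pt) (μ : ℕ) (g : ℕ → ℕ) (j : ℕ) : ℝ :=
  (1 + 2 * τ) * ((P (j + 1) μ).1 - (P j μ).1) + τ + 2 * ((μ : ℝ) - g j) * τ

theorem FenceTree.fst_mem_and_snd_mem_of_mem_postRect
    (h : FenceTree S τ L x₀ k s.cnt s.post s.treePath) {j μ : ℕ} (hj : 1 ≤ j)
    (hμ : InTree k s.cnt (j + 1) μ) {z : Pt} :
    z ∈ postRect s j μ ↔ ((s.post j μ).1 ≤ z.1 ∧ z.1 ≤ (s.post (j + 1) μ).1) ∧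
      (s.post (j + 1) μ).2 ≤ z.2 ∧ z.2 ≤ (s.post j μ).2 := by
  have h1 := h.fst_le_fence_succ hμ hj
  have h2 := h.height_fence_succ hμ hj
  have h3 := h.tau_pos
  rw [postRect, ← Set.uIcc_prod_uIcc, Set.mem_prod, Set.uIcc_of_le h1, Set.uIcc_of_ge (by linarith)]
  rfl

theorem FenceTree.snd_sub_snd (h : FenceTree S τ L x₀ k s.cnt s.post s.treePath) {i j μ : ℕ}
    (hi : InTree k s.cnt i μ) (hj : InTree k s.cnt j μ) :
    (s.post j μ).2 - (s.post i μ).2 = ((i : ℝ) - j) * τ := by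
  rw [h.height _ _ hi, h.height _ _ hj]; ring

theorem le_fenceStepCost (h : FenceTree S τ L x₀ k s.cnt s.post s.treePath) {j μ : ℕ} (hj : 1 ≤ j)
    (hμ : InTree k s.cnt (j + 1) μ) {g : ℕ → ℕ} (hg : g j ≤ μ) :
    τ ≤ fenceStepCost τ s.post μ g j := by
  have h1 := h.fst_le_fence_succ hμ hj
  have h3 := h.tau_pos
  have h4 : (0 : ℝ) ≤ (μ : ℝ) - g j := sub_nonneg.2 (by exact_mod_cast hg)
  have h5 : 0 ≤ (1 + 2 * τ) * ((s.post (j + 1) μ).1 - (s.post j μ).1) :=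
    mul_nonneg (by linarith) (by linarith)
  have h6 : 0 ≤ 2 * ((μ : ℝ) - g j) * τ := by positivity
  rw [fenceStepCost]
  linarith

/-- Each summand is at least τ, so steps that are skipped still pay for the height difference
between their fences. -/
theorem mul_le_sum_fenceStepCost (h : FenceTree S τ L x₀ k s.cnt s.post s.treePath) {v i μ : ℕ}
    (hv : 1 ≤ v) (hvi : v ≤ i) (hμ : InTree k s.cnt i μ) {g : ℕ → ℕ}
    (hg : ∀ j, v ≤ j → j < i → g j ≤ μ) :
    ((i : ℝ) - v) * τ ≤ ∑ j ∈ Finset.Ico v i, fenceStepCost τ s.post μ g j := by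
  have := Finset.card_nsmul_le_sum (Finset.Ico v i) (fenceStepCost τ s.post μ g) τ fun j hj => by
    rw [Finset.mem_Ico] at hj
    exact le_fenceStepCost h (hv.trans hj.1) (h.inTree_of_le hμ (Nat.succ_pos j) hj.2 hμ.2.2.1 le_rfl)
      (hg j hj.1 hj.2)
  rwa [Nat.card_Ico, nsmul_eq_mul, Nat.cast_sub hvi] at this

theorem GoDownRepeat.spec_of_le (h : FenceTree S τ L x₀ k s.cnt s.post s.treePath) {i μ : ℕ}
    (hμ : InTree k s.cnt i μ) {g : ℕ → ℕ} {v : ℕ}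
    (hg : ∀ j, v ≤ j → j < i → ∀ p, 1 ≤ p → p ≤ g j → (s.post (j + 1) p).1 < (s.post j μ).1)
    {j : ℕ} {p r : Pt} {π : List Pt} (hgo : GoDownRepeat S τ s i μ j p r π) (hj : 1 ≤ j)
    (hvj : v ≤ j) (hp1 : (s.post j μ).1 ≤ p.1) (hp2 : p.2 ≤ (s.post j μ).2)
    (hp3 : j < i → (s.post (j + 1) μ).2 ≤ p.2) (hp4 : j = i → p = s.post j μ) :
    j ≤ i ∧ r = s.post i μ ∧ π.head? = some p ∧ π.getLast? = some (s.post i μ) ∧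
      pathLen π ≤ (p.2 - (s.post j μ).2) +
        ∑ j' ∈ Finset.Ico j i, fenceStepCost τ s.post μ g j' := by
  induction hgo with
  | done p =>
    obtain rfl := hp4 rfl
    simp [pathLen]
  | call j p r π π' hji hgo hrest ih =>
    have hτ := h.tau_pos
    have hμj : InTree k s.cnt (j + 1) μ := h.inTree_of_le hμ (Nat.succ_pos j) hji hμ.2.2.1 le_rfl
    obtain ⟨g1, g2, g3⟩ := hgo.spec_of_le h hj hμj hp1 (hp3 hji) hp2 (hg j hvj hji)
    obtain ⟨i1, i2, i3, i4, i5⟩ := ih (Nat.succ_pos j) (by omega) le_rfl le_rfl (fun hlt => by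
      have := h.height_fence_succ
        (h.inTree_of_le hμ (Nat.succ_pos _) hlt hμ.2.2.1 le_rfl) (Nat.succ_pos j)
      linarith) (fun _ => rfl)
    refine ⟨hji.le, i2, ?_, ?_, ?_⟩
    · rw [List.head?_append, g1]; rfl
    · rw [List.getLast?_append, i4]; rfl
    · rw [pathLen_append g2 i3, Finset.sum_eq_sum_Ico_succ_bot hji, fenceStepCost]
      have := h.height_fence_succ hμj hj
      linarith

/-- The rectangle that is hit may belong to a fence above `v`, where no information on `g` is
available. This happens only at the abscissa of post `v`, and then the calls just slide straight
down along posts until fence `v`. -/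
theorem GoDownRepeat.spec (h : FenceTree S τ L x₀ k s.cnt s.post s.treePath) {i μ : ℕ}
    (hμ : InTree k s.cnt i μ) {g : ℕ → ℕ} {v : ℕ} (hv : 1 ≤ v) (hvi : v ≤ i)
    (hgμ : ∀ j, v ≤ j → j < i → g j ≤ μ)
    (hg : ∀ j, v ≤ j → j < i → ∀ p, 1 ≤ p → p ≤ g j → (s.post (j + 1) p).1 < (s.post j μ).1)
    {j : ℕ} {p r : Pt} {π : List Pt} (hgo : GoDownRepeat S τ s i μ j p r π) (hj : 1 ≤ j)
    (hp1 : (s.post j μ).1 ≤ p.1) (hp2 : p.2 ≤ (s.post j μ).2)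
    (hp3 : j < i → (s.post (j + 1) μ).2 ≤ p.2) (hp4 : j = i → p = s.post j μ)
    (hp5 : j < v → p.1 = (s.post v μ).1 ∧ (s.post (j + 1) μ).1 = (s.post v μ).1) :
    r = s.post i μ ∧ π.head? = some p ∧ π.getLast? = some (s.post i μ) ∧
      pathLen π ≤ (p.2 - (s.post v μ).2) +
        ∑ j' ∈ Finset.Ico v i, fenceStepCost τ s.post μ g j' := by
  have hτ := h.tau_pos
  have hge : ∀ {j p r π}, GoDownRepeat S τ s i μ j p r π → 1 ≤ j → v ≤ j →
      (s.post j μ).1 ≤ p.1 → p.2 ≤ (s.post j μ).2 →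
      (j < i → (s.post (j + 1) μ).2 ≤ p.2) → (j = i → p = s.post j μ) →
      r = s.post i μ ∧ π.head? = some p ∧ π.getLast? = some (s.post i μ) ∧
        pathLen π ≤ (p.2 - (s.post v μ).2) +
          ∑ j' ∈ Finset.Ico v i, fenceStepCost τ s.post μ g j' := by
    intro j p r π hgo hj hvj hp1 hp2 hp3 hp4
    obtain ⟨s0, s1, s2, s3, s4⟩ := hgo.spec_of_le h hμ hg hj hvj hp1 hp2 hp3 hp4
    refine ⟨s1, s2, s3, s4.trans ?_⟩
    have hμj := h.inTree_of_le hμ hj s0 hμ.2.2.1 le_rfl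
    have h1 := mul_le_sum_fenceStepCost h hv hvj hμj (fun j' h1 h2 => hgμ j' h1 (by omega))
    have h2 := h.snd_sub_snd hμj (h.inTree_of_le hμ hv hvi hμ.2.2.1 le_rfl)
    rw [← Finset.sum_Ico_consecutive _ hvj s0]
    linarith
  induction hgo with
  | done p => exact hge (.done p) hj hvi hp1 hp2 hp3 hp4
  | call j p r π π' hji hgo hrest ih =>
    rcases Nat.lt_or_ge j v with hjv | hjv
    · have hμj : InTree k s.cnt (j + 1) μ := h.inTree_of_le hμ (Nat.succ_pos j) hji hμ.2.2.1 le_rfl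
      obtain ⟨q1, q2⟩ := hp5 hjv
      have hh := h.height_fence_succ hμj hj
      have hp3' := hp3 hji
      obtain ⟨g1, g2, g3⟩ := hgo.spec_of_mem (p := p)
        ⟨q1.trans q2.symm, by rw [abs_of_nonneg (by linarith)]; linarith⟩
      rw [abs_of_nonneg (by linarith)] at g3
      obtain ⟨i2, i3, i4, i5⟩ := ih (Nat.succ_pos j) le_rfl le_rfl (fun hlt => by
        have := h.height_fence_succ
          (h.inTree_of_le hμ (Nat.succ_pos _) hlt hμ.2.2.1 le_rfl) (Nat.succ_pos j)
        linarith) (fun _ => rfl) (fun hlt => ⟨q2, by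
          have hμv := h.inTree_of_le hμ hv hvi hμ.2.2.1 le_rfl
          have h1 := h.fst_mono hμv (Nat.succ_pos (j + 1)) hlt hμ.2.2.1 le_rfl
          have h2 := h.fst_le_fence_succ
            (h.inTree_of_le hμ (Nat.succ_pos _) (by omega) hμ.2.2.1 le_rfl) (Nat.succ_pos j)
          linarith⟩)
      refine ⟨i2, ?_, ?_, ?_⟩
      · rw [List.head?_append, g1]; rfl
      · rw [List.getLast?_append, i4]; rfl
      · rw [pathLen_append g2 i3]
        linarith
    · exact hge (.call j p r π π' hji hgo hrest) hj hjv hp1 hp2 hp3 hp4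

theorem exists_goDownRepeat (h : FenceTree S τ L x₀ k s.cnt s.post s.treePath) {i μ : ℕ}
    (hμ : InTree k s.cnt i μ) {j : ℕ} (hj : 1 ≤ j) (hji : j < i) {p : Pt} (hp : S.Free p)
    (hp1 : p ∈ postRect s j μ) : ∃ r π, GoDownRepeat S τ s i μ j p r π := by
  have hτ := h.tau_pos
  obtain ⟨d, rfl⟩ : ∃ d, i = j + d + 1 := ⟨i - j - 1, by omega⟩
  induction d generalizing j p with
  | zero =>
    rw [h.fst_mem_and_snd_mem_of_mem_postRect hj hμ] at hp1
    obtain ⟨π, hπ⟩ := exists_goDown_of_le h hj hμ hp hp1.1.1 hp1.1.2 hp1.2.1 hp1.2.2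
    exact ⟨_, _, .call j p _ π _ hji hπ (.done _)⟩
  | succ d ih =>
    have hμj : InTree k s.cnt (j + 1) μ := h.inTree_of_le hμ (Nat.succ_pos j) hji hμ.2.2.1 le_rfl
    have hμj' : InTree k s.cnt (j + 1 + 1) μ :=
      h.inTree_of_le hμ (Nat.succ_pos _) (by omega) hμ.2.2.1 le_rfl
    rw [h.fst_mem_and_snd_mem_of_mem_postRect hj hμj] at hp1
    obtain ⟨π, hπ⟩ := exists_goDown_of_le h hj hμj hp hp1.1.1 hp1.1.2 hp1.2.1 hp1.2.2
    rw [show j + (d + 1) + 1 = j + 1 + d + 1 by ring] at hμ hji ⊢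
    obtain ⟨r, π', h1⟩ := ih (Nat.succ_pos j) (p := s.post (j + 1) μ)
      ((h.post _ _ hμj).free rfl (by simpa using hτ.le)) Set.left_mem_uIcc hμ (by omega)
    exact ⟨r, _, .call j p r π π' (by omega) hπ h1⟩

theorem isClosed_setOf_mem_postRect (s : RobotState) (i μ : ℕ) :
    IsClosed {z : Pt | ∃ j, 1 ≤ j ∧ j < i ∧ z ∈ postRect s j μ} := by
  have : {z : Pt | ∃ j, 1 ≤ j ∧ j < i ∧ z ∈ postRect s j μ} =
      ⋃ j ∈ Set.Ico 1 i, postRect s j μ := by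
    ext z; simp [and_assoc]
  rw [this]
  refine (Set.finite_Ico 1 i).isClosed_biUnion fun j _ => ?_
  rw [postRect, Set.uIcc]
  exact isClosed_Icc

/-- The second phase of `GoBackDown`, where the goal may have been enlarged. -/
theorem GreedyDownLeft.goBackDown_spec (h : FenceTree S τ L x₀ k s.cnt s.post s.treePath)
    {v i μ : ℕ} (hv : 1 ≤ v) (hvi : v ≤ i) (hμ : 1 ≤ μ) (hvm : InTree k s.cnt v (μ + 1))
    (him : InTree k s.cnt i μ)
    {A : Pt} (hA1 : (s.post i μ).1 ≤ A.1) (hA2 : |A.2 - (s.post v (μ + 1)).2| < τ)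
    (hA3 : (s.post v (μ + 1)).2 < A.2 → ∃ R ∈ S.obstacles, R.bot < (s.post v (μ + 1)).2 ∧
      A.2 ≤ R.top ∧ (R.left : ℝ) ≤ A.1 ∧ (s.post v μ).1 ≤ R.left)
    {C : Set Pt}
    (hC : {z | (∃ j, 1 ≤ j ∧ j < i ∧ z ∈ postRect s j μ) ∨ z.2 = (s.post i μ).2} ⊆ C)
    {r : Pt} {π : List Pt} (hgr : GreedyDownLeft S C A r π) :
    (s.post v μ).1 ≤ r.1 ∧ (s.post i μ).2 ≤ r.2 ∧
      ∀ j, v ≤ j → j ≤ i → r.2 ≤ (s.post j μ).2 → (s.post j μ).1 ≤ r.1 := by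
  have hτ := h.tau_pos
  have hin : ∀ j, 1 ≤ j → j ≤ i → InTree k s.cnt j μ := fun j h1 h2 =>
    h.inTree_of_le him h1 h2 hμ le_rfl
  have hvμ := hin v hv hvi
  have hvY := h.height_succ hvm hμ
  obtain ⟨R, hR, hl, hb, ht⟩ := h.post _ _ hvμ
  have hA2' := abs_lt.1 hA2
  have hvA : (s.post v μ).1 ≤ A.1 := (h.fst_mono him hv hvi hμ le_rfl).trans hA1
  have key : ∀ 𝓑, IsBarrier S 𝓑 A.2 → RightOf 𝓑 A → R ∈ 𝓑 →
      (s.post v μ).1 ≤ r.1 ∧ (s.post i μ).2 ≤ r.2 ∧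
      ∀ j, v ≤ j → j ≤ i → r.2 ≤ (s.post j μ).2 → (s.post j μ).1 ≤ r.1 := by
    intro 𝓑 hB hAB hRB
    have hsub := h.snd_sub_snd him hvμ
    have hvi' : (0 : ℝ) ≤ (i : ℝ) - v := sub_nonneg.2 (by exact_mod_cast hvi)
    have hpos : 0 ≤ ((i : ℝ) - v) * τ := mul_nonneg hvi' hτ.le
    obtain ⟨r1, r2, r3⟩ := hgr.stairs (P := fun j => s.post j μ) (v := v) (i := i)
      (fun j h1 h2 => h.fst_le_fence_succ (hin _ (by omega) h2) (by omega))
      (fun j h1 h2 => by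
        have := h.height_fence_succ (hin _ (by omega) h2) (by omega); linarith)
      (fun j h1 h2 z z1 z2 z3 z4 => hC (Or.inl ⟨j, by omega, h2,
        (h.fst_mem_and_snd_mem_of_mem_postRect (by omega) (hin _ (by omega) h2)).2
          ⟨⟨z1, z2⟩, z3, z4⟩⟩))
      (fun z hz => hC (Or.inr hz)) hB hRB hl (by linarith) le_rfl hAB (by linarith)
      (fun j h1 h2 _ => (h.fst_mono him (by omega) h2 hμ le_rfl).trans hA1)
    refine ⟨?_, r2, r3⟩
    rcases le_or_gt r.2 (s.post v μ).2 with h1 | h1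
    · exact r3 v le_rfl hvi h1
    · rw [← hl]; exact r1 R hRB (by linarith)
  -- The segment of post number μ reaches up to the centre of post μ + 1. So it is a barrier up to
  -- `A` by itself, or together with the obstacle of the detour on which `A` lies.
  rcases le_or_gt A.2 (s.post v (μ + 1)).2 with hle | hlt
  · refine key {R} ⟨by simpa using hR, ?_⟩ ?_ rfl
    · rintro R' rfl y hy1 hy2
      exact ⟨R', rfl, le_rfl, hy1, by linarith⟩
    · rintro R' rfl _
      rwa [hl]
  · obtain ⟨R', hR', b1, b2, b3, b4⟩ := hA3 hlt
    refine key {R, R'} ⟨?_, ?_⟩ ?_ (Or.inl rfl)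
    · rintro _ (rfl | rfl) <;> assumption
    · rintro _ (rfl | rfl) y hy1 hy2
      · rename_i R₁
        rcases le_or_gt y R₁.top with h1 | h1
        · exact ⟨R₁, Or.inl rfl, le_rfl, hy1, h1⟩
        · refine ⟨R', Or.inr rfl, ?_, by linarith, by linarith⟩
          rw [← hl] at b4
          exact_mod_cast b4
      · rename_i R₁
        exact ⟨R₁, Or.inr rfl, le_rfl, hy1, by linarith⟩
    · rintro _ (rfl | rfl) _
      · rwa [hl]
      · exact b3

/-- Besides the final `GoDown`, the walk back costs at most one τ per chain edge and one more, and
the drop to the height of post `v` less than 2τ: hence the constant 3 added to that of `GoDown`,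
whose m' − q + 1 becomes μ + 1 − q here. The part of the descent left of `P i μ` is spread over the
chain. -/
theorem GoBackDown.spec (h : FenceTree S τ L x₀ k s.cnt s.post s.treePath) {i q μ : ℕ}
    (hi : 1 ≤ i) (hq : InTree k s.cnt (i + 1) q) (hm : InTree k s.cnt i (μ + 1)) (hqμ : q < μ)
    (hc : (s.post i μ).1 ≤ (s.post (i + 1) q).1)
    (hc' : (s.post (i + 1) q).1 < (s.post i (μ + 1)).1) {π : List Pt}
    (hgo : GoBackDown S τ s i (μ + 1) q π) {g : ℕ}
    (hg : ∀ p, 1 ≤ p → p ≤ g → (s.post (i + 1) p).1 < (s.post i (q + 1)).1) {g' : ℕ → ℕ}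
    (hgμ : ∀ j, 1 ≤ j → j < i → g' j < μ)
    (hg' : ∀ j, 1 ≤ j → j < i → (s.post (i + 1) q).1 < (s.post j (μ + 1)).1 →
      ∀ p, 1 ≤ p → p ≤ g' j → (s.post (j + 1) p).1 < (s.post j μ).1) :
    π.head? = some (s.post i (μ + 1)) ∧ π.getLast? = some (s.post (i + 1) q) ∧
      ∃ v, 1 ≤ v ∧ v ≤ i ∧
        (∀ j, v ≤ j → j ≤ i → (s.post (i + 1) q).1 < (s.post j (μ + 1)).1) ∧
        pathLen π ≤ 3 * τ * ((s.post i (μ + 1)).1 - (s.post (i + 1) q).1) +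
          ∑ j ∈ Finset.Ico v i, (4 * τ * ((s.post (j + 1) μ).1 - (s.post j μ).1) +
            4 * ((μ : ℝ) - g' j) * τ) +
          5 * τ * ((s.post (i + 1) q).1 - (s.post i (q + 1)).1) +
          (((μ : ℝ) + 1 - q) + 3 + 2 * ((q : ℝ) - g)) * τ := by
  have hτ := h.tau_pos
  have h1τ := h.one_le_tau
  have hμ1 : 1 ≤ μ := by omega
  have him : InTree k s.cnt i μ := h.inTree_of_le hm hi le_rfl hμ1 (Nat.le_succ μ)
  obtain ⟨A, C, D, π₁, π₂, π₃, π₄, h1, h2, h3, h4, rfl⟩ := hgo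
  rw [Nat.add_sub_cancel] at h2 h3
  obtain ⟨v, v1, v2, v3, v4, v5, v6, v7⟩ := h.backUntil_spec hμ1 hm hc hc' h1
  have hgv : ∀ j, v ≤ j → j < i → ∀ p, 1 ≤ p → p ≤ g' j →
      (s.post (j + 1) p).1 < (s.post j μ).1 := fun j j1 j2 =>
    hg' j (v1.trans j1) j2 (v3 j j1 j2.le)
  have hgμ' : ∀ j, v ≤ j → j < i → g' j ≤ μ := fun j j1 j2 => (hgμ j (v1.trans j1) j2).le
  have hAc := h1.2.1
  obtain ⟨c1, c2, c3⟩ := h2.goBackDown_spec h v1 v2 hμ1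
    (h.inTree_of_le hm v1 v2 (by omega) le_rfl) him (by rw [hAc]; exact hc) v4 v6 subset_rfl
  obtain ⟨d1, d2, d3, d4, d5, d6⟩ := h2.spec
  have hmid : (s.post i μ).1 ≤ D.1 ∧ D.1 ≤ (s.post (i + 1) q).1 ∧ D.2 = (s.post i μ).2 ∧
      π₃.head? = some C ∧ π₃.getLast? = some D ∧
      pathLen π₃ ≤ (C.2 - (s.post v μ).2) +
        ∑ j' ∈ Finset.Ico v i, fenceStepCost τ s.post μ g' j' := by
    rcases h3 with ⟨j, j1, j2, j3, hrep⟩ | ⟨e1, rfl, rfl⟩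
    · rw [h.fst_mem_and_snd_mem_of_mem_postRect j1
        (h.inTree_of_le him (Nat.succ_pos j) j2 hμ1 le_rfl)] at j3
      obtain ⟨r1, r2, r3, r4⟩ := hrep.spec h him v1 v2 hgμ' hgv j1 j3.1.1 j3.2.2
        (fun _ => j3.2.1) (fun heq => absurd heq j2.ne) (fun hjv => by
          have h5 := h.fst_mono (h.inTree_of_le him v1 v2 hμ1 le_rfl) (Nat.succ_pos j) hjv
            hμ1 le_rfl
          have h6 := j3.1.2
          constructor <;> linarith)
      subst r1
      exact ⟨le_rfl, hc, rfl, r2, r3, r4⟩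
    · refine ⟨c3 i v2 le_rfl e1.le, by linarith, e1, rfl, rfl, ?_⟩
      have h5 := mul_le_sum_fenceStepCost h v1 v2 him hgμ'
      have h6 := h.snd_sub_snd him (h.inTree_of_le him v1 v2 hμ1 le_rfl)
      simp only [pathLen]
      linarith
  obtain ⟨m1, m2, m3, m4, m5, m6⟩ := hmid
  obtain ⟨f1, f2, f3⟩ := h4.spec h hi hq him hqμ m1 m2 m3 hg
  have hspec := h.path_spec hm
  have g1 : π₁.reverse.head? = some (s.post i (μ + 1)) := by
    rw [List.head?_reverse, h1.1.getLast?, hspec.2.1]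
  have g2 : π₁.reverse.getLast? = some A := by
    rw [List.getLast?_reverse, h1.1.head?]
  refine ⟨?_, ?_, v, v1, v2, v3, ?_⟩
  · simp only [List.head?_append, g1, Option.some_or]
  · rw [List.getLast?_append, f2]; rfl
  · rw [pathLen_append (by rw [List.getLast?_append, m5]; rfl) f1,
      pathLen_append (by rw [List.getLast?_append, d2]; rfl) m4, pathLen_append g2 d1,
      pathLen_reverse, d6]
    have hvY := h.height_succ (h.inTree_of_le hm v1 v2 (by omega) le_rfl) hμ1
    have hA2 := (abs_lt.1 v4).2
    -- Each summand absorbs its share of the leftward descent and of the walk back: (1 + 2τ) + 1 ≤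
    -- 4τ, and 2 + 2(μ − g') ≤ 4(μ − g') because g' < μ.
    have hsum : ∑ j ∈ Finset.Ico v i, (4 * τ * ((s.post (j + 1) μ).1 - (s.post j μ).1) +
            4 * ((μ : ℝ) - g' j) * τ) ≥ ∑ j ∈ Finset.Ico v i, (fenceStepCost τ s.post μ g' j +
              (((s.post (j + 1) μ).1 - (s.post j μ).1) + τ)) := by
      apply Finset.sum_le_sum
      intro j hj
      rw [Finset.mem_Ico] at hj
      have j1 := h.fst_le_fence_succ (h.inTree_of_le him (Nat.succ_pos j) hj.2 hμ1 le_rfl)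
        (v1.trans hj.1)
      have j2 : (g' j : ℝ) + 1 ≤ μ := by exact_mod_cast hgμ j (v1.trans hj.1) hj.2
      rw [fenceStepCost]
      have j3 : 0 ≤ (τ - 1) * ((s.post (j + 1) μ).1 - (s.post j μ).1) :=
        mul_nonneg (by linarith) (by linarith)
      have j4 : 0 ≤ ((μ : ℝ) - g' j - 1) * τ := mul_nonneg (by linarith) hτ.le
      linarith
    have hsplit : ∑ j ∈ Finset.Ico v i, (fenceStepCost τ s.post μ g' j +
        (((s.post (j + 1) μ).1 - (s.post j μ).1) + τ)) =
        ∑ j ∈ Finset.Ico v i, fenceStepCost τ s.post μ g' j +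
          (((s.post i μ).1 - (s.post v μ).1) + ((i : ℝ) - v) * τ) := by
      rw [Finset.sum_add_distrib, Finset.sum_add_distrib,
        Finset.sum_Ico_sub (fun j => (s.post j μ).1) v2, Finset.sum_const, Nat.card_Ico,
        nsmul_eq_mul, Nat.cast_sub v2]
    rw [hsplit] at hsum
    -- The descent right of `P i μ` is merged with the 2 + 2τ of `GoDown`, and 3 + 2τ ≤ 5τ.
    have h5 : (s.post i (q + 1)).1 ≤ (s.post i μ).1 :=
      h.fst_mono him hi le_rfl (by omega) hqμ
    have h6 : 0 ≤ (τ - 1) * ((s.post i (μ + 1)).1 - (s.post (i + 1) q).1) :=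
      mul_nonneg (by linarith) (by linarith)
    have h7 : 0 ≤ (τ - 1) * ((s.post (i + 1) q).1 - (s.post i (q + 1)).1) :=
      mul_nonneg (by linarith) (by linarith)
    linarith

/-- The two half-planes added to the goal are harmless: the staircase keeps the path right of `P v
μ` and not below the height of `P i μ`. -/
theorem exists_goBackDown (h : FenceTree S τ L x₀ k s.cnt s.post s.treePath) {i q μ : ℕ}
    (hi : 1 ≤ i) (hq : InTree k s.cnt (i + 1) q) (hm : InTree k s.cnt i (μ + 1)) (hqμ : q < μ)
    (hc : (s.post i μ).1 ≤ (s.post (i + 1) q).1)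
    (hc' : (s.post (i + 1) q).1 < (s.post i (μ + 1)).1) :
    ∃ π, GoBackDown S τ s i (μ + 1) q π := by
  have hτ := h.tau_pos
  have hμ1 : 1 ≤ μ := by omega
  have him : InTree k s.cnt i μ := h.inTree_of_le hm hi le_rfl hμ1 (Nat.le_succ μ)
  have hspec := h.path_spec hm
  obtain ⟨A, π₁, h1⟩ := exists_backUntil hspec.2.2 hspec.1 hspec.2.1
    (c := (s.post (i + 1) q).1) (by rw [h.root]; exact h.start_le hq) hc'
  obtain ⟨v, v1, v2, v3, v4, v5, v6, v7⟩ := h.backUntil_spec hμ1 hm hc hc' h1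
  have hAc := h1.2.1
  set C : Set Pt :=
    {z | (∃ j, 1 ≤ j ∧ j < i ∧ z ∈ postRect s j μ) ∨ z.2 = (s.post i μ).2} with hC
  have hCc : IsClosed C := (isClosed_setOf_mem_postRect s i μ).union
    (isClosed_eq continuous_snd continuous_const)
  obtain ⟨r, π₂, h2⟩ := exists_greedyDownLeft
    (C := C ∪ ({z | z.1 ≤ x₀ - 1} ∪ {z | z.2 ≤ (s.post i μ).2}))
    (hCc.union ((isClosed_le continuous_fst continuous_const).union
      (isClosed_le continuous_snd continuous_const)))
    (fun z hz => Or.inr (Or.inl hz)) (fun z hz => Or.inr (Or.inr hz)) v5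
  obtain ⟨c1, c2, c3⟩ := h2.goBackDown_spec h v1 v2 hμ1
    (h.inTree_of_le hm v1 v2 (by omega) le_rfl) him (by rw [hAc]; exact hc) v4 v6
    Set.subset_union_left
  obtain ⟨d1, d2, d3, d4, d5, d6⟩ := h2.spec
  have hrC : r ∈ C := by
    rcases d3 with h3 | h3 | h3
    · exact h3
    · have h4 := h.start_le (h.inTree_of_le him v1 v2 hμ1 le_rfl)
      have h5 : r.1 ≤ x₀ - 1 := h3
      linarith
    · exact Or.inr (le_antisymm h3 c2)
  have hgr := h2.of_subset Set.subset_union_left hrC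
  have hrf := h2.free v5
  obtain ⟨D, π₃, hD, hD1, hD2, hD3, hD4⟩ : ∃ D π₃, ((∃ j, 1 ≤ j ∧ j < i ∧ r ∈ postRect s j μ ∧
        GoDownRepeat S τ s i μ j r D π₃) ∨
      (r.2 = (s.post i μ).2 ∧ D = r ∧ π₃ = [r])) ∧ S.Free D ∧ (s.post i μ).1 ≤ D.1 ∧
      D.1 ≤ (s.post (i + 1) q).1 ∧ D.2 = (s.post i μ).2 := by
    by_cases h3 : r.2 = (s.post i μ).2
    · exact ⟨r, [r], Or.inr ⟨h3, rfl, rfl⟩, hrf, c3 i v2 le_rfl h3.le, by linarith, h3⟩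
    · obtain ⟨j, j1, j2, j3⟩ := hrC.resolve_right h3
      obtain ⟨D, π₃, h4⟩ := exists_goDownRepeat h him j1 j2 hrf j3
      have hD : D = s.post i μ := by
        rw [h.fst_mem_and_snd_mem_of_mem_postRect j1
          (h.inTree_of_le him (Nat.succ_pos j) j2 hμ1 le_rfl)] at j3
        exact (h4.spec_of_le h him (g := fun _ => 0) (v := j) (fun _ _ _ p hp hp' => by omega)
          j1 le_rfl j3.1.1 j3.2.2 (fun _ => j3.2.1) (fun heq => absurd heq j2.ne)).2.1
      refine ⟨D, π₃, Or.inl ⟨j, j1, j2, j3, h4⟩, ?_⟩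
      rw [hD]
      exact ⟨(h.post _ _ him).free rfl (by simpa using hτ.le), le_rfl, hc, rfl⟩
  obtain ⟨π₄, h4⟩ := exists_goDown h hi hq him hqμ hD1 hD2 hD3 hD4
  exact ⟨_, A, r, D, π₁, π₂, π₃, π₄, h1, hgr, hD, h4, rfl⟩

end GoBackDown

/-! ## Adding a post to a fence -/

/-- The sequences `m'`, `P'`, `T'` are `m`, `P`, `T` with one more post on fence `j`. -/
structure Extends (m m' : ℕ → ℕ) (P P' : ℕ → ℕ → Pt) (j : ℕ) : Prop where
  cnt_self : m' j = m j + 1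
  cnt_of_ne : ∀ i, i ≠ j → m' i = m i
  post : ∀ i p, p ≤ m i → P' i p = P i p
  last_le : (P j (m j)).1 ≤ (P' j (m j + 1)).1

namespace Extends

variable {m m' : ℕ → ℕ} {P P' : ℕ → ℕ → Pt} {j : ℕ}

theorem cnt_le (h : Extends m m' P P' j) (i : ℕ) : m i ≤ m' i := by
  rcases eq_or_ne i j with rfl | hij
  · rw [h.cnt_self]; exact Nat.le_succ _
  · rw [h.cnt_of_ne i hij]

theorem last_of_ne (h : Extends m m' P P' j) {i : ℕ} (hij : i ≠ j) : P' i (m' i) = P i (m i) := by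
  rw [h.cnt_of_ne i hij, h.post i _ le_rfl]

theorem last_mono (h : Extends m m' P P' j) (i : ℕ) : (P i (m i)).1 ≤ (P' i (m' i)).1 := by
  rcases eq_or_ne i j with rfl | hij
  · rw [h.cnt_self]; exact h.last_le
  · rw [h.last_of_ne hij]

end Extends

theorem RobotState.extends_addPost (s : RobotState) (j : ℕ) (Q : Pt) (γ : List Pt)
    (h : (s.post j (s.cnt j)).1 ≤ Q.1) :
    Extends s.cnt (s.addPost j Q γ).cnt s.post (s.addPost j Q γ).post j where
  cnt_self := by simp [RobotState.addPost]
  cnt_of_ne i hij := by simp [RobotState.addPost, hij]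
  post i p hp := by
    rcases eq_or_ne i j with rfl | hij
    · simp only [RobotState.addPost, Function.update_self]
      exact Function.update_of_ne (by omega) _ _
    · simp [RobotState.addPost, hij]
  last_le := by simpa [RobotState.addPost] using h

theorem RobotState.addPost_post_self (s : RobotState) (j : ℕ) (Q : Pt) (γ : List Pt) :
    (s.addPost j Q γ).post j (s.cnt j + 1) = Q := by simp [RobotState.addPost]

theorem RobotState.addPost_treePath_self (s : RobotState) (j : ℕ) (Q : Pt) (γ : List Pt) :
    (s.addPost j Q γ).treePath j (s.cnt j + 1) = γ := by simp [RobotState.addPost]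

theorem RobotState.addPost_treePath (s : RobotState) (j : ℕ) (Q : Pt) (γ : List Pt) {i p : ℕ}
    (hp : p ≤ s.cnt i) : (s.addPost j Q γ).treePath i p = s.treePath i p := by
  rcases eq_or_ne i j with rfl | hij
  · simp only [RobotState.addPost, Function.update_self]
    exact Function.update_of_ne (by omega) _ _
  · simp [RobotState.addPost, hij]

theorem FenceTree.extend {S : Scene} {τ L x₀ : ℝ} {k : ℕ} {m m' : ℕ → ℕ} {P P' : ℕ → ℕ → Pt}
    {T T' : ℕ → ℕ → List Pt} (h : FenceTree S τ L x₀ k m P T) {j : ℕ}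
    (hE : Extends m m' P P' j) (hT : ∀ i p, p ≤ m i → T' i p = T i p) (hj : 1 ≤ j)
    (hanti : ∀ j', 1 ≤ j' → j = j' + 1 → m j + 1 ≤ m j')
    (hedge : (1 ≤ m j ∧ (∀ j', 1 ≤ j' → j = j' + 1 → (P j' (m j + 1)).1 ≤ (P j (m j)).1) ∧
      ∃ δ, IsEdge S τ ((P j (m j)).2 + τ) (P j (m j)) (P' j (m j + 1)) δ ∧
        T' j (m j + 1) = T j (m j) ++ δ) ∨
      (∃ j', 1 ≤ j' ∧ j = j' + 1 ∧ (1 ≤ m j → (P j (m j)).1 < (P j' (m j + 1)).1) ∧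
        ∃ δ, IsEdge S τ ((P j' (m j + 1)).2 - τ) (P j' (m j + 1)) (P' j (m j + 1)) δ ∧
          T' j (m j + 1) = T j' (m j + 1) ++ δ)) :
    FenceTree S τ L x₀ k m' P' T' := by
  have hold : ∀ i p, InTree k m' i p → InTree k m i p ∨ (i = j ∧ p = m j + 1) := by
    rintro i p ⟨h1, h2, h3, h4⟩
    rcases eq_or_ne i j with rfl | hij
    · rw [hE.cnt_self] at h4
      rcases Nat.lt_or_ge (m i) p with h5 | h5
      · exact Or.inr ⟨rfl, by omega⟩
      · exact Or.inl ⟨h1, h2, h3, h5⟩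
    · rw [hE.cnt_of_ne i hij] at h4
      exact Or.inl ⟨h1, h2, h3, h4⟩
  have hpost : ∀ i p, InTree k m i p → P' i p = P i p := fun i p hp => hE.post i p hp.2.2.2
  have hnew : j ≤ k → (P' j (m j + 1)).2 = -L + (((m j + 1 : ℕ) : ℝ) - j) * τ ∧
      IsPost S τ (P' j (m j + 1)) ∧ (P' j (m j + 1)).1 < S.n := by
    intro hjk
    rcases hedge with ⟨h1, _, δ, hδ, _⟩ | ⟨j', h1, rfl, _, δ, hδ, _⟩
    · refine ⟨?_, hδ.isPost, hδ.2.2.1⟩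
      rw [hδ.snd_eq, h.height j _ ⟨hj, hjk, h1, le_rfl⟩]
      push_cast; ring
    · refine ⟨?_, hδ.isPost, hδ.2.2.1⟩
      rw [hδ.snd_eq, h.height j' _ ⟨h1, by omega, by omega, hanti j' h1 rfl⟩]
      push_cast; ring
  refine ⟨h.one_le_tau, h.start_pos, h.one_le_cnt.trans (hE.cnt_le 1), ?_, ?_, ?_, ?_, ?_, ?_, ?_,
    ?_⟩
  · intro i h1 h2
    have h3 := h.anti i h1 h2
    rcases eq_or_ne (i + 1) j with rfl | hij
    · rw [hE.cnt_self, hE.cnt_of_ne i (by omega)]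
      exact hanti i h1 rfl
    · rw [hE.cnt_of_ne _ hij]
      exact h3.trans (hE.cnt_le i)
  · rw [hE.post 1 1 h.one_le_cnt, h.root]
  · rw [hT 1 1 h.one_le_cnt, hE.post 1 1 h.one_le_cnt, h.root_path]
  · intro i
    rw [hE.post i 0 (Nat.zero_le _), h.post_zero]
  · intro i p hp
    rcases hold i p hp with h1 | ⟨rfl, rfl⟩
    · rw [hpost i p h1, h.height i p h1]
    · exact (hnew hp.2.1).1
  · intro i p hp
    rcases hold i p hp with h1 | ⟨rfl, rfl⟩
    · rw [hpost i p h1]; exact h.post i p h1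
    · exact (hnew hp.2.1).2.1
  · intro i p hp
    rcases hold i p hp with h1 | ⟨rfl, rfl⟩
    · rw [hpost i p h1]; exact h.lt_wall i p h1
    · exact (hnew hp.2.1).2.2
  · intro i p hp
    rcases hold i p hp with h1 | ⟨rfl, rfl⟩
    · rw [hpost i p h1, hT i p h1.2.2.2]
      rcases h.edge i p h1 with h2 | ⟨p', h2, rfl, h3, δ, h4, h5⟩ | ⟨j', h2, rfl, h3, δ, h4, h5⟩
      · exact Or.inl h2
      · have h6 := h.inTree_of_le h1 h1.1 le_rfl h2 (Nat.le_succ p')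
        refine Or.inr (Or.inl ⟨p', h2, rfl, ?_, δ, ?_, ?_⟩)
        · intro j' h7 h8
          rw [hpost i p' h6, hpost j' _ (h.inTree_of_le h1 h7 (by omega) h1.2.2.1 le_rfl)]
          exact h3 j' h7 h8
        · rwa [hpost i p' h6]
        · rwa [hT i p' h6.2.2.2]
      · have h6 := h.inTree_of_le h1 h2 (Nat.le_succ j') h1.2.2.1 le_rfl
        refine Or.inr (Or.inr ⟨j', h2, rfl, ?_, δ, ?_, ?_⟩)
        · intro p' h7 h8
          rw [hpost j' p h6, hpost _ p' (h.inTree_of_le h1 h1.1 le_rfl h7 (by omega))]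
          exact h3 p' h7 h8
        · rwa [hpost j' p h6]
        · rwa [hT j' p h6.2.2.2]
    · rcases hedge with ⟨h1, h3, δ, h4, h5⟩ | ⟨j', h2, rfl, h3, δ, h4, h5⟩
      · refine Or.inr (Or.inl ⟨m i, h1, rfl, ?_, δ, ?_, ?_⟩)
        · intro j' h7 h8
          rw [hE.post i _ le_rfl, hE.post j' _ (hanti j' h7 h8)]
          exact h3 j' h7 h8
        · rwa [hE.post i _ le_rfl]
        · rwa [hT i _ le_rfl]
      · have h6 := hanti j' h2 rfl
        refine Or.inr (Or.inr ⟨j', h2, rfl, ?_, δ, ?_, ?_⟩)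
        · intro p' h7 h8
          obtain rfl : p' = m (j' + 1) := by omega
          rw [hE.post j' _ h6, hE.post _ _ le_rfl]
          exact h3 h7
        · rwa [hE.post j' _ h6]
        · rwa [hT j' _ h6]

/-- An empty fence has the conventional abscissa 0 < x₀, so a comparison with a real post shows that
a fence is not empty. -/
theorem FenceTree.one_le_cnt_of_start_le {S : Scene} {τ L x₀ : ℝ} {k : ℕ} {m : ℕ → ℕ}
    {P : ℕ → ℕ → Pt} {T : ℕ → ℕ → List Pt} (h : FenceTree S τ L x₀ k m P T) {j : ℕ}
    (hle : x₀ ≤ (P j (m j)).1) : 1 ≤ m j := by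
  by_contra hcon
  have h0 : m j = 0 := by omega
  rw [h0, h.post_zero] at hle
  exact absurd h.start_pos (not_lt.2 hle)

/-! ## The order in which the fences are extended -/

/-- The relations between the fences when fence `i` is the current one: `m j` posts of fence `j`
have been found. -/
structure FenceInv (k M : ℕ) (m : ℕ → ℕ) (P : ℕ → ℕ → Pt) (i : ℕ) : Prop where
  one_le_cur : 1 ≤ i
  cur_le : i ≤ k
  one_le_cnt : 1 ≤ m i
  cnt_le : ∀ j, 1 ≤ j → j ≤ k → m j ≤ M
  le_cur_of_full : ∀ j, 1 ≤ j → j ≤ k → m j = M → j ≤ i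
  last_le_succ : ∀ j, i < j → j < k → (P j (m j)).1 ≤ (P (j + 1) (m (j + 1))).1
  le_last : ∀ j j' p, 1 ≤ j → j < j' → j' ≤ k → 1 ≤ p → p < m j →
    (P j p).1 ≤ (P j' (m j')).1

namespace FenceInv

variable {S : Scene} {τ L x₀ : ℝ} {k M : ℕ} {m m' : ℕ → ℕ} {P P' : ℕ → ℕ → Pt}
  {T : ℕ → ℕ → List Pt} {i : ℕ}

theorem last_le_last (hI : FenceInv k M m P i) {j j' : ℕ} (hj : i < j) (hjj' : j ≤ j')
    (hj' : j' ≤ k) : (P j (m j)).1 ≤ (P j' (m j')).1 := by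
  induction j', hjj' using Nat.le_induction with
  | base => exact le_rfl
  | succ j' hjj' ih => exact (ih (by omega)).trans (hI.last_le_succ j' (by omega) hj')

theorem last_le_last_of_le (hI : FenceInv k M m P i)
    (h2 : i < k → (P i (m i)).1 ≤ (P (i + 1) (m (i + 1))).1) {j' : ℕ} (hj : i < j')
    (hj' : j' ≤ k) : (P i (m i)).1 ≤ (P j' (m j')).1 :=
  (h2 (by omega)).trans (hI.last_le_last (Nat.lt_succ_self i) hj hj')

theorem inTree_cur (hI : FenceInv k M m P i) : InTree k m i (m i) :=
  ⟨hI.one_le_cur, hI.cur_le, hI.one_le_cnt, le_rfl⟩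

/-- The next fence becomes the current one. -/
theorem descend (hI : FenceInv k M m P i) (hik : i < k) (hm : 1 ≤ m (i + 1)) :
    FenceInv k M m P (i + 1) where
  one_le_cur := Nat.succ_pos i
  cur_le := hik
  one_le_cnt := hm
  cnt_le := hI.cnt_le
  le_cur_of_full j h1 h2 h3 := (hI.le_cur_of_full j h1 h2 h3).trans (Nat.le_succ i)
  last_le_succ j h1 h2 := hI.last_le_succ j (by omega) h2
  le_last := hI.le_last

/-- Full fences are not below the current one, so a full current fence above the lowest has an
incomplete successor, and the fourth case applies. -/
theorem cnt_ne_full (hI : FenceInv k M m P i)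
    (h4 : i < k → m (i + 1) < m i → m i ≠ M) (h5 : ¬ (i = k ∧ m i = M)) : m i ≠ M := by
  intro hM
  have hik : i < k := lt_of_le_of_ne hI.cur_le fun h => h5 ⟨h, hM⟩
  have h6 : m (i + 1) = M := by
    refine le_antisymm (hI.cnt_le _ (Nat.succ_pos i) hik) ?_
    by_contra hcon
    exact h4 hik (by omega) hM
  exact absurd (hI.le_cur_of_full _ (Nat.succ_pos i) hik h6) (by omega)

/-- The previous fence becomes the current one. -/
theorem ascend (hI : FenceInv k M m P (i + 1)) (h : FenceTree S τ L x₀ k m P T) (hi : 1 ≤ i)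
    (h2 : i + 1 < k → (P (i + 1) (m (i + 1))).1 ≤ (P (i + 1 + 1) (m (i + 1 + 1))).1)
    (h4 : i + 1 < k → m (i + 1 + 1) < m (i + 1) → m (i + 1) ≠ M)
    (h5 : ¬ (i + 1 = k ∧ m (i + 1) = M)) : FenceInv k M m P i where
  one_le_cur := hi
  cur_le := (Nat.le_succ i).trans hI.cur_le
  one_le_cnt := hI.one_le_cnt.trans (h.anti i hi hI.cur_le)
  cnt_le := hI.cnt_le
  le_cur_of_full j h6 h7 h8 := by
    have h9 := hI.le_cur_of_full j h6 h7 h8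
    rcases eq_or_ne j (i + 1) with rfl | hne
    · exact absurd h8 (hI.cnt_ne_full h4 h5)
    · omega
  last_le_succ j h6 h7 := by
    rcases eq_or_ne j (i + 1) with rfl | hne
    · exact h2 h7
    · exact hI.last_le_succ j (by omega) h7
  le_last := hI.le_last

/-- The only new comparison is for the post that was last on fence `j` so far; all other last posts
merely advance. -/
theorem le_last_of_extends {j : ℕ} (hE : Extends m m' P P' j)
    (hB : ∀ j j' p, 1 ≤ j → j < j' → j' ≤ k → 1 ≤ p → p < m j → (P j p).1 ≤ (P j' (m j')).1)
    (hlast : ∀ j', j < j' → j' ≤ k → (P j (m j)).1 ≤ (P j' (m j')).1) :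
    ∀ l l' p, 1 ≤ l → l < l' → l' ≤ k → 1 ≤ p → p < m' l → (P' l p).1 ≤ (P' l' (m' l')).1 := by
  intro l l' p h1 h2 h3 h4 h5
  rcases eq_or_ne l j with rfl | hlj
  · rw [hE.cnt_self] at h5
    rw [hE.post l p (by omega), hE.last_of_ne h2.ne']
    rcases eq_or_ne p (m l) with rfl | hp
    · exact hlast l' h2 h3
    · exact hB l l' p h1 h2 h3 h4 (by omega)
  · rw [hE.cnt_of_ne l hlj] at h5
    rw [hE.post l p h5.le]
    exact (hB l l' p h1 h2 h3 h4 h5).trans (hE.last_mono l')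

/-- The current fence is extended. -/
theorem extend (hI : FenceInv k M m P i) (hE : Extends m m' P P' i) (hM : m i + 1 ≤ M)
    (h2 : i < k → (P i (m i)).1 ≤ (P (i + 1) (m (i + 1))).1) : FenceInv k M m' P' i where
  one_le_cur := hI.one_le_cur
  cur_le := hI.cur_le
  one_le_cnt := hI.one_le_cnt.trans (hE.cnt_le i)
  cnt_le j h3 h4 := by
    rcases eq_or_ne j i with rfl | hji
    · rwa [hE.cnt_self]
    · rw [hE.cnt_of_ne j hji]; exact hI.cnt_le j h3 h4
  le_cur_of_full j h3 h4 h5 := by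
    rcases eq_or_ne j i with rfl | hji
    · exact le_rfl
    · rw [hE.cnt_of_ne j hji] at h5; exact hI.le_cur_of_full j h3 h4 h5
  last_le_succ j h3 h4 := by
    rw [hE.last_of_ne (by omega : j ≠ i), hE.last_of_ne (by omega : j + 1 ≠ i)]
    exact hI.last_le_succ j h3 h4
  le_last := le_last_of_extends hE hI.le_last fun _ h3 h4 => hI.last_le_last_of_le h2 h3 h4

/-- The next fence is extended and becomes the current one. -/
theorem extend_succ (hI : FenceInv k M m P i) (hE : Extends m m' P P' (i + 1)) (hik : i < k)
    (hM : m (i + 1) + 1 ≤ M) : FenceInv k M m' P' (i + 1) where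
  one_le_cur := Nat.succ_pos i
  cur_le := hik
  one_le_cnt := by rw [hE.cnt_self]; exact Nat.succ_pos _
  cnt_le j h3 h4 := by
    rcases eq_or_ne j (i + 1) with rfl | hji
    · rwa [hE.cnt_self]
    · rw [hE.cnt_of_ne j hji]; exact hI.cnt_le j h3 h4
  le_cur_of_full j h3 h4 h5 := by
    rcases eq_or_ne j (i + 1) with rfl | hji
    · exact le_rfl
    · rw [hE.cnt_of_ne j hji] at h5
      exact (hI.le_cur_of_full j h3 h4 h5).trans (Nat.le_succ i)
  last_le_succ j h3 h4 := by
    rw [hE.last_of_ne (by omega : j ≠ i + 1), hE.last_of_ne (by omega : j + 1 ≠ i + 1)]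
    exact hI.last_le_succ j (by omega) h4
  le_last := le_last_of_extends hE hI.le_last fun _ h3 h4 =>
    hI.last_le_last (Nat.lt_succ_self i) h3.le h4

end FenceInv

/-! ## The record of the subroutine calls -/

/-- Data about the calls of the subroutines `GoDown` and `GoBackDown` so far.  For a fence `j`,
`src j` and `tgt j` are the numbers of posts of the fences `j` and `j + 1` at the last call from
fence `j` to fence `j + 1`, and `tgtX j` is the abscissa of the target of that call.  All calls of
`GoBackDown` from fence `j` took place to the left of `srcX j`.  The last one that passed from fence
`j` to fence `j + 1` on its way started at a post number `chain j`, and it ended to the right of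
`chainX j`. -/
structure CallRecord where
  src : ℕ → ℕ
  tgt : ℕ → ℕ
  chain : ℕ → ℕ
  srcX : ℕ → ℝ
  tgtX : ℕ → ℝ
  chainX : ℕ → ℝ

/-- The record after a call from fence `i` to fence `i + 1` that went from fence `v` to fence `i`
on its way. -/
noncomputable def CallRecord.call (r : CallRecord) (m : ℕ → ℕ) (P : ℕ → ℕ → Pt) (v i : ℕ) :
    CallRecord where
  src := Function.update r.src i (m i)
  tgt := Function.update r.tgt i (m (i + 1))
  chain := fun j => if v ≤ j ∧ j < i then m i else r.chain j
  srcX := Function.update r.srcX i (P i (m i)).1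
  tgtX := Function.update r.tgtX i (P (i + 1) (m (i + 1))).1
  chainX := fun j => if v ≤ j ∧ j < i then (P (j + 1) (m i - 1)).1 else r.chainX j

/-- Below fence `i₁`, the `f`-th posts of the fences are not needed for an extension of fence `j`
beyond its `f`-th post. -/
def ChainDone (k : ℕ) (m : ℕ → ℕ) (P : ℕ → ℕ → Pt) (i j i₁ f : ℕ) : Prop :=
  ∀ i', i₁ < i' → i' < k → (f ≤ m i' ∨ (f = m i' + 1 ∧ i < i')) →
    (f ≤ m (i' + 1) + 1 ∨ (P j f).1 ≤ (P (i' + 1) (m (i' + 1))).1)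

/-- The properties of the record `r` of the calls when fence `i` is the current one. -/
structure CallInv (x₀ : ℝ) (k M : ℕ) (m : ℕ → ℕ) (P : ℕ → ℕ → Pt) (i : ℕ) (r : CallRecord) :
    Prop where
  src_le : ∀ j, 1 ≤ j → j < k → r.src j ≤ m j
  tgt_le : ∀ j, 1 ≤ j → j < k → r.tgt j ≤ m (j + 1)
  src_le_of_lt : ∀ j, 1 ≤ j → j < k → i < j → r.src j ≤ m (j + 1)
  src_le_of_eq : i < k → r.src i ≤ m (i + 1) ∨
    (m (i + 1) + 1 = m i ∧ (P (i + 1) (m (i + 1))).1 < (P i (m i)).1)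
  tgt_spec : ∀ j, 1 ≤ j → j < k → (r.tgt j = 0 ∧ r.tgtX j = x₀) ∨
    (1 ≤ r.tgt j ∧ r.tgtX j = (P (j + 1) (r.tgt j)).1 ∧
      (r.src j = M ∨ (1 ≤ r.src j ∧ r.tgtX j < (P j (r.src j)).1) ∨
        ∃ u, 1 ≤ u ∧ u ≤ j ∧ r.src j + 1 ≤ m u ∧ r.tgtX j < (P u (r.src j + 1)).1))
  srcX_spec : ∀ j, 1 ≤ j → j < k → r.srcX j = x₀ ∨
    (1 ≤ r.src j ∧ r.srcX j ≤ (P j (r.src j)).1)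
  chain_spec : ∀ j, 1 ≤ j → j < k → (r.chain j = 0 ∧ r.chainX j = x₀) ∨
    (2 ≤ r.chain j ∧ r.chainX j = (P (j + 1) (r.chain j - 1)).1 ∧
      r.chainX j < (P j (r.chain j)).1 ∧
      ∃ i₁, j < i₁ ∧ i₁ < k ∧ r.chain j ≤ r.src i₁ ∧ ChainDone k m P i j i₁ (r.chain j))

/-! ### Persistence of `ChainDone` under the moves of the procedure. -/

section ChainDone

variable {S : Scene} {τ L x₀ : ℝ} {k M : ℕ} {m m' : ℕ → ℕ} {P P' : ℕ → ℕ → Pt}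
  {T : ℕ → ℕ → List Pt} {i j i₁ f : ℕ}

theorem ChainDone.descend (hC : ChainDone k m P i j i₁ f) : ChainDone k m P (i + 1) j i₁ f :=
  fun i' h1 h2 h3 => hC i' h1 h2 (h3.imp id fun h => ⟨h.1, by omega⟩)

/-- Moving up adds the obligation that fence i + 1 may later receive its `f`-th post by a down-edge.
If the next fence is shorter, the failure of the fourth case, with u = j, gives the required
comparison. -/
theorem ChainDone.ascend (hC : ChainDone k m P (i + 1) j i₁ f)
    (h : FenceTree S τ L x₀ k m P T) (hI : FenceInv k M m P (i + 1)) (hj : 1 ≤ j) (hij : j < i₁)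
    (hf : 1 ≤ f) (hfj : f ≤ m i₁)
    (h4 : i + 1 < k → m (i + 1 + 1) < m (i + 1) → ∀ u, 1 ≤ u → u < i + 1 → m u = m (i + 1) + 1 →
      (P u (m u)).1 ≤ (P (i + 1 + 1) (m (i + 1 + 1))).1) : ChainDone k m P i j i₁ f := by
  rintro i' h1 h2 (h3 | ⟨h3, h5⟩)
  · exact hC i' h1 h2 (Or.inl h3)
  · rcases eq_or_ne i' (i + 1) with rfl | hne
    · rcases Nat.lt_or_ge (m (i + 1 + 1)) (m (i + 1)) with h6 | h6
      · have hjm : m i₁ ≤ m j := h.cnt_le hj hij.le (by omega)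
        have h7 : f ≤ m j := hfj.trans hjm
        rcases h7.lt_or_eq with h8 | h8
        · exact Or.inr (hI.le_last j _ f hj (by omega) h2 hf h8)
        · refine Or.inr ?_
          have := h4 h2 h6 j hj (by omega) (by omega)
          rwa [← h8] at this
      · exact Or.inl (by omega)
    · exact hC i' h1 h2 (Or.inr ⟨h3, by omega⟩)

theorem ChainDone.of_extends_of_ne {l : ℕ} (hC : ChainDone k m P i j i₁ f)
    (hE : Extends m m' P P' l) (hfj : f ≤ m j) {i' : ℕ} (h1 : i₁ < i') (h2 : i' < k)
    (h3 : f ≤ m i' ∨ (f = m i' + 1 ∧ i < i')) :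
    f ≤ m' (i' + 1) + 1 ∨ (P' j f).1 ≤ (P' (i' + 1) (m' (i' + 1))).1 := by
  rw [hE.post j f hfj]
  rcases hC i' h1 h2 h3 with h4 | h4
  · exact Or.inl (h4.trans (Nat.succ_le_succ (hE.cnt_le _)))
  · exact Or.inr (h4.trans (hE.last_mono _))

/-- The alternative f = m i' + 1 in `ChainDone` anticipates exactly this new post, so nothing new
has to be shown. -/
theorem ChainDone.extend_succ (hC : ChainDone k m P i j i₁ f) (hE : Extends m m' P P' (i + 1))
    (hfj : f ≤ m j) : ChainDone k m' P' (i + 1) j i₁ f := by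
  intro i' h1 h2 h3
  refine hC.of_extends_of_ne hE hfj h1 h2 ?_
  rcases eq_or_ne i' (i + 1) with rfl | hne
  · rw [hE.cnt_self] at h3
    omega
  · rw [hE.cnt_of_ne i' hne] at h3
    omega

/-- Only the new post being the `f`-th is not anticipated. An up-edge is allowed only if the fence
above has more than `f` posts or its `f`-th post is not to the right; either way `P j f` is not
right of the last post of the next fence. -/
theorem ChainDone.extend (hC : ChainDone k m P i j i₁ f) (hE : Extends m m' P P' i)
    (h : FenceTree S τ L x₀ k m P T) (hI : FenceInv k M m P i) (hj : 1 ≤ j) (hij : j < i₁)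
    (hf : 1 ≤ f) (hfj : f ≤ m j)
    (h2 : i < k → (P i (m i)).1 ≤ (P (i + 1) (m (i + 1))).1)
    (h3 : ∀ l, 1 ≤ l → i = l + 1 →
      m i + 1 < m l ∨ (m l = m i + 1 ∧ (P l (m l)).1 ≤ (P i (m i)).1)) :
    ChainDone k m' P' i j i₁ f := by
  intro i' h4 h5 h6
  by_cases h7 : f ≤ m i' ∨ (f = m i' + 1 ∧ i < i')
  · exact hC.of_extends_of_ne hE hfj h4 h5 h7
  · have hii : i' = i := by
      by_contra hne
      rw [hE.cnt_of_ne i' hne] at h6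
      exact h7 h6
    subst hii
    rw [hE.cnt_self] at h6
    have hfm : f = m i' + 1 := by omega
    obtain ⟨l, rfl⟩ : ∃ l, i' = l + 1 := ⟨i' - 1, by omega⟩
    right
    rw [hE.post j f hfj]
    refine le_trans ?_ (hE.last_mono _)
    have hjl : m l ≤ m j := h.cnt_le hj (by omega) (by omega)
    rcases h3 l (by omega) rfl with h8 | ⟨h8, h9⟩
    · exact hI.le_last j _ f hj (by omega) h5 hf (by omega)
    · refine le_trans ?_ (h9.trans (h2 h5))
      rw [hfm, ← h8]
      exact h.fst_mono ⟨by omega, by omega, by omega, le_rfl⟩ hj (by omega) (by omega) le_rfl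

end ChainDone

namespace CallInv

variable {S : Scene} {τ L x₀ : ℝ} {k M : ℕ} {m m' : ℕ → ℕ} {P P' : ℕ → ℕ → Pt}
  {T : ℕ → ℕ → List Pt} {i : ℕ} {r : CallRecord}

/-- The third case has failed on fence i + 1. So either it has caught up with fence `i`, or it lacks
one post and lies behind; then a down-edge, not a call, comes next. -/
theorem ascend (hR : CallInv x₀ k M m P (i + 1) r) (h : FenceTree S τ L x₀ k m P T)
    (hI : FenceInv k M m P (i + 1)) (hi : 1 ≤ i)
    (h3 : ¬ (m (i + 1) + 1 < m i ∨
      (m i = m (i + 1) + 1 ∧ (P i (m i)).1 ≤ (P (i + 1) (m (i + 1))).1)))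
    (h2 : i + 1 < k → (P (i + 1) (m (i + 1))).1 ≤ (P (i + 1 + 1) (m (i + 1 + 1))).1)
    (h4 : i + 1 < k → m (i + 1 + 1) < m (i + 1) → ∀ u, 1 ≤ u → u < i + 1 → m u = m (i + 1) + 1 →
      (P u (m u)).1 ≤ (P (i + 1 + 1) (m (i + 1 + 1))).1) : CallInv x₀ k M m P i r where
  src_le := hR.src_le
  tgt_le := hR.tgt_le
  src_le_of_lt j j1 j2 j3 := by
    rcases eq_or_ne j (i + 1) with rfl | hne
    · rcases hR.src_le_of_eq j2 with h5 | h5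
      · exact h5
      · exact absurd (h2 j2) (not_le.2 h5.2)
    · exact hR.src_le_of_lt j j1 j2 (by omega)
  src_le_of_eq hik := by
    have h5 := hR.src_le i hi hik
    push Not at h3
    rcases Nat.lt_or_ge (m (i + 1)) (m i) with h6 | h6
    · have h7 : m i = m (i + 1) + 1 := by omega
      exact Or.inr ⟨h7.symm, h3.2 h7⟩
    · exact Or.inl (by omega)
  tgt_spec := hR.tgt_spec
  srcX_spec := hR.srcX_spec
  chain_spec j j1 j2 := by
    rcases hR.chain_spec j j1 j2 with h5 | ⟨c1, c2, c3, i₁, c4, c5, c6, c7⟩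
    · exact Or.inl h5
    · exact Or.inr ⟨c1, c2, c3, i₁, c4, c5, c6, c7.ascend h hI j1 c4 (by omega)
        (c6.trans (hR.src_le i₁ (by omega) c5)) h4⟩

theorem chain_le (hR : CallInv x₀ k M m P i r) (h : FenceTree S τ L x₀ k m P T) {j i₁ : ℕ}
    (hj : 1 ≤ j) (hi₁ : j < i₁) (hk : i₁ < k) (hle : r.chain j ≤ r.src i₁) :
    r.chain j ≤ m (j + 1) :=
  hle.trans ((hR.src_le i₁ (by omega) hk).trans (h.cnt_le (by omega : 1 ≤ j + 1) hi₁ hk.le))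

theorem of_extends {l i' : ℕ} (hR : CallInv x₀ k M m P i r) (h : FenceTree S τ L x₀ k m P T)
    (hE : Extends m m' P P' l) (hii' : i ≤ i')
    (heq : i' < k → r.src i' ≤ m' (i' + 1) ∨
      (m' (i' + 1) + 1 = m' i' ∧ (P' (i' + 1) (m' (i' + 1))).1 < (P' i' (m' i')).1))
    (hchain : ∀ j i₁, 1 ≤ j → j < k → 2 ≤ r.chain j → r.chain j ≤ m j → j < i₁ →
      ChainDone k m P i j i₁ (r.chain j) → ChainDone k m' P' i' j i₁ (r.chain j)) :
    CallInv x₀ k M m' P' i' r where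
  src_le j j1 j2 := (hR.src_le j j1 j2).trans (hE.cnt_le j)
  tgt_le j j1 j2 := (hR.tgt_le j j1 j2).trans (hE.cnt_le _)
  src_le_of_lt j j1 j2 j3 := (hR.src_le_of_lt j j1 j2 (by omega)).trans (hE.cnt_le _)
  src_le_of_eq := heq
  tgt_spec j j1 j2 := by
    rcases hR.tgt_spec j j1 j2 with h1 | ⟨h1, h2, h3⟩
    · exact Or.inl h1
    · refine Or.inr ⟨h1, ?_, h3.imp id (Or.imp ?_ ?_)⟩
      · rwa [hE.post _ _ (hR.tgt_le j j1 j2)]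
      · rw [hE.post _ _ (hR.src_le j j1 j2)]; exact id
      · rintro ⟨u, u1, u2, u3, u4⟩
        exact ⟨u, u1, u2, u3.trans (hE.cnt_le u), by rwa [hE.post _ _ u3]⟩
  srcX_spec j j1 j2 := by
    rw [hE.post _ _ (hR.src_le j j1 j2)]; exact hR.srcX_spec j j1 j2
  chain_spec j j1 j2 := by
    rcases hR.chain_spec j j1 j2 with h5 | ⟨c1, c2, c3, i₁, c4, c5, c6, c7⟩
    · exact Or.inl h5
    · have h6 := hR.chain_le h j1 c4 c5 c6
      have h7 := h6.trans (h.anti j j1 j2)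
      refine Or.inr ⟨c1, ?_, ?_, i₁, c4, c5, c6, hchain j i₁ j1 j2 c1 h7 c4 c7⟩
      · rwa [hE.post _ _ ((Nat.sub_le _ _).trans h6)]
      · rwa [hE.post _ _ h7]

theorem extend (hR : CallInv x₀ k M m P i r) (h : FenceTree S τ L x₀ k m P T)
    (hI : FenceInv k M m P i) (hE : Extends m m' P P' i)
    (h2 : i < k → (P i (m i)).1 ≤ (P (i + 1) (m (i + 1))).1)
    (h3 : ∀ l, 1 ≤ l → i = l + 1 →
      m i + 1 < m l ∨ (m l = m i + 1 ∧ (P l (m l)).1 ≤ (P i (m i)).1)) :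
    CallInv x₀ k M m' P' i r := by
  refine hR.of_extends h hE le_rfl ?_ ?_
  · intro hik
    rcases hR.src_le_of_eq hik with h5 | h5
    · exact Or.inl (h5.trans (hE.cnt_le _))
    · exact absurd (h2 hik) (not_le.2 h5.2)
  · intro j i₁ j1 j2 h4 h5 h6 h7
    exact h7.extend hE h hI j1 h6 (by omega) h5 h2 h3

theorem extend_succ (hR : CallInv x₀ k M m P i r) (h : FenceTree S τ L x₀ k m P T)
    (hE : Extends m m' P P' (i + 1)) : CallInv x₀ k M m' P' (i + 1) r := by
  refine hR.of_extends h hE (Nat.le_succ i) ?_ ?_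
  · intro hik
    exact Or.inl ((hR.src_le_of_lt (i + 1) (by omega : 1 ≤ i + 1) hik (Nat.lt_succ_self i)).trans
      (hE.cnt_le _))
  · intro j i₁ j1 j2 h4 h5 h6 h7
    exact h7.extend_succ hE h5

/-! ### The situation at a call -/

/-- The exceptional alternative of `src_le_of_eq` is the situation of a new down-edge, so at a call
the next fence has reached the number of the previous source. -/
theorem src_le_of_call (hR : CallInv x₀ k M m P i r) (hik : i < k)
    (hcase : m (i + 1) + 1 < m i ∨ (P i (m i)).1 ≤ (P (i + 1) (m (i + 1))).1) :
    r.src i ≤ m (i + 1) := by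
  rcases hR.src_le_of_eq hik with h1 | ⟨h1, h2⟩
  · exact h1
  · rcases hcase with h3 | h3
    · omega
    · exact absurd h3 (not_le.2 h2)

/-- The previous target was left of a post numbered `src` or `src` + 1, on fence `i` or above. By
now `src` ≤ m (i + 1), so monotonicity of the posts applies. A full source is impossible, since the
next fence is still incomplete. -/
theorem tgtX_lt (hR : CallInv x₀ k M m P i r) (h : FenceTree S τ L x₀ k m P T)
    (hI : FenceInv k M m P i) (hik : i < k) (hsrc : r.src i ≤ m (i + 1)) (hm : m (i + 1) < m i) :
    (r.tgt i = 0 ∧ r.tgtX i = x₀) ∨ (1 ≤ r.tgt i ∧ r.tgtX i = (P (i + 1) (r.tgt i)).1 ∧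
      r.tgtX i < (P i (m (i + 1) + 1)).1) := by
  rcases hR.tgt_spec i hI.one_le_cur hik with h1 | ⟨h1, h2, h3⟩
  · exact Or.inl h1
  · refine Or.inr ⟨h1, h2, ?_⟩
    have hin : InTree k m i (m (i + 1) + 1) := ⟨hI.one_le_cur, hik.le, Nat.succ_pos _, hm⟩
    rcases h3 with h3 | ⟨h3, h4⟩ | ⟨u, u1, u2, u3, u4⟩
    · have := hI.cnt_le i hI.one_le_cur hik.le
      omega
    · exact h4.trans_le (h.fst_mono hin hI.one_le_cur le_rfl h3 (by omega))
    · exact u4.trans_le (h.fst_mono hin u1 u2 (Nat.succ_pos _) (by omega))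

theorem tgtX_le (hR : CallInv x₀ k M m P i r) (h : FenceTree S τ L x₀ k m P T)
    (hI : FenceInv k M m P i) (hik : i < k) (hsrc : r.src i ≤ m (i + 1)) (hm : m (i + 1) < m i) :
    r.tgtX i ≤ (P i (m (i + 1) + 1)).1 := by
  rcases hR.tgtX_lt h hI hik hsrc hm with ⟨_, h1⟩ | h1
  · rw [h1]
    exact h.start_le ⟨hI.one_le_cur, hik.le, Nat.succ_pos _, hm⟩
  · exact h1.2.2.le

theorem fst_lt_of_le_tgt (hR : CallInv x₀ k M m P i r) (h : FenceTree S τ L x₀ k m P T)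
    (hI : FenceInv k M m P i) (hik : i < k) (hsrc : r.src i ≤ m (i + 1)) (hm : m (i + 1) < m i)
    {p : ℕ} (hp : 1 ≤ p) (hpt : p ≤ r.tgt i) : (P (i + 1) p).1 < (P i (m (i + 1) + 1)).1 := by
  rcases hR.tgtX_lt h hI hik hsrc hm with ⟨h1, _⟩ | ⟨h1, h2, h3⟩
  · omega
  · rw [h2] at h3
    exact (h.fst_mono ⟨Nat.succ_pos i, hik, h1, hR.tgt_le i hI.one_le_cur hik⟩ (by omega : 1 ≤ i + 1)
      le_rfl hp hpt).trans_lt h3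

/-- This makes the horizontal intervals walked back in successive calls of `GoBackDown` from one
fence disjoint up to endpoints. -/
theorem srcX_le (hR : CallInv x₀ k M m P i r) (h : FenceTree S τ L x₀ k m P T)
    (hI : FenceInv k M m P i) (hik : i < k) (hsrc : r.src i ≤ m (i + 1)) (hm : 1 ≤ m (i + 1)) :
    r.srcX i ≤ (P (i + 1) (m (i + 1))).1 := by
  have hin : InTree k m (i + 1) (m (i + 1)) := ⟨Nat.succ_pos i, hik, hm, le_rfl⟩
  rcases hR.srcX_spec i hI.one_le_cur hik with h1 | ⟨h1, h2⟩
  · rw [h1]; exact h.start_le hin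
  · exact h2.trans (h.fst_mono hin hI.one_le_cur (Nat.le_succ i) h1 hsrc)

/-- A larger number would make `P j (m i)` a non-last post, contradicting `hX`. For an equal number,
a previous call from fence `i` or below would have required that fence i + 1 has caught up, and one
from a fence above `i` is excluded by `ChainDone`. -/
theorem chain_lt (hR : CallInv x₀ k M m P i r) (h : FenceTree S τ L x₀ k m P T)
    (hI : FenceInv k M m P i) (hik : i < k) (hm : m (i + 1) + 1 < m i) {j : ℕ} (hj : 1 ≤ j)
    (hji : j < i) (hX : (P (i + 1) (m (i + 1))).1 < (P j (m i)).1) : r.chain j < m i := by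
  rcases hR.chain_spec j hj (by omega) with ⟨h1, _⟩ | ⟨c1, c2, c3, i₁, c4, c5, c6, c7⟩
  · omega
  · by_contra hcon
    push Not at hcon
    have h5 := (hR.chain_le h hj c4 c5 c6).trans (h.anti j hj (by omega))
    have h6 : r.chain j = m i := by
      refine le_antisymm ?_ hcon
      by_contra hlt
      exact absurd (hI.le_last j (i + 1) (m i) hj (by omega) hik hI.one_le_cnt (by omega))
        (not_le.2 hX)
    have h7 := hR.src_le i₁ (by omega) c5
    rcases lt_trichotomy i i₁ with h8 | rfl | h8
    · have h9 := h.cnt_le hI.one_le_cur h8.le c5.le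
      have h10 := hR.src_le_of_lt i₁ (by omega) c5 h8
      have h11 := h.cnt_le (by omega : 1 ≤ i + 1) (by omega : i + 1 ≤ i₁) c5.le
      omega
    · have := hR.src_le_of_call c5 (Or.inl hm)
      omega
    · rcases c7 i h8 hik (Or.inl h6.le) with h9 | h9
      · omega
      · rw [h6] at h9
        exact absurd h9 (not_le.2 hX)

theorem fst_lt_of_lt_chain (hR : CallInv x₀ k M m P i r) (h : FenceTree S τ L x₀ k m P T)
    {j : ℕ} (hj : 1 ≤ j) (hji : j < k) {μ : ℕ} (hμ : InTree k m j μ) (hc : r.chain j ≤ μ)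
    {p : ℕ} (hp : 1 ≤ p) (hpc : p ≤ r.chain j - 1) : (P (j + 1) p).1 < (P j μ).1 := by
  rcases hR.chain_spec j hj hji with ⟨h1, _⟩ | ⟨c1, c2, c3, i₁, c4, c5, c6, c7⟩
  · omega
  · rw [c2] at c3
    have h5 := hR.chain_le h hj c4 c5 c6
    exact (h.fst_mono (j := j + 1) ⟨by omega, hji, by omega, by omega⟩ (by omega : 1 ≤ j + 1) le_rfl hp
      hpc).trans_lt (c3.trans_le (h.fst_mono hμ hj le_rfl (by omega) hc))

theorem chainX_le (hR : CallInv x₀ k M m P i r) (h : FenceTree S τ L x₀ k m P T)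
    {j : ℕ} (hj : 1 ≤ j) (hji : j < k) {μ : ℕ} (hμ : InTree k m j μ) (hc : r.chain j ≤ μ) :
    r.chainX j ≤ (P j μ).1 := by
  rcases hR.chain_spec j hj hji with ⟨_, h1⟩ | ⟨c1, c2, c3, _⟩
  · rw [h1]; exact h.start_le hμ
  · exact c3.le.trans (h.fst_mono hμ hj le_rfl (by omega) hc)

theorem call (hR : CallInv x₀ k M m P i r) (h : FenceTree S τ L x₀ k m P T)
    (hI : FenceInv k M m P i) (hik : i < k) (hm : m (i + 1) < m i) (hm1 : 1 ≤ m (i + 1))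
    (hsrc : r.src i ≤ m (i + 1))
    (hnew : m i = M ∨ (P (i + 1) (m (i + 1))).1 < (P i (m i)).1 ∨
      ∃ u, 1 ≤ u ∧ u ≤ i ∧ m i + 1 ≤ m u ∧ (P (i + 1) (m (i + 1))).1 < (P u (m i + 1)).1)
    {v : ℕ} (hv : v < i → m (i + 1) + 1 < m i ∧
      ∀ j, v ≤ j → j < i → (P (i + 1) (m (i + 1))).1 < (P j (m i)).1) :
    CallInv x₀ k M m P (i + 1) (r.call m P v i) := by
  have hi := hI.one_le_cur
  have hsrc_ne : ∀ j, j ≠ i → (r.call m P v i).src j = r.src j := fun j hne => by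
    simp [CallRecord.call, hne]
  have hsrc_self : (r.call m P v i).src i = m i := by simp [CallRecord.call]
  have hsrc_le' : ∀ j, r.src j ≤ (r.call m P v i).src j := fun j => by
    rcases eq_or_ne j i with rfl | hne
    · rw [hsrc_self]; omega
    · rw [hsrc_ne j hne]
  refine ⟨?_, ?_, ?_, ?_, ?_, ?_, ?_⟩
  · intro j j1 j2
    rcases eq_or_ne j i with rfl | hne
    · rw [hsrc_self]
    · rw [hsrc_ne j hne]; exact hR.src_le j j1 j2
  · intro j j1 j2
    rcases eq_or_ne j i with rfl | hne
    · simp [CallRecord.call]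
    · simpa [CallRecord.call, hne] using hR.tgt_le j j1 j2
  · intro j j1 j2 j3
    rw [hsrc_ne j (by omega)]
    exact hR.src_le_of_lt j j1 j2 (by omega)
  · intro j2
    rw [hsrc_ne _ (by omega)]
    exact Or.inl (hR.src_le_of_lt _ (by omega : 1 ≤ i + 1) j2 (Nat.lt_succ_self i))
  · intro j j1 j2
    rcases eq_or_ne j i with rfl | hne
    · right
      simp only [CallRecord.call, Function.update_self]
      exact ⟨hm1, trivial, hnew.imp id (Or.imp (fun h => ⟨hI.one_le_cnt, h⟩) id)⟩
    · simpa only [CallRecord.call, Function.update_of_ne hne] using hR.tgt_spec j j1 j2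
  · intro j j1 j2
    rcases eq_or_ne j i with rfl | hne
    · right
      simp only [CallRecord.call, Function.update_self]
      exact ⟨hI.one_le_cnt, le_rfl⟩
    · simpa only [CallRecord.call, Function.update_of_ne hne] using hR.srcX_spec j j1 j2
  · intro j j1 j2
    by_cases hj : v ≤ j ∧ j < i
    · right
      have h1 : (r.call m P v i).chain j = m i := by simp [CallRecord.call, hj]
      have h2 : (r.call m P v i).chainX j = (P (j + 1) (m i - 1)).1 := by
        simp [CallRecord.call, hj]
      obtain ⟨h3, h4⟩ := hv (by omega)
      rw [h1, h2]
      refine ⟨by omega, rfl, ?_, i, hj.2, hik, by rw [hsrc_self], ?_⟩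
      -- The last but one post of fence `i` separates the two: it is right of the post with its
      -- number on fence j + 1, and not right of the last post of fence i + 1.
      · refine lt_of_le_of_lt ?_ (h4 j hj.1 hj.2)
        exact (h.fst_mono (i := j + 1) (j := i) (p := m i - 1) (q := m i - 1)
          ⟨hi, hik.le, by omega, by omega⟩ (by omega : 1 ≤ j + 1) hj.2 (by omega) le_rfl).trans
          (hI.le_last i (i + 1) _ hi (Nat.lt_succ_self i) hik (by omega) (by omega))
      -- Right after the call the claim is vacuous: lower fences have at least two posts fewer than
      -- fence `i`.
      · intro i' i1 i2 i3
        have := h.cnt_le (by omega : 1 ≤ i + 1) (by omega : i + 1 ≤ i') i2.le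
        omega
    · have h1 : (r.call m P v i).chain j = r.chain j := by simp only [CallRecord.call, hj, if_false]
      have h2 : (r.call m P v i).chainX j = r.chainX j := by
        simp only [CallRecord.call, hj, if_false]
      rw [h1, h2]
      rcases hR.chain_spec j j1 j2 with h5 | ⟨c1, c2, c3, i₁, c4, c5, c6, c7⟩
      · exact Or.inl h5
      · exact Or.inr ⟨c1, c2, c3, i₁, c4, c5, c6.trans (hsrc_le' i₁), c7.descend⟩

end CallInv

/-! ## The potential -/

/-- The share of the fence `j` in the bound for the length of the edges. -/
noncomputable def fenceCost (τ x₀ : ℝ) (m : ℕ → ℕ) (P : ℕ → ℕ → Pt) (j : ℕ) : ℝ :=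
  m j * τ + 3 * τ * (max x₀ (P j (m j)).1 - x₀)

/-- The share of the fence `j` in the bound for the length of the paths walked in subroutines. -/
noncomputable def callCost (τ x₀ : ℝ) (r : CallRecord) (j : ℕ) : ℝ :=
  (5 / 2 * r.src j + 2 * r.tgt j) * τ + 5 * τ * (r.tgtX j - x₀) + 3 * τ * (r.srcX j - x₀) +
    4 * r.chain j * τ + 4 * τ * (r.chainX j - x₀)

/-- The potential that bounds the distance walked, not counting the returns. -/
noncomputable def totalCost (τ x₀ : ℝ) (k : ℕ) (m : ℕ → ℕ) (P : ℕ → ℕ → Pt) (r : CallRecord) : ℝ :=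
  ∑ j ∈ Finset.Icc 1 k, fenceCost τ x₀ m P j + ∑ j ∈ Finset.Ico 1 k, callCost τ x₀ r j

/-- The abscissa `x` is that of the source of the new edge, which for a down-edge lies beyond the
last post of fence `j`. The maximum in `fenceCost` covers a fence that is still empty. -/
theorem totalCost_extends {τ x₀ : ℝ} (hτ : 0 < τ) {k : ℕ} {m m' : ℕ → ℕ} {P P' : ℕ → ℕ → Pt} {j : ℕ}
    (hE : Extends m m' P P' j) (hj : 1 ≤ j) (hjk : j ≤ k) {x : ℝ} (hx : x₀ ≤ x)
    (hx' : (P j (m j)).1 ≤ x) (r : CallRecord) :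
    totalCost τ x₀ k m P r + (τ + 3 * τ * ((P' j (m j + 1)).1 - x)) ≤
      totalCost τ x₀ k m' P' r := by
  have hle : ∀ l ∈ Finset.Icc 1 k, fenceCost τ x₀ m P l +
      (if l = j then τ + 3 * τ * ((P' j (m j + 1)).1 - x) else 0) ≤ fenceCost τ x₀ m' P' l := by
    intro l _
    split_ifs with h
    · subst h
      rw [fenceCost, fenceCost, hE.cnt_self]
      have h1 : max x₀ (P l (m l)).1 ≤ x := max_le hx hx'
      have h2 := le_max_right x₀ (P' l (m l + 1)).1
      have h3 : 3 * τ * (max x₀ (P l (m l)).1 + (P' l (m l + 1)).1) ≤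
          3 * τ * (max x₀ (P' l (m l + 1)).1 + x) :=
        mul_le_mul_of_nonneg_left (by linarith) (by linarith)
      push_cast
      linarith
    · rw [fenceCost, fenceCost, hE.last_of_ne h, hE.cnt_of_ne l h, add_zero]
  have hsum := Finset.sum_le_sum hle
  rw [Finset.sum_add_distrib, Finset.sum_ite_eq', if_pos (Finset.mem_Icc.2 ⟨hj, hjk⟩)] at hsum
  rw [totalCost, totalCost]
  linarith

theorem totalCost_call {τ x₀ : ℝ} {k : ℕ} {m : ℕ → ℕ} {P : ℕ → ℕ → Pt} {i v : ℕ} (hi : 1 ≤ i)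
    (hik : i < k) (hv : 1 ≤ v) (r : CallRecord) :
    totalCost τ x₀ k m P (r.call m P v i) = totalCost τ x₀ k m P r +
      ((5 / 2 * ((m i : ℝ) - r.src i) + 2 * ((m (i + 1) : ℝ) - r.tgt i)) * τ +
        5 * τ * ((P (i + 1) (m (i + 1))).1 - r.tgtX i) + 3 * τ * ((P i (m i)).1 - r.srcX i)) +
      ∑ j ∈ Finset.Ico v i, (4 * τ * ((P (j + 1) (m i - 1)).1 - r.chainX j) +
        4 * ((m i : ℝ) - r.chain j) * τ) := by
  have hterm : ∀ j, callCost τ x₀ (r.call m P v i) j = callCost τ x₀ r j +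
      (if j = i then
        (5 / 2 * ((m i : ℝ) - r.src i) + 2 * ((m (i + 1) : ℝ) - r.tgt i)) * τ +
          5 * τ * ((P (i + 1) (m (i + 1))).1 - r.tgtX i) + 3 * τ * ((P i (m i)).1 - r.srcX i)
        else 0) +
      (if v ≤ j ∧ j < i then (4 * τ * ((P (j + 1) (m i - 1)).1 - r.chainX j) +
        4 * ((m i : ℝ) - r.chain j) * τ) else 0) := by
    intro j
    rcases eq_or_ne j i with rfl | hne
    · have h1 : ¬ (v ≤ j ∧ j < j) := fun h => lt_irrefl _ h.2
      simp only [callCost, CallRecord.call, Function.update_self, h1, if_true, if_false]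
      ring
    · simp only [callCost, CallRecord.call, Function.update_of_ne hne, hne, if_false]
      split_ifs <;> ring
  have hfilter : (Finset.Ico 1 k).filter (fun j => v ≤ j ∧ j < i) = Finset.Ico v i := by
    ext j
    simp only [Finset.mem_filter, Finset.mem_Ico]
    omega
  rw [totalCost, totalCost, Finset.sum_congr rfl fun j _ => hterm j, Finset.sum_add_distrib,
    Finset.sum_add_distrib, Finset.sum_ite_eq', if_pos (Finset.mem_Ico.2 ⟨hi, hik⟩),
    ← Finset.sum_filter, hfilter]
  ring

/-- The constants add up as 1 + 5/2 + 2 + 4 = 19/2 for the counters and 3 + 5 + 3 + 4 = 15 for the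
abscissae. -/
theorem totalCost_le {S : Scene} {τ L x₀ : ℝ} {k M : ℕ} {m : ℕ → ℕ} {P : ℕ → ℕ → Pt}
    {T : ℕ → ℕ → List Pt} {i : ℕ} {r : CallRecord} (hR : CallInv x₀ k M m P i r)
    (h : FenceTree S τ L x₀ k m P T) (hI : FenceInv k M m P i) {x : ℝ}
    (hx : ∀ j p, InTree k m j p → (P j p).1 ≤ x) :
    totalCost τ x₀ k m P r ≤ k * (19 / 2 * (M * τ) + 15 * τ * (x - x₀)) := by
  have hτ := h.tau_pos
  have hk : 1 ≤ k := hI.one_le_cur.trans hI.cur_le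
  have hx₀ : x₀ ≤ x := (h.start_le hI.inTree_cur).trans (hx _ _ hI.inTree_cur)
  have hfence : ∀ j ∈ Finset.Icc 1 k, fenceCost τ x₀ m P j ≤ M * τ + 3 * τ * (x - x₀) := by
    intro j hj
    rw [Finset.mem_Icc] at hj
    have h1 : (m j : ℝ) ≤ M := by exact_mod_cast hI.cnt_le j hj.1 hj.2
    have h2 : max x₀ (P j (m j)).1 ≤ x := by
      refine max_le hx₀ ?_
      rcases Nat.eq_zero_or_pos (m j) with h3 | h3
      · rw [h3, h.post_zero]
        exact h.start_pos.le.trans hx₀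
      · exact hx j _ ⟨hj.1, hj.2, h3, le_rfl⟩
    rw [fenceCost]
    gcongr
  have hcall : ∀ j ∈ Finset.Ico 1 k,
      callCost τ x₀ r j ≤ 17 / 2 * (M * τ) + 12 * τ * (x - x₀) := by
    intro j hj
    rw [Finset.mem_Ico] at hj
    have hin : ∀ j p, 1 ≤ j → j ≤ k → p ≤ m j → 1 ≤ p → (P j p).1 ≤ x :=
      fun j p h1 h2 h3 h4 => hx j p ⟨h1, h2, h4, h3⟩
    have hs := hR.src_le j hj.1 hj.2
    have ht := hR.tgt_le j hj.1 hj.2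
    have hm := hI.cnt_le j hj.1 hj.2.le
    have hm' := hI.cnt_le (j + 1) (by omega) hj.2
    have h1 : (r.src j : ℝ) ≤ M := by exact_mod_cast hs.trans hm
    have h2 : (r.tgt j : ℝ) ≤ M := by exact_mod_cast ht.trans hm'
    have h3 : r.tgtX j ≤ x := by
      rcases hR.tgt_spec j hj.1 hj.2 with ⟨_, h3⟩ | ⟨h3, h4, _⟩
      · rwa [h3]
      · rw [h4]; exact hin _ _ (by omega) hj.2 ht h3
    have h4 : r.srcX j ≤ x := by
      rcases hR.srcX_spec j hj.1 hj.2 with h3 | ⟨h3, h4⟩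
      · rwa [h3]
      · exact h4.trans (hin _ _ hj.1 hj.2.le hs h3)
    have h5 : (r.chain j : ℝ) ≤ M ∧ r.chainX j ≤ x := by
      rcases hR.chain_spec j hj.1 hj.2 with ⟨h3, h4⟩ | ⟨c1, c2, c3, i₁, c4, c5, c6, c7⟩
      · rw [h3, h4]
        exact ⟨by simp, hx₀⟩
      · have h6 := hR.chain_le h hj.1 c4 c5 c6
        refine ⟨by exact_mod_cast h6.trans hm', ?_⟩
        rw [c2]; exact hin _ _ (by omega) hj.2 ((Nat.sub_le _ _).trans h6) (by omega)
    have e1 : (5 / 2 * (r.src j : ℝ) + 2 * r.tgt j) * τ ≤ (5 / 2 * M + 2 * M) * τ := by gcongr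
    have e2 : 5 * τ * (r.tgtX j - x₀) ≤ 5 * τ * (x - x₀) := by gcongr
    have e3 : 3 * τ * (r.srcX j - x₀) ≤ 3 * τ * (x - x₀) := by gcongr
    have e4 : 4 * (r.chain j : ℝ) * τ ≤ 4 * M * τ := by gcongr; exact_mod_cast h5.1
    have e5 : 4 * τ * (r.chainX j - x₀) ≤ 4 * τ * (x - x₀) := by gcongr; exact h5.2
    rw [callCost]
    linarith
  have s1 := Finset.sum_le_card_nsmul _ _ _ hfence
  have s2 := Finset.sum_le_card_nsmul _ _ _ hcall
  rw [Nat.card_Icc, nsmul_eq_mul, Nat.add_sub_cancel] at s1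
  rw [Nat.card_Ico, nsmul_eq_mul, Nat.cast_sub hk] at s2
  have h6 : 0 ≤ 17 / 2 * (M * τ) + 12 * τ * (x - x₀) := by
    have : 0 ≤ x - x₀ := by linarith
    positivity
  rw [totalCost]
  push_cast at s2
  linarith

/-! ## The invariant of the procedure -/

/-- The invariant of `FindFenceTree`, as long as it runs. -/
structure StateInv (S : Scene) (τ L x₀ : ℝ) (k M : ℕ) (s : RobotState) : Prop where
  running : s.halted = false
  tree : FenceTree S τ L x₀ k s.cnt s.post s.treePath
  fence : FenceInv k M s.cnt s.post s.cur
  pos : s.pos = s.post s.cur (s.cnt s.cur)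
  lastPath : ∀ j, 1 ≤ j → j ≤ s.cur → (s.lastPath j).getLast? = some (s.post j (s.cnt j))
  cost : ∃ r, CallInv x₀ k M s.cnt s.post s.cur r ∧
    s.dist + ∑ j ∈ Finset.Icc 2 s.cur, pathLen (s.lastPath j) ≤
      2 * totalCost τ x₀ k s.cnt s.post r

section Calls

variable {S : Scene} {τ L x₀ : ℝ} {k M : ℕ} {s : RobotState}

theorem StateInv.dist_le (h : StateInv S τ L x₀ k M s) {x : ℝ}
    (hx : ∀ j p, InTree k s.cnt j p → (s.post j p).1 ≤ x) :
    s.dist ≤ k * (19 * (M * τ) + 30 * τ * (x - x₀)) := by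
  obtain ⟨r, hr, hc⟩ := h.cost
  have h1 := totalCost_le hr h.tree h.fence hx
  have h2 : 0 ≤ ∑ j ∈ Finset.Icc 2 s.cur, pathLen (s.lastPath j) :=
    Finset.sum_nonneg fun j _ => pathLen_nonneg _
  linarith

/-- The length of the path walked in `GoDown`, when it is called by the procedure. -/
theorem GoDown.pathLen_le_totalCost (h : FenceTree S τ L x₀ k s.cnt s.post s.treePath)
    (hI : FenceInv k M s.cnt s.post s.cur) {r : CallRecord}
    (hR : CallInv x₀ k M s.cnt s.post s.cur r) (hik : s.cur < k)
    (h2 : (s.post s.cur (s.cnt s.cur)).1 ≤ (s.post (s.cur + 1) (s.cnt (s.cur + 1))).1)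
    (hm : s.cnt (s.cur + 1) < s.cnt s.cur) {π : List Pt}
    (hgo : GoDown S τ s s.cur (s.cnt (s.cur + 1)) (s.post s.cur (s.cnt s.cur)) π) :
    π.getLast? = some (s.post (s.cur + 1) (s.cnt (s.cur + 1))) ∧
      totalCost τ x₀ k s.cnt s.post r + pathLen π ≤
        totalCost τ x₀ k s.cnt s.post (r.call s.cnt s.post s.cur s.cur) := by
  have hτ := h.one_le_tau
  have hsrc := hR.src_le_of_call hik (Or.inr h2)
  have hm1 := h.one_le_cnt_of_start_le ((h.start_le hI.inTree_cur).trans h2)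
  obtain ⟨g1, g2, g3⟩ := hgo.spec h hI.one_le_cur ⟨by omega, hik, hm1, le_rfl⟩ hI.inTree_cur hm le_rfl
    h2 rfl (fun p hp hpg => hR.fst_lt_of_le_tgt h hI hik hsrc hm hp hpg)
  refine ⟨g2, ?_⟩
  rw [totalCost_call hI.one_le_cur hik hI.one_le_cur, Finset.Ico_self, Finset.sum_empty, add_zero]
  have a1 := hR.tgtX_le h hI hik hsrc hm
  have a3 : r.srcX s.cur ≤ (s.post s.cur (s.cnt s.cur)).1 := by
    rcases hR.srcX_spec _ hI.one_le_cur hik with h3 | ⟨h3, h4⟩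
    · rw [h3]; exact h.start_le hI.inTree_cur
    · exact h4.trans (h.fst_mono hI.inTree_cur hI.one_le_cur le_rfl h3
        (hR.src_le _ hI.one_le_cur hik))
  have a4 : (s.post s.cur (s.cnt (s.cur + 1) + 1)).1 ≤
      (s.post (s.cur + 1) (s.cnt (s.cur + 1))).1 :=
    (h.fst_mono hI.inTree_cur hI.one_le_cur le_rfl (by omega) hm).trans h2
  have b1 : (r.src s.cur : ℝ) ≤ s.cnt (s.cur + 1) := by exact_mod_cast hsrc
  have b2 : (s.cnt (s.cur + 1) : ℝ) + 1 ≤ s.cnt s.cur := by exact_mod_cast hm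
  have c1 : (2 + 2 * τ) * ((s.post (s.cur + 1) (s.cnt (s.cur + 1))).1 -
      (s.post s.cur (s.cnt (s.cur + 1) + 1)).1) ≤
      5 * τ * ((s.post (s.cur + 1) (s.cnt (s.cur + 1))).1 - r.tgtX s.cur) :=
    mul_le_mul (by linarith) (by linarith) (by linarith) (by linarith)
  have c2 : 0 ≤ 3 * τ * ((s.post s.cur (s.cnt s.cur)).1 - r.srcX s.cur) :=
    mul_nonneg (by linarith) (by linarith)
  -- With d = M_i − M_{i+1} ≥ 1, the vertical cost d + 1 is at most 5d/2.
  have c3 : ((s.cnt s.cur : ℝ) - s.cnt (s.cur + 1) + 1 +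
      2 * ((s.cnt (s.cur + 1) : ℝ) - r.tgt s.cur)) * τ ≤
      (5 / 2 * ((s.cnt s.cur : ℝ) - r.src s.cur) +
        2 * ((s.cnt (s.cur + 1) : ℝ) - r.tgt s.cur)) * τ :=
    mul_le_mul_of_nonneg_right (by linarith) (by linarith)
  linarith

/-- The length of the path walked in `GoBackDown`, when it is called by the procedure. -/
theorem GoBackDown.exists_pathLen_le_totalCost (h : FenceTree S τ L x₀ k s.cnt s.post s.treePath)
    (hI : FenceInv k M s.cnt s.post s.cur) {r : CallRecord}
    (hR : CallInv x₀ k M s.cnt s.post s.cur r) (hik : s.cur < k)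
    (h2 : (s.post (s.cur + 1) (s.cnt (s.cur + 1))).1 < (s.post s.cur (s.cnt s.cur)).1)
    (hm : s.cnt (s.cur + 1) + 1 < s.cnt s.cur) {π : List Pt}
    (hgo : GoBackDown S τ s s.cur (s.cnt s.cur) (s.cnt (s.cur + 1)) π) :
    1 ≤ s.cnt (s.cur + 1) ∧ π.getLast? = some (s.post (s.cur + 1) (s.cnt (s.cur + 1))) ∧
      ∃ v, 1 ≤ v ∧ CallInv x₀ k M s.cnt s.post (s.cur + 1) (r.call s.cnt s.post v s.cur) ∧
      totalCost τ x₀ k s.cnt s.post r + pathLen π ≤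
        totalCost τ x₀ k s.cnt s.post (r.call s.cnt s.post v s.cur) := by
  have hτ := h.one_le_tau
  have hi := hI.one_le_cur
  have hsrc := hR.src_le_of_call hik (Or.inl hm)
  obtain ⟨μ, hμ⟩ : ∃ μ, s.cnt s.cur = μ + 1 := ⟨s.cnt s.cur - 1, by omega⟩
  have hcμ : (s.post s.cur μ).1 ≤ (s.post (s.cur + 1) (s.cnt (s.cur + 1))).1 :=
    hI.le_last _ _ μ hi (Nat.lt_succ_self _) hik (by omega) (by omega)
  have him : InTree k s.cnt s.cur μ := ⟨hi, hik.le, by omega, by omega⟩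
  have hm1 := h.one_le_cnt_of_start_le ((h.start_le him).trans hcμ)
  have hq : InTree k s.cnt (s.cur + 1) (s.cnt (s.cur + 1)) := ⟨by omega, hik, hm1, le_rfl⟩
  have hin := hI.inTree_cur
  have hjin : ∀ j, 1 ≤ j → j < s.cur → InTree k s.cnt j μ := fun j j1 j2 =>
    h.inTree_of_le him j1 j2.le (by omega) le_rfl
  have hchain : ∀ j, 1 ≤ j → j < s.cur →
      (s.post (s.cur + 1) (s.cnt (s.cur + 1))).1 < (s.post j (s.cnt s.cur)).1 →
      r.chain j < s.cnt s.cur := fun j j1 j2 => hR.chain_lt h hI hik hm j1 j2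
  have hgo' := hgo
  have h2' := h2
  have hin' := hin
  rw [hμ] at hgo' h2' hin'
  obtain ⟨g1, g2, v, v1, v2, v3, g3⟩ := hgo'.spec h hi hq hin' (by omega) hcμ h2'
    (fun p hp hpg => hR.fst_lt_of_le_tgt h hI hik hsrc (by omega) hp hpg)
    -- The posts before number `chain j` of fence j + 1 are left of `P j μ`. The default 0 occurs
    -- only for fences the chain does not cross, by `hchain`.
    (g' := fun j => if r.chain j < s.cnt s.cur then r.chain j - 1 else 0)
    (fun j j1 j2 => by split_ifs <;> omega)
    (fun j j1 j2 j3 p hp hpg => by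
      rw [← hμ] at j3
      have j4 := hchain j j1 j2 j3
      rw [if_pos j4] at hpg
      exact hR.fst_lt_of_lt_chain h j1 (by omega) (hjin j j1 j2) (by omega) hp hpg)
  refine ⟨hm1, g2, v, v1, hR.call h hI hik (by omega) hm1 hsrc (Or.inr (Or.inl h2))
    (fun _ => ⟨hm, fun j j1 j2 => by rw [hμ]; exact v3 j j1 j2.le⟩), ?_⟩
  rw [totalCost_call hi hik v1]
  have a1 := hR.tgtX_le h hI hik hsrc (by omega)
  have a2 := hR.srcX_le h hI hik hsrc hm1
  have b1 : (r.src s.cur : ℝ) ≤ s.cnt (s.cur + 1) := by exact_mod_cast hsrc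
  have b2 : (s.cnt (s.cur + 1) : ℝ) + 1 ≤ μ := by exact_mod_cast (by omega : _ + 1 ≤ μ)
  have hμR : (s.cnt s.cur : ℝ) = μ + 1 := by rw [hμ]; push_cast; ring
  have c1 : 5 * τ * ((s.post (s.cur + 1) (s.cnt (s.cur + 1))).1 -
      (s.post s.cur (s.cnt (s.cur + 1) + 1)).1) ≤
      5 * τ * ((s.post (s.cur + 1) (s.cnt (s.cur + 1))).1 - r.tgtX s.cur) :=
    mul_le_mul_of_nonneg_left (by linarith) (by linarith)
  have c2 : 3 * τ * ((s.post s.cur (s.cnt s.cur)).1 -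
      (s.post (s.cur + 1) (s.cnt (s.cur + 1))).1) ≤
      3 * τ * ((s.post s.cur (s.cnt s.cur)).1 - r.srcX s.cur) :=
    mul_le_mul_of_nonneg_left (by linarith) (by linarith)
  -- Here d = M_i − M_{i+1} ≥ 2, so d + 3 ≤ 5d/2; equality at d = 2 dictates the coefficient of
  -- `src`.
  have c3 : (((μ : ℝ) + 1 - s.cnt (s.cur + 1)) + 3 +
      2 * ((s.cnt (s.cur + 1) : ℝ) - r.tgt s.cur)) * τ ≤
      (5 / 2 * ((s.cnt s.cur : ℝ) - r.src s.cur) +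
        2 * ((s.cnt (s.cur + 1) : ℝ) - r.tgt s.cur)) * τ :=
    mul_le_mul_of_nonneg_right (by linarith) (by linarith)
  have c4 : ∑ j ∈ Finset.Ico v s.cur, (4 * τ * ((s.post (j + 1) μ).1 - (s.post j μ).1) +
      4 * ((μ : ℝ) - (if r.chain j < s.cnt s.cur then r.chain j - 1 else 0 : ℕ)) * τ) ≤
      ∑ j ∈ Finset.Ico v s.cur, (4 * τ * ((s.post (j + 1) (s.cnt s.cur - 1)).1 - r.chainX j) +
        4 * ((s.cnt s.cur : ℝ) - r.chain j) * τ) := by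
    apply Finset.sum_le_sum
    intro j hj
    rw [Finset.mem_Ico] at hj
    have j4 := hchain j (by omega) hj.2 (by rw [hμ]; exact v3 j hj.1 hj.2.le)
    rw [if_pos j4, show s.cnt s.cur - 1 = μ by omega, hμR]
    have j5 := hR.chainX_le h (by omega) (by omega) (hjin j (by omega) hj.2)
      (by omega : r.chain j ≤ μ)
    have j6 : (r.chain j : ℝ) ≤ (r.chain j - 1 : ℕ) + 1 := by
      exact_mod_cast (by omega : r.chain j ≤ r.chain j - 1 + 1)
    have e1 : 4 * τ * ((s.post (j + 1) μ).1 - (s.post j μ).1) ≤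
        4 * τ * ((s.post (j + 1) μ).1 - r.chainX j) :=
      mul_le_mul_of_nonneg_left (by linarith) (by linarith)
    have e2 : 4 * ((μ : ℝ) - (r.chain j - 1 : ℕ)) * τ ≤ 4 * ((μ : ℝ) + 1 - r.chain j) * τ :=
      mul_le_mul_of_nonneg_right (by linarith) (by linarith)
    linarith
  rw [← hμ] at g3
  linarith

end Calls

/-! ## The steps of the procedure -/

section Steps

variable {S : Scene} {τ L x₀ : ℝ} {k M : ℕ} {s s' : RobotState}

theorem exists_tauPath_of_post {p : Pt} (hp : IsPost S τ p) (hn : p.1 < S.n) {y : ℝ}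
    (hy : |y - p.2| ≤ τ) : ∃ q π, TauPath S τ (p.1, y) q π := by
  have hfree := hp.free (z := (p.1, y)) rfl hy
  obtain ⟨R, hR, h1, h2, h3⟩ := hp
  rw [← h1] at hfree ⊢
  exact exists_tauPath (by rw [h1]; exact hn.le) hfree

theorem TauPath.pathLen_cons_le (hτ : 0 < τ) {p q : Pt} {y : ℝ} {π : List Pt}
    (h : TauPath S τ (p.1, y) q π) (hp : p.1 ≤ S.n) (hy : |p.2 - y| = τ) :
    pathLen (p :: π) ≤ 2 * τ + (1 + 2 * τ) * (q.1 - p.1) := by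
  have h1 := (h.pathLen_le hτ hp).1
  obtain ⟨t, rfl⟩ := eq_cons_of_head? (h.spec hp).1
  rw [pathLen_cons_cons, sub_self, abs_zero, abs_sub_comm, hy]
  simp only at h1
  linarith

theorem StateInv.exists_tauPath (h : StateInv S τ L x₀ k M s) {y : ℝ} (hy : |y - s.pos.2| ≤ τ) :
    ∃ q π, TauPath S τ (s.pos.1, y) q π ∧ q.1 ≤ S.n := by
  have hin := h.fence.inTree_cur
  rw [h.pos] at hy ⊢
  have hn := h.tree.lt_wall _ _ hin
  obtain ⟨q, π, hq⟩ := exists_tauPath_of_post (h.tree.post _ _ hin) hn hy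
  exact ⟨q, π, hq, (hq.spec hn.le).2.2.2.1⟩

/-- The procedure does not get stuck. -/
theorem StateInv.exists_step (h : StateInv S τ L x₀ k M s) :
    ∃ s', FindFenceTreeStep S τ k M s s' := by
  have hτ := h.tree.tau_pos
  have hin := h.fence.inTree_cur
  have hi := h.fence.one_le_cur
  by_cases h1 : Case1 k s
  · obtain ⟨c1, c2, c3⟩ := id h1
    obtain ⟨μ, hμ⟩ : ∃ μ, s.cnt s.cur = μ + 1 := ⟨s.cnt s.cur - 1, by omega⟩
    have hcμ : (s.post s.cur μ).1 ≤ (s.post (s.cur + 1) (s.cnt (s.cur + 1))).1 :=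
      h.fence.le_last _ _ μ hi (Nat.lt_succ_self _) c1 (by omega) (by omega)
    have him : InTree k s.cnt s.cur μ := ⟨hi, c1.le, by omega, by omega⟩
    have hm1 := h.tree.one_le_cnt_of_start_le ((h.tree.start_le him).trans hcμ)
    have c2' : (s.post (s.cur + 1) (s.cnt (s.cur + 1))).1 < (s.post s.cur (s.cnt s.cur)).1 := c2
    rw [hμ] at hin c2'
    obtain ⟨π, hπ⟩ := exists_goBackDown h.tree hi ⟨by omega, c1, hm1, le_rfl⟩ hin (by omega)
      hcμ c2'
    rw [← hμ] at hπ
    exact ⟨_, .case1 s π h.running h1 hπ⟩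
  by_cases h2 : Case2 k s
  · obtain ⟨q, π, hq, hqn⟩ := h.exists_tauPath (y := s.pos.2 - τ) (by simp [abs_of_pos hτ])
    rcases hqn.lt_or_eq with hlt | heq
    · exact ⟨_, .case2 s q π h.running h1 h2 hq hlt⟩
    · exact ⟨_, .case2Wall s q π h.running h1 h2 hq heq⟩
  by_cases h3 : Case3 M s
  · obtain ⟨q, π, hq, hqn⟩ := h.exists_tauPath (y := s.pos.2 + τ) (by simp [abs_of_pos hτ])
    rcases hqn.lt_or_eq with hlt | heq
    · exact ⟨_, .case3 s q π h.running h2 h3 hq hlt⟩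
    · exact ⟨_, .case3Wall s q π h.running h2 h3 hq heq⟩
  by_cases h4 : Case4 k M s
  · obtain ⟨c1, c2, _⟩ := id h4
    have c3 : (s.post s.cur (s.cnt s.cur)).1 ≤ (s.post (s.cur + 1) (s.cnt (s.cur + 1))).1 := by
      by_contra hcon
      exact h2 ⟨c1, not_le.1 hcon⟩
    have hm1 := h.tree.one_le_cnt_of_start_le ((h.tree.start_le hin).trans c3)
    have hpos := h.pos
    obtain ⟨π, hπ⟩ := exists_goDown h.tree (p := s.pos) hi ⟨by omega, c1, hm1, le_rfl⟩ hin c2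
      (by rw [hpos]; exact (h.tree.post _ _ hin).free rfl (by simpa using hτ.le))
      (by rw [hpos]) (by rw [hpos]; exact c3) (by rw [hpos])
    exact ⟨_, .case4 s π h.running h2 h3 h4 hπ⟩
  by_cases h5 : Case5 k M s
  · exact ⟨_, .case5 s h.running h2 h3 h4 h5⟩
  · refine ⟨_, .case6 s h.running h2 h3 h4 h5 ?_⟩
    -- On fence 1 the failure of the third case means that the fence is full, and then the fourth or
    -- the fifth case applies.
    by_contra hcon
    have hcur : s.cur = 1 := by omega
    have hle := h.fence.cnt_le _ hi h.fence.cur_le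
    have hM : s.cnt s.cur = M := by
      by_contra hne
      exact h3 (Or.inl ⟨hcur, by omega⟩)
    refine h.fence.cnt_ne_full (fun hik hlt _ => h4 ⟨hik, hlt, Or.inl hM⟩) h5 hM

theorem sum_lastPath_succ {f g : ℕ → List Pt} {i : ℕ} (hi : 1 ≤ i) (hfg : ∀ j, j ≤ i → g j = f j) :
    ∑ j ∈ Finset.Icc 2 (i + 1), pathLen (g j) =
      ∑ j ∈ Finset.Icc 2 i, pathLen (f j) + pathLen (g (i + 1)) := by
  rw [Finset.sum_Icc_succ_top (by omega)]
  congr 1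
  refine Finset.sum_congr rfl fun j hj => ?_
  rw [hfg j (Finset.mem_Icc.1 hj).2]

/-- A call of a subroutine preserves the invariant. -/
theorem StateInv.call (h : StateInv S τ L x₀ k M s) (hik : s.cur < k)
    (hm1 : 1 ≤ s.cnt (s.cur + 1)) {π : List Pt}
    (hπ : π.getLast? = some (s.post (s.cur + 1) (s.cnt (s.cur + 1))))
    (hr : ∀ r, CallInv x₀ k M s.cnt s.post s.cur r → ∃ r',
      CallInv x₀ k M s.cnt s.post (s.cur + 1) r' ∧
      totalCost τ x₀ k s.cnt s.post r + pathLen π ≤ totalCost τ x₀ k s.cnt s.post r') :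
    StateInv S τ L x₀ k M (((s.walk π (s.post (s.cur + 1) (s.cnt (s.cur + 1)))).setLastPath
      (s.cur + 1) π).setCur (s.cur + 1)) where
  running := h.running
  tree := h.tree
  fence := h.fence.descend hik hm1
  pos := rfl
  lastPath j h1 h2 := by
    simp only [RobotState.setCur, RobotState.setLastPath, RobotState.walk] at h2 ⊢
    rcases eq_or_ne j (s.cur + 1) with rfl | hne
    · rw [Function.update_self, hπ]
    · rw [Function.update_of_ne hne]
      exact h.lastPath j h1 (by omega)
  cost := by
    obtain ⟨r, h1, h2⟩ := h.cost
    obtain ⟨r', h3, h4⟩ := hr r h1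
    refine ⟨r', h3, ?_⟩
    simp only [RobotState.setCur, RobotState.setLastPath, RobotState.walk]
    rw [sum_lastPath_succ (f := s.lastPath) h.fence.one_le_cur
      (fun _ _ => Function.update_of_ne (by omega) _ _), Function.update_self]
    linarith

theorem StateInv.case1 (h : StateInv S τ L x₀ k M s) (hc : Case1 k s) {π : List Pt}
    (hgo : GoBackDown S τ s s.cur (s.cnt s.cur) (s.cnt (s.cur + 1)) π) :
    StateInv S τ L x₀ k M (((s.walk π (s.post (s.cur + 1) (s.cnt (s.cur + 1)))).setLastPath
      (s.cur + 1) π).setCur (s.cur + 1)) := by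
  obtain ⟨c1, c2, c3⟩ := hc
  obtain ⟨r, hr, _⟩ := h.cost
  have h1 := hgo.exists_pathLen_le_totalCost h.tree h.fence hr c1 c2 c3
  refine h.call c1 h1.1 h1.2.1 fun r hr => ?_
  obtain ⟨_, _, v, _, h2, h3⟩ := hgo.exists_pathLen_le_totalCost h.tree h.fence hr c1 c2 c3
  exact ⟨_, h2, h3⟩

theorem StateInv.last_le_of_not_case2 (hc : ¬ Case2 k s) (hik : s.cur < k) :
    (s.post s.cur (s.cnt s.cur)).1 ≤ (s.post (s.cur + 1) (s.cnt (s.cur + 1))).1 := by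
  by_contra hcon
  exact hc ⟨hik, not_le.1 hcon⟩

theorem StateInv.case4 (h : StateInv S τ L x₀ k M s) (h2 : ¬ Case2 k s) (hc : Case4 k M s)
    {π : List Pt} (hgo : GoDown S τ s s.cur (s.cnt (s.cur + 1)) s.pos π) :
    StateInv S τ L x₀ k M (((s.walk π (s.post (s.cur + 1) (s.cnt (s.cur + 1)))).setLastPath
      (s.cur + 1) π).setCur (s.cur + 1)) := by
  obtain ⟨c1, c2, c3⟩ := hc
  have h2' := StateInv.last_le_of_not_case2 h2 c1
  rw [h.pos] at hgo
  obtain ⟨r, hr, _⟩ := h.cost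
  have hm1 := h.tree.one_le_cnt_of_start_le ((h.tree.start_le h.fence.inTree_cur).trans h2')
  refine h.call c1 hm1 (hgo.pathLen_le_totalCost h.tree h.fence hr c1 h2' c2).1 fun r hr =>
    ⟨_, hr.call h.tree h.fence c1 c2 hm1 (hr.src_le_of_call c1 (Or.inr h2')) ?_
      (fun hlt => absurd hlt (lt_irrefl _)),
      (hgo.pathLen_le_totalCost h.tree h.fence hr c1 h2' c2).2⟩
  rcases c3 with c3 | ⟨u, u1, u2, u3, u4⟩
  · exact Or.inl c3
  · refine Or.inr (Or.inr ⟨u, u1, u2.le, u3.ge, ?_⟩)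
    rw [← u3]
    exact u4

theorem StateInv.case2 (h : StateInv S τ L x₀ k M s) (h1 : ¬ Case1 k s) (hc : Case2 k s)
    {p : Pt} {π : List Pt} (hgo : TauPath S τ (s.pos.1, s.pos.2 - τ) p π) (hp : p.1 < S.n) :
    StateInv S τ L x₀ k M ((((s.walk (s.pos :: π) p).addPost
      (s.cur + 1) p (s.treePath s.cur (s.cnt s.cur) ++ s.pos :: π)).setLastPath
      (s.cur + 1) (s.pos :: π)).setCur (s.cur + 1)) := by
  obtain ⟨c1, c2⟩ := hc
  have hτ := h.tree.one_le_tau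
  have hi := h.fence.one_le_cur
  have hin := h.fence.inTree_cur
  have hn := h.tree.lt_wall _ _ hin
  have hpos := h.pos
  have c2' : (s.post (s.cur + 1) (s.cnt (s.cur + 1))).1 < (s.post s.cur (s.cnt s.cur)).1 := c2
  have hedge : IsEdge S τ ((s.post s.cur (s.cnt s.cur)).2 - τ) (s.post s.cur (s.cnt s.cur)) p
      (s.pos :: π) := by
    refine ⟨by simp [abs_of_pos (by linarith : 0 < τ)], hn, hp, π, by rw [hpos], ?_⟩
    rw [← hpos]; exact hgo
  have hpX : (s.post s.cur (s.cnt s.cur)).1 ≤ p.1 := hedge.fst_le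
  have hanti := h.tree.anti _ hi c1
  -- The first case has failed, so at most one post is missing; with none missing, the posts would
  -- be ordered the other way.
  have hcnt : s.cnt (s.cur + 1) + 1 = s.cnt s.cur := by
    have h4 : ¬ s.cnt (s.cur + 1) + 1 < s.cnt s.cur := fun h4 => h1 ⟨c1, c2, h4⟩
    have h5 : s.cnt (s.cur + 1) ≠ s.cnt s.cur := by
      intro h5
      rw [h5] at c2'
      exact absurd (h.tree.fst_le_fence_succ (j := s.cur) (p := s.cnt s.cur)
        ⟨by omega, c1, h.fence.one_le_cnt, h5.ge⟩ hi) (not_le.2 c2')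
    omega
  have hE := s.extends_addPost (s.cur + 1) p (s.treePath s.cur (s.cnt s.cur) ++ s.pos :: π)
    (c2'.le.trans hpX)
  set s₁ := s.addPost (s.cur + 1) p (s.treePath s.cur (s.cnt s.cur) ++ s.pos :: π) with hs₁
  have hnew : s₁.post (s.cur + 1) (s.cnt (s.cur + 1) + 1) = p := s.addPost_post_self _ _ _
  have hlast : s₁.post (s.cur + 1) (s₁.cnt (s.cur + 1)) = p := by rw [hE.cnt_self, hnew]
  have htree : FenceTree S τ L x₀ k s₁.cnt s₁.post s₁.treePath := by
    refine h.tree.extend hE (fun i q hq => s.addPost_treePath _ _ _ hq) (by omega) ?_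
      (Or.inr ⟨s.cur, hi, rfl, ?_, s.pos :: π, ?_, ?_⟩)
    · intro j' _ hj'
      obtain rfl : j' = s.cur := by omega
      exact hcnt.le
    · rw [hcnt]; exact fun _ => c2'
    · rw [hnew, hcnt]; exact hedge
    · rw [hs₁, s.addPost_treePath_self, hcnt]
  obtain ⟨r, hr, hcost⟩ := h.cost
  refine ⟨h.running, htree, ?_, ?_, ?_, r, ?_, ?_⟩
  · exact h.fence.extend_succ hE c1 (hcnt.le.trans (h.fence.cnt_le _ hi h.fence.cur_le))
  · exact hlast.symm
  · intro j h2 h3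
    show (Function.update s.lastPath (s.cur + 1) (s.pos :: π) j).getLast? =
      some (s₁.post j (s₁.cnt j))
    have h3' : j ≤ s.cur + 1 := h3
    rcases eq_or_ne j (s.cur + 1) with rfl | hne
    · rw [Function.update_self, hedge.getLast?, hlast]
    · rw [Function.update_of_ne hne, hE.last_of_ne hne]
      exact h.lastPath j h2 (by omega)
  · exact hr.extend_succ h.tree hE
  · have h2 := totalCost_extends (x₀ := x₀) h.tree.tau_pos hE (by omega) c1 (h.tree.start_le hin) c2'.le r
    rw [hnew] at h2
    show s.dist + pathLen (s.pos :: π) + ∑ j ∈ Finset.Icc 2 (s.cur + 1),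
      pathLen (Function.update s.lastPath (s.cur + 1) (s.pos :: π) j) ≤
        2 * totalCost τ x₀ k s₁.cnt s₁.post r
    rw [sum_lastPath_succ (f := s.lastPath) hi
      (fun _ _ => Function.update_of_ne (by omega) _ _), Function.update_self]
    have h4 := hedge.pathLen_le (by linarith)
    have h5 : (1 + 2 * τ) * (p.1 - (s.post s.cur (s.cnt s.cur)).1) ≤
        3 * τ * (p.1 - (s.post s.cur (s.cnt s.cur)).1) :=
      mul_le_mul_of_nonneg_right (by linarith) (by linarith)
    linarith

theorem StateInv.case3 (h : StateInv S τ L x₀ k M s) (h2 : ¬ Case2 k s) (hc : Case3 M s)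
    {p : Pt} {π : List Pt} (hgo : TauPath S τ (s.pos.1, s.pos.2 + τ) p π) (hp : p.1 < S.n) :
    StateInv S τ L x₀ k M (((s.walk (s.pos :: π) p).addPost
      s.cur p (s.treePath s.cur (s.cnt s.cur) ++ s.pos :: π)).setLastPath
      s.cur (s.lastPath s.cur ++ s.pos :: π)) := by
  have hτ := h.tree.one_le_tau
  have hi := h.fence.one_le_cur
  have hin := h.fence.inTree_cur
  have hn := h.tree.lt_wall _ _ hin
  have hpos := h.pos
  have h2' := StateInv.last_le_of_not_case2 h2
  have hedge : IsEdge S τ ((s.post s.cur (s.cnt s.cur)).2 + τ) (s.post s.cur (s.cnt s.cur)) p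
      (s.pos :: π) := by
    refine ⟨by simp [abs_of_pos (by linarith : 0 < τ)], hn, hp, π, by rw [hpos], ?_⟩
    rw [← hpos]; exact hgo
  have hpX : (s.post s.cur (s.cnt s.cur)).1 ≤ p.1 := hedge.fst_le
  have hc' : ∀ l, 1 ≤ l → s.cur = l + 1 → s.cnt s.cur + 1 < s.cnt l ∨
      (s.cnt l = s.cnt s.cur + 1 ∧
        (s.post l (s.cnt l)).1 ≤ (s.post s.cur (s.cnt s.cur)).1) := by
    intro l hl heq
    have hl' : s.cur - 1 = l := by omega
    rcases hc with hc | ⟨_, hc⟩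
    · omega
    · rw [hl'] at hc; exact hc
  have hM : s.cnt s.cur + 1 ≤ M := by
    rcases hc with hc | ⟨hc, hc1⟩
    · exact hc.2
    · have := h.fence.cnt_le (s.cur - 1) (by omega) (by have := h.fence.cur_le; omega)
      omega
  have hE := s.extends_addPost s.cur p (s.treePath s.cur (s.cnt s.cur) ++ s.pos :: π) hpX
  set s₁ := s.addPost s.cur p (s.treePath s.cur (s.cnt s.cur) ++ s.pos :: π) with hs₁
  have hnew : s₁.post s.cur (s.cnt s.cur + 1) = p := s.addPost_post_self _ _ _
  have hlast : s₁.post s.cur (s₁.cnt s.cur) = p := by rw [hE.cnt_self, hnew]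
  have htree : FenceTree S τ L x₀ k s₁.cnt s₁.post s₁.treePath := by
    refine h.tree.extend hE (fun i q hq => s.addPost_treePath _ _ _ hq) hi ?_
      (Or.inl ⟨h.fence.one_le_cnt, ?_, s.pos :: π, ?_, ?_⟩)
    · intro j' h3 h4
      have := hc' j' h3 h4
      omega
    · intro j' h3 h4
      rcases hc' j' h3 h4 with h5 | ⟨h5, h6⟩
      · exact h.fence.le_last j' s.cur _ h3 (by omega) h.fence.cur_le (by omega) h5
      · rwa [← h5]
    · rw [hnew]; exact hedge
    · rw [hs₁, s.addPost_treePath_self]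
  obtain ⟨r, hr, hcost⟩ := h.cost
  have hlp := h.lastPath s.cur hi le_rfl
  refine ⟨h.running, htree, ?_, ?_, ?_, r, ?_, ?_⟩
  · exact h.fence.extend hE hM h2'
  · exact hlast.symm
  · intro j h3 h4
    show (Function.update s.lastPath s.cur (s.lastPath s.cur ++ s.pos :: π) j).getLast? =
      some (s₁.post j (s₁.cnt j))
    rcases eq_or_ne j s.cur with rfl | hne
    · rw [Function.update_self, List.getLast?_append, hedge.getLast?, hlast]; rfl
    · rw [Function.update_of_ne hne, hE.last_of_ne hne]
      exact h.lastPath j h3 h4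
  · exact hr.extend h.tree h.fence hE h2' hc'
  · have h5 := totalCost_extends (x₀ := x₀) h.tree.tau_pos hE hi h.fence.cur_le
      (h.tree.start_le hin) le_rfl r
    rw [hnew] at h5
    show s.dist + pathLen (s.pos :: π) + ∑ j ∈ Finset.Icc 2 s.cur,
      pathLen (Function.update s.lastPath s.cur (s.lastPath s.cur ++ s.pos :: π) j) ≤
        2 * totalCost τ x₀ k s₁.cnt s₁.post r
    have h6 : ∑ j ∈ Finset.Icc 2 s.cur,
        pathLen (Function.update s.lastPath s.cur (s.lastPath s.cur ++ s.pos :: π) j) ≤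
        ∑ j ∈ Finset.Icc 2 s.cur, (pathLen (s.lastPath j) +
          if j = s.cur then pathLen (s.pos :: π) else 0) := by
      refine Finset.sum_le_sum fun j _ => ?_
      rcases eq_or_ne j s.cur with rfl | hne
      · rw [Function.update_self, pathLen_append hlp hedge.head?, if_pos rfl]
      · rw [Function.update_of_ne hne, if_neg hne, add_zero]
    rw [Finset.sum_add_distrib, Finset.sum_ite_eq'] at h6
    -- Paths on fence 1 are never retraced and do not enter the sum.
    have h7 : (if s.cur ∈ Finset.Icc 2 s.cur then pathLen (s.pos :: π) else 0) ≤
        pathLen (s.pos :: π) := by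
      split_ifs
      · exact le_rfl
      · exact pathLen_nonneg _
    have h8 := hedge.pathLen_le (by linarith)
    have h9 : (1 + 2 * τ) * (p.1 - (s.post s.cur (s.cnt s.cur)).1) ≤
        3 * τ * (p.1 - (s.post s.cur (s.cnt s.cur)).1) :=
      mul_le_mul_of_nonneg_right (by linarith) (by linarith)
    linarith

theorem StateInv.case6 (h : StateInv S τ L x₀ k M s) (h2 : ¬ Case2 k s) (h3 : ¬ Case3 M s)
    (h4 : ¬ Case4 k M s) (h5 : ¬ Case5 k M s) (hi : 1 < s.cur) :
    StateInv S τ L x₀ k M ((s.walk (s.lastPath s.cur).reverse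
      (s.post (s.cur - 1) (s.cnt (s.cur - 1)))).setCur (s.cur - 1)) := by
  obtain ⟨i, hcur⟩ : ∃ i, s.cur = i + 1 := ⟨s.cur - 1, by omega⟩
  have hi1 : 1 ≤ i := by omega
  have h2' := fun hik => StateInv.last_le_of_not_case2 h2 hik
  have h3' : ¬ (s.cnt s.cur + 1 < s.cnt (s.cur - 1) ∨
      (s.cnt (s.cur - 1) = s.cnt s.cur + 1 ∧ (s.post (s.cur - 1) (s.cnt (s.cur - 1))).1 ≤
        (s.post s.cur (s.cnt s.cur)).1)) := fun h => h3 (Or.inr ⟨hi, h⟩)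
  have h4' : s.cur < k → s.cnt (s.cur + 1) < s.cnt s.cur → s.cnt s.cur ≠ M :=
    fun c1 c2 c3 => h4 ⟨c1, c2, Or.inl c3⟩
  have h4'' : s.cur < k → s.cnt (s.cur + 1) < s.cnt s.cur → ∀ u, 1 ≤ u → u < s.cur →
      s.cnt u = s.cnt s.cur + 1 →
      (s.post u (s.cnt u)).1 ≤ (s.post (s.cur + 1) (s.cnt (s.cur + 1))).1 := by
    intro c1 c2 u u1 u2 u3
    by_contra hcon
    exact h4 ⟨c1, c2, Or.inr ⟨u, u1, u2, u3, not_le.1 hcon⟩⟩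
  have h5' : ¬ (s.cur = k ∧ s.cnt s.cur = M) := h5
  obtain ⟨r, hr, hcost⟩ := h.cost
  have hI := h.fence
  have hlast := h.lastPath
  rw [hcur, Nat.add_sub_cancel] at *
  refine ⟨h.running, h.tree, ?_, rfl, ?_, r, ?_, ?_⟩
  · exact hI.ascend h.tree hi1 h2' h4' h5'
  · exact fun j j1 j2 => hlast j j1 (le_trans j2 (Nat.le_succ i))
  · exact hr.ascend h.tree hI hi1 h3' h2' h4''
  -- The length of the retraced path moves from the sum to the distance; the potential is unchanged.
  · show s.dist + pathLen (s.lastPath (i + 1)).reverse +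
      ∑ j ∈ Finset.Icc 2 i, pathLen (s.lastPath j) ≤ 2 * totalCost τ x₀ k s.cnt s.post r
    rw [sum_lastPath_succ (f := s.lastPath) hi1 (fun _ _ => rfl)] at hcost
    rw [pathLen_reverse]
    linarith

end Steps

/-! ## Termination and the bound -/

section Termination

variable {S : Scene} {τ L x₀ : ℝ} {k M : ℕ} {s s' : RobotState}

/-- A step preserves the invariant or halts; in the latter case, the distance is bounded. -/
theorem StateInv.step (h : StateInv S τ L x₀ k M s) (hkL : k * τ ≤ L) (hML : M * τ ≤ 3 * L)
    (hs : FindFenceTreeStep S τ k M s s') :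
    StateInv S τ L x₀ k M s' ∨
      (s'.halted = true ∧ s'.dist ≤ k * (60 * L + 62 * τ * (s'.pos.1 - x₀))) := by
  have hτ := h.tree.one_le_tau
  have hin := h.fence.inTree_cur
  have hn := h.tree.lt_wall _ _ hin
  have hk : (1 : ℝ) ≤ k := by exact_mod_cast h.fence.one_le_cur.trans h.fence.cur_le
  have hX := h.tree.start_le hin
  have hτL : τ ≤ L := le_trans (by nlinarith) hkL
  have hpos := h.pos
  have hbound : ∀ {x : ℝ}, (∀ j p, InTree k s.cnt j p → (s.post j p).1 ≤ x) →
      s.dist ≤ k * (57 * L + 30 * τ * (x - x₀)) := fun hx =>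
    (h.dist_le hx).trans (mul_le_mul_of_nonneg_left (by linarith) (by linarith))
  -- The final edge costs at most 2τ + 3τΔx, and τ ≤ L.
  have hwall : ∀ {p : Pt} {y : ℝ} {π : List Pt}, TauPath S τ (s.pos.1, y) p π →
      |s.pos.2 - y| = τ → p.1 = S.n → s.dist + pathLen (s.pos :: π) ≤
        k * (60 * L + 62 * τ * (p.1 - x₀)) := by
    intro p y π hgo hy hp
    have h1 := hgo.pathLen_cons_le h.tree.tau_pos (by rw [hpos]; exact hn.le) hy
    have h2 := hbound (x := S.n) fun j p hjp => (h.tree.lt_wall j p hjp).le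
    rw [← hp] at h2
    have h3 : x₀ ≤ s.pos.1 := by rw [hpos]; exact hX
    have h4 : s.pos.1 ≤ p.1 := by rw [hpos, hp]; exact hn.le
    have h5 : (1 + 2 * τ) * (p.1 - s.pos.1) ≤ 3 * τ * (p.1 - x₀) :=
      mul_le_mul (by linarith) (by linarith) (by linarith) (by linarith)
    have h6 : 0 ≤ τ * (p.1 - x₀) := mul_nonneg (by linarith) (by linarith)
    have h7 : 1 * (2 * L + 3 * (τ * (p.1 - x₀))) ≤ k * (2 * L + 3 * (τ * (p.1 - x₀))) :=
      mul_le_mul_of_nonneg_right hk (by linarith)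
    have h8 : (0 : ℝ) ≤ k * (L + 29 * (τ * (p.1 - x₀))) :=
      mul_nonneg (by linarith) (by linarith)
    linarith
  have habs : |τ| = τ := abs_of_pos h.tree.tau_pos
  cases hs with
  | case1 π hrun hc hgo => exact Or.inl (h.case1 hc hgo)
  | case2 p π hrun h1 hc hgo hp => exact Or.inl (h.case2 h1 hc hgo hp)
  | case2Wall p π hrun h1 hc hgo hp =>
    exact Or.inr ⟨rfl, hwall hgo (by rw [sub_sub_cancel, habs]) hp⟩
  | case3 p π hrun h2 hc hgo hp => exact Or.inl (h.case3 h2 hc hgo hp)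
  | case3Wall p π hrun h2 hc hgo hp =>
    exact Or.inr ⟨rfl, hwall hgo (by rw [sub_add_cancel_left, abs_neg, habs]) hp⟩
  | case4 π hrun h2 h3 hc hgo => exact Or.inl (h.case4 h2 hc hgo)
  | case5 hrun h2 h3 h4 hc =>
    refine Or.inr ⟨rfl, ?_⟩
    show s.dist ≤ k * (60 * L + 62 * τ * (s.pos.1 - x₀))
    -- The `M`-th post of the lowest fence is the rightmost of all posts.
    have h1 := hbound (x := s.pos.1) fun j p hjp => by
      rw [hpos]
      have hle : p ≤ s.cnt s.cur := by
        rw [hc.2]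
        exact hjp.2.2.2.trans (h.fence.cnt_le j hjp.1 hjp.2.1)
      exact h.tree.fst_mono hin hjp.1 (hjp.2.1.trans hc.1.ge) hjp.2.2.1 hle
    have h3 : x₀ ≤ s.pos.1 := by rw [hpos]; exact hX
    have h6 : 0 ≤ τ * (s.pos.1 - x₀) := mul_nonneg (by linarith) (by linarith)
    have h8 : (0 : ℝ) ≤ k * (3 * L + 32 * (τ * (s.pos.1 - x₀))) :=
      mul_nonneg (by linarith) (by linarith)
    linarith
  | case6 hrun h2 h3 h4 h5 hi => exact Or.inl (h.case6 h2 h3 h4 h5 hi)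

open Classical in
/-- The termination measure. -/
noncomputable def progress (k M : ℕ) (s : RobotState) : ℕ :=
  (k * M - ∑ j ∈ Finset.Icc 1 k, s.cnt j) * (k + 2) +
    if Case3 M s ∧ ¬ Case2 k s then 0 else s.cur + 1

theorem StateInv.sum_cnt_le (h : StateInv S τ L x₀ k M s) :
    ∑ j ∈ Finset.Icc 1 k, s.cnt j ≤ k * M := by
  have := Finset.sum_le_card_nsmul (Finset.Icc 1 k) s.cnt M fun j hj => by
    rw [Finset.mem_Icc] at hj
    exact h.fence.cnt_le j hj.1 hj.2
  rwa [Nat.card_Icc, smul_eq_mul, Nat.add_sub_cancel] at this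

/-- A new post lowers the first summand by k + 2, while the second one is at most k + 1. -/
theorem progress_lt_of_extends (h' : StateInv S τ L x₀ k M s') {j : ℕ}
    (hE : Extends s.cnt s'.cnt s.post s'.post j) (hj : 1 ≤ j) (hjk : j ≤ k) :
    progress k M s' < progress k M s := by
  have h1 : ∑ l ∈ Finset.Icc 1 k, s'.cnt l = ∑ l ∈ Finset.Icc 1 k, s.cnt l + 1 := by
    have : ∀ l, s'.cnt l = s.cnt l + if l = j then 1 else 0 := fun l => by
      split_ifs with hl
      · rw [hl, hE.cnt_self]
      · rw [hE.cnt_of_ne l hl, add_zero]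
    rw [Finset.sum_congr rfl fun l _ => this l, Finset.sum_add_distrib, Finset.sum_ite_eq',
      if_pos (Finset.mem_Icc.2 ⟨hj, hjk⟩)]
  have h2 := h'.sum_cnt_le
  have h3 := h'.fence.cur_le
  obtain ⟨d, hd⟩ : ∃ d, k * M = ∑ l ∈ Finset.Icc 1 k, s'.cnt l + d := ⟨_, (Nat.add_sub_of_le h2).symm⟩
  have h4 : k * M - ∑ l ∈ Finset.Icc 1 k, s'.cnt l = d := by omega
  have h5 : k * M - ∑ l ∈ Finset.Icc 1 k, s.cnt l = d + 1 := by omega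
  rw [progress, progress, h4, h5, add_mul]
  split_ifs <;> omega

theorem progress_lt_of_case3 (hcnt : s'.cnt = s.cnt) (hs : ¬ (Case3 M s ∧ ¬ Case2 k s))
    (hs' : Case3 M s' ∧ ¬ Case2 k s') : progress k M s' < progress k M s := by
  rw [progress, progress, if_neg hs, if_pos hs', hcnt]
  omega

theorem progress_lt_of_cur_lt (hcnt : s'.cnt = s.cnt) (hs : ¬ (Case3 M s ∧ ¬ Case2 k s))
    (hcur : s'.cur < s.cur) : progress k M s' < progress k M s := by
  rw [progress, progress, if_neg hs, hcnt]
  split_ifs <;> omega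

/-- After a call the second case cannot apply, because the last posts below the calling fence are
ordered, and the condition of the call is just what enables an up-edge on the new fence. -/
theorem StateInv.progress_lt (h : StateInv S τ L x₀ k M s) (h' : StateInv S τ L x₀ k M s')
    (hs : FindFenceTreeStep S τ k M s s') : progress k M s' < progress k M s := by
  have hi := h.fence.one_le_cur
  have hnot2 : ∀ π, ¬ Case2 k (((s.walk π (s.post (s.cur + 1) (s.cnt (s.cur + 1)))).setLastPath
      (s.cur + 1) π).setCur (s.cur + 1)) := fun π hc =>
    absurd (h.fence.last_le_succ (s.cur + 1) (Nat.lt_succ_self _) hc.1) (not_le.2 hc.2)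
  cases hs with
  | case1 π hrun hc hgo =>
    exact progress_lt_of_case3 rfl (fun hn => hn.2 ⟨hc.1, hc.2.1⟩)
      ⟨Or.inr ⟨Nat.lt_succ_of_le hi, Or.inl hc.2.2⟩, hnot2 π⟩
  | case2 p π hrun h1 hc hgo hp =>
    refine progress_lt_of_extends h' (s.extends_addPost (s.cur + 1) p
      (s.treePath s.cur (s.cnt s.cur) ++ s.pos :: π) ?_) (by omega) hc.1
    have hn := h.tree.lt_wall _ _ h.fence.inTree_cur
    have h2 := (hgo.spec (by rw [h.pos]; exact hn.le)).2.2.1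
    rw [h.pos] at h2
    exact hc.2.le.trans h2
  | case2Wall p π hrun h1 hc hgo hp => exact absurd h'.running (by simp [RobotState.halt])
  | case3 p π hrun h2 hc hgo hp =>
    refine progress_lt_of_extends h' (s.extends_addPost s.cur p
      (s.treePath s.cur (s.cnt s.cur) ++ s.pos :: π) ?_) hi h.fence.cur_le
    have hn := h.tree.lt_wall _ _ h.fence.inTree_cur
    have h2 := (hgo.spec (by rw [h.pos]; exact hn.le)).2.2.1
    rw [h.pos] at h2
    exact h2
  | case3Wall p π hrun h2 hc hgo hp => exact absurd h'.running (by simp [RobotState.halt])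
  | case4 π hrun h2 h3 hc hgo =>
    refine progress_lt_of_case3 rfl (fun hn => h3 hn.1)
      ⟨Or.inr ⟨Nat.lt_succ_of_le hi, ?_⟩, hnot2 π⟩
    rcases (Nat.succ_le_of_lt hc.2.1).lt_or_eq with hlt | heq
    · exact Or.inl hlt
    · exact Or.inr ⟨heq.symm, StateInv.last_le_of_not_case2 h2 hc.1⟩
  | case5 hrun h2 h3 h4 hc => exact absurd h'.running (by simp [RobotState.halt])
  | case6 hrun h2 h3 h4 h5 hi =>
    exact progress_lt_of_cur_lt rfl (fun hn => h3 hn.1) (Nat.sub_lt (by omega) one_pos)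

theorem FindFenceTreeStep.running (hs : FindFenceTreeStep S τ k M s s') : s.halted = false := by
  cases hs <;> assumption

theorem not_exists_infinite_run (hkL : k * τ ≤ L) (hML : M * τ ≤ 3 * L)
    (h : StateInv S τ L x₀ k M s) :
    ¬ ∃ f : ℕ → RobotState, f 0 = s ∧ ∀ j, FindFenceTreeStep S τ k M (f j) (f (j + 1)) := by
  obtain ⟨N, hN⟩ : ∃ N, N = progress k M s := ⟨_, rfl⟩
  induction N using Nat.strong_induction_on generalizing s with
  | _ N ih =>
    rintro ⟨f, rfl, hf⟩
    rcases h.step hkL hML (hf 0) with h1 | ⟨h1, _⟩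
    · exact ih _ (by rw [hN]; exact h.progress_lt h1 (hf 0)) h1 rfl
        ⟨fun j => f (j + 1), rfl, fun j => hf (j + 1)⟩
    · have := (hf 1).running
      rw [h1] at this
      exact absurd this (by simp)

theorem stateInv_initState (hτ : 1 ≤ τ) (hx₀ : 0 < x₀) (hx₀n : x₀ < S.n) (hk : 1 ≤ k) (hM : 1 ≤ M)
    (hroot : IsPost S τ (x₀, -L)) : StateInv S τ L x₀ k M (initState (x₀, -L)) := by
  have hin : ∀ j p, InTree k (initState (x₀, -L)).cnt j p → j = 1 ∧ p = 1 := by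
    rintro j p ⟨h1, h2, h3, h4⟩
    simp only [initState] at h4
    split_ifs at h4 <;> omega
  refine ⟨rfl, ⟨hτ, hx₀, ?_, ?_, ?_, ?_, ?_, ?_, ?_, ?_, ?_⟩, ⟨le_rfl, hk, ?_, ?_, ?_, ?_, ?_⟩, ?_, ?_,
    ⟨fun _ => 0, fun _ => 0, fun _ => 0, fun _ => x₀, fun _ => x₀, fun _ => x₀⟩,
    ⟨?_, ?_, ?_, ?_, ?_, ?_, ?_⟩, ?_⟩
  · simp [initState]
  · intro j h1 h2
    simp only [initState]
    split_ifs <;> omega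
  · simp [initState]
  · simp [initState]
  · intro j; simp [initState]
  · intro j p hjp
    obtain ⟨rfl, rfl⟩ := hin j p hjp
    simp [initState]
  · intro j p hjp
    obtain ⟨rfl, rfl⟩ := hin j p hjp
    simpa [initState] using hroot
  · intro j p hjp
    obtain ⟨rfl, rfl⟩ := hin j p hjp
    simpa [initState] using hx₀n
  · exact fun j p hjp => Or.inl (hin j p hjp)
  · simp [initState]
  · intro j h1 h2
    simp only [initState]
    split_ifs <;> omega
  · intro j h1 h2 h3
    simp only [initState] at h3 ⊢
    split_ifs at h3 <;> omega
  · intro j h1 h2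
    have h1' : 1 < j := h1
    have h3 : j ≠ 1 := by omega
    have h4 : j ≠ 0 := by omega
    simp [initState, h3, h4]
  · intro j j' p h1 h2 h3 h4 h5
    simp only [initState] at h5
    split_ifs at h5 <;> omega
  · simp [initState]
  · intro j h1 h2
    have h2' : j ≤ 1 := h2
    obtain rfl : j = 1 := by omega
    simp [initState]
  · exact fun _ _ _ => Nat.zero_le _
  · exact fun _ _ _ => Nat.zero_le _
  · exact fun _ _ _ _ => Nat.zero_le _
  · exact fun _ => Or.inl (Nat.zero_le _)
  · exact fun _ _ _ => Or.inl ⟨rfl, rfl⟩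
  · exact fun _ _ _ => Or.inl rfl
  · exact fun _ _ _ => Or.inl ⟨rfl, rfl⟩
  · have h1 : (initState (x₀, -L)).dist + ∑ j ∈ Finset.Icc 2 (initState (x₀, -L)).cur,
        pathLen ((initState (x₀, -L)).lastPath j) = 0 := by simp [initState]
    rw [h1]
    refine mul_nonneg zero_le_two (add_nonneg (Finset.sum_nonneg fun j _ => ?_)
      (Finset.sum_nonneg fun j _ => ?_))
    · have h2 := le_max_left x₀ ((initState (x₀, -L)).post j ((initState (x₀, -L)).cnt j)).1
      rw [fenceCost]
      have h3 : 0 ≤ 3 * τ * (max x₀ ((initState (x₀, -L)).post j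
          ((initState (x₀, -L)).cnt j)).1 - x₀) := mul_nonneg (by linarith) (by linarith)
      positivity
    · simp [callCost]

/-- Both follow from k ≤ √(nk) ≤ L. -/
theorem tau_bounds {n : ℝ} (hk : 1 ≤ k) (hkn : (k : ℝ) ≤ n) (hL : n ≤ L)
    (hτ : τ = L / Real.sqrt (n * k)) : 1 ≤ τ ∧ k * τ ≤ L := by
  have hk' : (1 : ℝ) ≤ k := by exact_mod_cast hk
  have hpos : 0 < Real.sqrt (n * k) := Real.sqrt_pos.2 (mul_pos (by linarith) (by linarith))
  have h1 : Real.sqrt (n * k) ≤ L := Real.sqrt_le_iff.2 ⟨by linarith, by nlinarith⟩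
  have h2 : (k : ℝ) ≤ Real.sqrt (n * k) := Real.le_sqrt_of_sq_le (by nlinarith)
  rw [hτ]
  refine ⟨(one_le_div hpos).2 h1, ?_⟩
  rw [← mul_div_assoc, div_le_iff₀ hpos, mul_comm]
  exact mul_le_mul_of_nonneg_left h2 (by linarith)

end Termination

theorem theorem9 (S : Scene) (k M : ℕ) (L τ x₀ : ℝ)
    (hk : 1 ≤ k) (hkn : (k : ℝ) ≤ S.n) (hL : S.n ≤ L)
    (hτ : τ = L / Real.sqrt (S.n * k))
    (hM : 1 ≤ M) (hML : ((M : ℝ) - k) * τ ≤ 2 * L)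
    (hx₀ : 0 < x₀) (hx₀n : x₀ < S.n) (hroot : IsPost S τ (x₀, -L)) :
    Terminates S τ k M (x₀, -L) ∧
      ∀ s : RobotState, Reachable S τ k M (x₀, -L) s → s.halted = true →
        s.dist ≤ k * (60 * L + 62 * τ * (s.pos.1 - x₀)) := by
  obtain ⟨h1τ, hkL⟩ := tau_bounds hk hkn hL hτ
  have hML' : M * τ ≤ 3 * L := by linarith
  have hinit := stateInv_initState (M := M) h1τ hx₀ hx₀n hk hM hroot
  have hreach : ∀ s, Reachable S τ k M (x₀, -L) s → StateInv S τ L x₀ k M s ∨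
      (s.halted = true ∧ s.dist ≤ k * (60 * L + 62 * τ * (s.pos.1 - x₀))) := by
    intro s hs
    induction hs with
    | refl => exact Or.inl hinit
    | tail _ hstep ih =>
      rcases ih with ih | ⟨ih, _⟩
      · exact ih.step hkL hML' hstep
      · rw [hstep.running] at ih
        exact absurd ih (by simp)
  refine ⟨⟨fun s hs hrun => ?_, not_exists_infinite_run hkL hML' hinit⟩, fun s hs hhalt => ?_⟩
  · rcases hreach s hs with h | ⟨h, _⟩
    · exact h.exists_step
    · rw [hrun] at h
      exact absurd h (by simp)
  · rcases hreach s hs with h | ⟨_, h⟩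
    · have := h.running
      rw [hhalt] at this
      exact absurd this (by simp)
    · exact h
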